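/- Let $d\in\{2,3\}$. Let $F:(0,1)^d\to\Omega_0\subset\mathbb R^d$ be a bi-Lipschitz bijection whose components are tensor-product splines (degrees $k_{F,i}$, regularities $0\le r_{F,i}<k_{F,i}$) on a coarse Cartesian mesh. Fix integers $0\le r<k$ (degree $k$, regularity $r$), a viscosity $\mu>0$, a threshold $\theta\in(0,1]$, and constants $\sigma,C,N,L$. *Configurations.* Consider any trimmed domain $\Omega=\Omega_0\setminus\overline{\Omega_1}$ whose boundary $\Gamma$ is Lipschitz with character $(N,L)$ ($\Gamma$ is covered by $N$ open sets, in each of which $\Omega$ is, up to a rotation, the set above the graph of an $L$-Lipschitz function); any relatively open $\Gamma_D\subseteq\Gamma$, with outward unit normal $n$; and any Cartesian mesh of $(0,1)^d$ that refines the coarse one by insertion of breakpoints and satisfies $\operatorname{diam}Q\le\sigma\,\ell$ for each element $Q$ and each edge length $\ell$ of $Q$. The physical elements are $K=F(Q)$, with $Q$ open, and $h_K=\operatorname{diam}K$; $K$ is active if $K\cap\Omega\neq\emptyset$; an active $K$ is cut if $K\cap\Gamma\ne\emptyset$, good if $|K\cap\Omega|/|K|\ge\theta$, and bad otherwise. We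 assume that each bad $K$ has a good neighbor $K'\neq K$, and we choose one: $K'$ is good, $\operatorname{dist}(K,K')\le C h_K$, and $K'$ is contained in the union of the closed active non-cut elements. Let $\mathsf h=h_K$ on $K$ (on $\Gamma_D$, boundary values of elementwise quantities are taken from the element on the side of $\Omega$). *Spaces.* Let $S^{p}_{s}$ be the tensor-product spline space on the mesh, with degree $p_l$ and regularity $s_l$ at the internal breakpoints in direction $l$. The parametric velocity space $\hat V_h$ consists of the vector fields whose $i$-th component has: for Raviart–Thomas (RT), degree $k+1$ and regularity $r+1$ in direction $i$, and $k$ and $r$ in the others; for Nédélec (N), degree $k+1$ in all directions, regularity $r+1$ in direction $i$ and $r$ in the others; for Taylor–Hood (TH), degree $k+1$ and regularity $r$ in all directions. Let $V_h$ be the space of the restrictions to $\Omega$ of the fields $v$ on $\Omega_0$ with $\det(DF)\,DF^{-1}(v\circ F)\in\hat V_h$ (RT, N), respectively $v\circ F\in\hat V_h$ (TH). Define $R_h^v(v)|_K=v|_K$ if $K$ is good; if $K$ is bad, $R_h^v(v)|_K$ is the polynomial extension to $K$ of the $L^2(K')$-orthogonal projection of $v$ onto $\mathbb V_k(K')$,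 the vector polynomials on $K'$ in the physical coordinates with each component of degree at most $k+1$ in each variable (N, TH), respectively with $i$-th component of degree at most $k+1$ in $x_i$ and at most $k$ in the other variables (RT). *Form and norm.* For $w,v\in V_h$ and $\gamma>0$, with $Dv$ taken element by element, let $$\bar a_h(w,v)=\int_\Omega\mu\,Dw:Dv-\int_{\Gamma_D}\mu\,DR_h^v(w)n\cdot v-\int_{\Gamma_D}\mu\,w\cdot DR_h^v(v)n+\gamma\int_{\Gamma_D}\mathsf h^{-1}w\cdot v,$$ $$\|v\|_{1,h}^2=\|\mu^{1/2}Dv\|_{L^2(\Omega)}^2+\|\mathsf h^{-1/2}\mu^{1/2}v\|_{L^2(\Gamma_D)}^2 .$$ *Claim.* For each of the three families RT, N, TH there exist $\bar\gamma>0$ and $\alpha>0$ such that, for every $\gamma\ge\bar\gamma$ and every configuration as above, $$\alpha\|v\|_{1,h}^2\le\bar a_h(v,v)\qquad\forall\,v\in V_h,$$ and, for every $\gamma\ge\bar\gamma$, there exists $M_a>0$ such that, for every configuration as above, $$|\bar a_h(w,v)|\le M_a\|w\|_{1,h}\|v\|_{1,h}\qquad\forall\,w,v\in V_h.$$ Thus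 $\bar\gamma$, $\alpha$ (and $M_a$, for given $\gamma$) depend only on $d,F,k,r,\mu,\theta,\sigma,C,N,L$ and the family of elements, and not on the mesh size or on the way the mesh is cut. -/

import Mathlib

open MeasureTheory Filter Topology
open scoped NNReal ENNReal

noncomputable section

namespace TrimmedStokes

/-- Euclidean space of dimension `d`. -/
abbrev E (d : ℕ) := EuclideanSpace ℝ (Fin d)

/-! ### Splines -/

/-- The Cox-de Boor recursion: `bspline ξ p i` is the `i`-th B-spline of degree `p` on the knots
`ξ 0 ≤ ξ 1 ≤ …` (indices start at `0`; the convention `0 / 0 = 0` is the usual one). -/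
def bspline (ξ : ℕ → ℝ) : ℕ → ℕ → ℝ → ℝ
  | 0, i, x => if ξ i ≤ x ∧ x < ξ (i + 1) then 1 else 0
  | p + 1, i, x =>
      (x - ξ i) / (ξ (i + p + 1) - ξ i) * bspline ξ p i x
        + (ξ (i + p + 2) - x) / (ξ (i + p + 2) - ξ (i + 1)) * bspline ξ p (i + 1) x

/-- Breakpoints `0 = ζ i 0 < ζ i 1 < … < ζ i (n i) = 1` in each direction `i`, that is, a Cartesian
grid of the parametric domain `(0,1)^d`. -/
structure CartesianMesh (d : ℕ) where
  n : Fin d → ℕ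
  ζ : (i : Fin d) → Fin (n i + 1) → ℝ
  strictMono : ∀ i, StrictMono (ζ i)
  first : ∀ i, ζ i 0 = 0
  last : ∀ i, ζ i (Fin.last (n i)) = 1

namespace CartesianMesh

variable {d : ℕ}

/-- Multi-indices of the Bézier elements. -/
abbrev Cell (T : CartesianMesh d) := (i : Fin d) → Fin (T.n i)

/-- The (open) parametric Bézier element with multi-index `j`. -/
def Q (T : CartesianMesh d) (j : T.Cell) : Set (E d) :=
  {x | ∀ i, x i ∈ Set.Ioo (T.ζ i (j i).castSucc) (T.ζ i (j i).succ)}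

/-- `T` is obtained from `T₀` by inserting breakpoints. -/
def Refines (T T₀ : CartesianMesh d) : Prop :=
  ∀ i, Set.range (T₀.ζ i) ⊆ Set.range (T.ζ i)

/-- Shape regularity with constant `σ`: the diameter of each element is at most `σ` times each of
its edges. -/
def ShapeRegular (T : CartesianMesh d) (σ : ℝ) : Prop :=
  ∀ (j : T.Cell) (i : Fin d),
    Metric.diam (T.Q j) ≤ σ * (T.ζ i (j i).succ - T.ζ i (j i).castSucc)

/-- The open knot vector of degree `p` and regularity `r` in direction `i`: the end knots are
repeated `p + 1` times and every internal breakpoint `p - r` times (used with `r < p`). -/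
def knot (T : CartesianMesh d) (i : Fin d) (p r : ℕ) (a : ℕ) : ℝ :=
  T.ζ i ⟨min (T.n i) (if a ≤ p then 0 else 1 + (a - p - 1) / (p - r)),
    Nat.lt_succ_of_le (min_le_left _ _)⟩

/-- The number of B-splines on that knot vector. -/
def numSplines (T : CartesianMesh d) (i : Fin d) (p r : ℕ) : ℕ :=
  p + 1 + (p - r) * (T.n i - 1)

/-- The tensor-product spline space of degrees `p` and regularities `r`. -/
def splineSpace (T : CartesianMesh d) (p r : Fin d → ℕ) : Submodule ℝ (E d → ℝ) :=
  Submodule.span ℝ (Set.range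
    fun (a : (i : Fin d) → Fin (T.numSplines i (p i) (r i))) (x : E d) =>
      ∏ i, bspline (T.knot i (p i) (r i)) (p i) (a i) (x i))

end CartesianMesh

/-- The parametric domain `(0,1)^d`. -/
def unitCube (d : ℕ) : Set (E d) := {x | ∀ i, x i ∈ Set.Ioo (0 : ℝ) 1}

/-- The three families of isogeometric elements: Raviart-Thomas, Nédélec, Taylor-Hood. -/
inductive StokesElement
  | RT
  | N
  | TH

namespace StokesElement

/-- Degree in direction `l` of the `i`-th component of the velocities. -/
def deg {d : ℕ} (el : StokesElement) (k : ℕ) (i l : Fin d) : ℕ :=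
  match el with
  | RT => if l = i then k + 1 else k
  | N => k + 1
  | TH => k + 1

/-- Regularity in direction `l` of the `i`-th component of the velocities. -/
def reg {d : ℕ} (el : StokesElement) (r : ℕ) (i l : Fin d) : ℕ :=
  match el with
  | RT => if l = i then r + 1 else r
  | N => if l = i then r + 1 else r
  | TH => r

/-- The parametric velocity space. -/
def paramVelocity {d : ℕ} (el : StokesElement) (k r : ℕ) (T : CartesianMesh d) :
    Set (E d → E d) :=
  {v | ∀ i, (fun x => v x i) ∈ T.splineSpace (el.deg k i) (el.reg r i)}

/-- The pull-back of velocities to the parametric domain: the Piola transformation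
`det(DF) DF⁻¹ (v ∘ F)` for Raviart-Thomas and Nédélec, `v ∘ F` for Taylor-Hood. -/
def pullback {d : ℕ} (el : StokesElement) (F : E d → E d) (v : E d → E d) (x : E d) : E d :=
  match el with
  | RT => (fderiv ℝ F x).det • (fderiv ℝ F x).inverse (v (F x))
  | N => (fderiv ℝ F x).det • (fderiv ℝ F x).inverse (v (F x))
  | TH => v (F x)

/-- Vector fields whose `i`-th component is a polynomial of degree at most `el.deg k i l` in the
variable `x l`: this is `ℚ_{k+1,k} × ℚ_{k,k+1}` (resp. its analogue for `d = 3`) for Raviart-Thomas,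
and `(ℚ_{k+1})^d` for Nédélec and Taylor-Hood. -/
def polyField {d : ℕ} (el : StokesElement) (k : ℕ) : Set (E d → E d) :=
  {q | ∀ i, ∃ p : MvPolynomial (Fin d) ℝ, (∀ l, p.degreeOf l ≤ el.deg k i l) ∧
    ∀ x : E d, q x i = MvPolynomial.eval (fun l => x l) p}

end StokesElement

/-! ### Geometry -/

/-- An untrimmed patch: a coarse mesh and a bi-Lipschitz spline map on the unit cube. -/
structure Patch (d : ℕ) where
  mesh : CartesianMesh d
  deg : Fin d → ℕ
  reg : Fin d → ℕ
  reg_lt_deg : ∀ i, reg i < deg i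
  map : E d → E d
  isSpline : ∀ i, ∃ s ∈ mesh.splineSpace deg reg, ∀ x ∈ unitCube d, map x i = s x
  biLipschitz : ∃ c C : ℝ, 0 < c ∧ ∀ x ∈ unitCube d, ∀ y ∈ unitCube d,
    c * dist x y ≤ dist (map x) (map y) ∧ dist (map x) (map y) ≤ C * dist x y

/-- The boundary of `Ω` is Lipschitz, and it is covered by `N` open sets in each of which, for some
unit vector `e`, the set `Ω` is the part above the graph (in direction `e`, over the hyperplane
orthogonal to `e`) of an `L`-Lipschitz function. -/
def HasLipschitzBoundary {d : ℕ} (Ω : Set (E d)) (N : ℕ) (L : ℝ≥0) : Prop :=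
  ∃ U : Fin N → Set (E d), (∀ i, IsOpen (U i)) ∧ frontier Ω ⊆ ⋃ i, U i ∧
    ∀ i, ∃ (e : E d) (g : E d → ℝ), ‖e‖ = 1 ∧ LipschitzWith L g ∧
      ∀ x ∈ U i, (x ∈ Ω ↔ g (x - inner ℝ e x • e) < inner ℝ e x)

/-- `n` is the outward unit normal of `Ω` at the boundary point `x`: near `x`, the set `Ω` agrees
with the half-space `⟪n, y - x⟫ < 0` up to arbitrarily thin cones around its boundary. -/
def IsOuterNormal {d : ℕ} (Ω : Set (E d)) (x n : E d) : Prop :=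
  ‖n‖ = 1 ∧ ∀ ε > 0, ∀ᶠ y in 𝓝 x,
    (inner ℝ n (y - x) < -(ε * ‖y - x‖) → y ∈ Ω) ∧
    (ε * ‖y - x‖ < inner ℝ n (y - x) → y ∉ Ω)

open Classical in
/-- The outward unit normal. On a Lipschitz boundary it exists, and is unique, almost everywhere;
the value is `0` where it does not exist. -/
def outerNormal {d : ℕ} (Ω : Set (E d)) (x : E d) : E d :=
  if h : ∃ n, IsOuterNormal Ω x n then h.choose else 0

/-- The Frobenius product `A : B` of two matrices. -/
def frob {d : ℕ} (A B : E d →L[ℝ] E d) : ℝ :=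
  ∑ j : Fin d, inner ℝ (A (EuclideanSpace.single j 1)) (B (EuclideanSpace.single j 1))

/-- The value at `x` of the continuous extension of `f` from `S` to `closure S`. -/
def trace {d : ℕ} {V : Type*} [TopologicalSpace V] [Nonempty V] (S : Set (E d)) (f : E d → V)
    (x : E d) : V :=
  limUnder (𝓝[S] x) f

/-- The `L²(K)`-orthogonal projection of `v` onto the vector fields of `W`. As the elements of `W`
are polynomials on the whole space, this is at once the projection and its canonical extension. -/
def l2Projection {d : ℕ} (W : Set (E d → E d)) (K : Set (E d)) (v : E d → E d) : E d → E d :=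
  Classical.epsilon fun q => q ∈ W ∧ ∀ w ∈ W, ∫ x in K, inner ℝ (v x - q x) (w x) = 0

/-! ### Trimmed discretizations -/

/-- The data of a discretization on the trimmed patch: the set that is cut away, the Dirichlet part
of the boundary, the (fine) mesh, and the choice of a good neighbor for each bad element. -/
structure Trimmed {d : ℕ} (P : Patch d) where
  cutOut : Set (E d)
  ΓD : Set (E d)
  mesh : CartesianMesh d
  neighbor : mesh.Cell → mesh.Cell

namespace Trimmed

variable {d : ℕ} {P : Patch d}

/-- The computational domain `Ω = Ω₀ \ closure Ω₁`. -/
def Ω (D : Trimmed P) : Set (E d) := P.map '' unitCube d \ closure D.cutOut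

/-- The physical Bézier elements. -/
def K (D : Trimmed P) (j : D.mesh.Cell) : Set (E d) := P.map '' D.mesh.Q j

/-- The element size `h_K`. -/
def h (D : Trimmed P) (j : D.mesh.Cell) : ℝ := Metric.diam (D.K j)

/-- `K j` belongs to the active mesh. -/
def Active (D : Trimmed P) (j : D.mesh.Cell) : Prop := (D.K j ∩ D.Ω).Nonempty

/-- `K j` is a cut element. -/
def Cut (D : Trimmed P) (j : D.mesh.Cell) : Prop :=
  D.Active j ∧ (frontier D.Ω ∩ D.K j).Nonempty

/-- `K j` is a good element for the volume-ratio threshold `θ`. -/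
def Good (D : Trimmed P) (θ : ℝ) (j : D.mesh.Cell) : Prop :=
  D.Active j ∧ θ ≤ volume.real (D.K j ∩ D.Ω) / volume.real (D.K j)

/-- `K j` is a bad element for the volume-ratio threshold `θ`. -/
def Bad (D : Trimmed P) (θ : ℝ) (j : D.mesh.Cell) : Prop :=
  D.Active j ∧ ¬ D.Good θ j

/-- `K j'` is a neighbor of `K j`: an active element, other than `K j`, at distance at most
`C h_K`. -/
def IsNeighbor (D : Trimmed P) (C : ℝ) (j j' : D.mesh.Cell) : Prop :=
  D.Active j' ∧ j' ≠ j ∧ sInf (Set.image2 dist (D.K j) (D.K j')) ≤ C * D.h j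

/-- The closed set `closure Ω_{I,h}`, the union of the closed active elements that are not cut. -/
def closedInterior (D : Trimmed P) : Set (E d) :=
  ⋃ (j : D.mesh.Cell) (_ : D.Active j ∧ ¬ D.Cut j), closure (D.K j)

/-- `K j'` is a good neighbor of `K j`. -/
def IsGoodNeighbor (D : Trimmed P) (θ C : ℝ) (j j' : D.mesh.Cell) : Prop :=
  D.IsNeighbor C j j' ∧ D.Good θ j' ∧ D.K j' ⊆ D.closedInterior

/-- The standing assumptions, with their constants: shape regularity `σ`, volume-ratio threshold
`θ`, radius `C` of the neighborhoods, Lipschitz character `(N, L)` of the boundary. -/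
structure Admissible (D : Trimmed P) (σ θ C : ℝ) (N : ℕ) (L : ℝ≥0) : Prop where
  lipschitz : HasLipschitzBoundary D.Ω N L
  dirichlet : ∃ U, IsOpen U ∧ D.ΓD = U ∩ frontier D.Ω
  refines : D.mesh.Refines P.mesh
  shapeRegular : D.mesh.ShapeRegular σ
  goodNeighbor : ∀ j, D.Bad θ j → D.IsGoodNeighbor θ C j (D.neighbor j)

/-- The discrete velocities on the untrimmed patch. The pull-back is prescribed in the open
elements, where the spline map is smooth. -/
def velocity₀ (D : Trimmed P) (el : StokesElement) (k r : ℕ) : Set (E d → E d) :=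
  {v | ∃ w ∈ el.paramVelocity k r D.mesh, ∀ j, ∀ x ∈ D.mesh.Q j, el.pullback P.map v x = w x}

/-- The discrete velocities `V_h`: the restrictions to `Ω` of the velocities on the untrimmed patch
(the values outside `Ω` play no role). -/
def velocity (D : Trimmed P) (el : StokesElement) (k r : ℕ) : Set (E d → E d) :=
  {v | ∃ v₀ ∈ D.velocity₀ el k r, Set.EqOn v v₀ D.Ω}

open Classical in
/-- The velocity stabilization operator on the element `K j`. -/
def stab (D : Trimmed P) (el : StokesElement) (k : ℕ) (θ : ℝ) (j : D.mesh.Cell)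
    (v : E d → E d) : E d → E d :=
  if D.Bad θ j then l2Projection (el.polyField k) (D.K (D.neighbor j)) v else v

/-- The part of `ΓD` that belongs to the element `K j`: the points from which one enters `K j` when
one moves into `Ω` along the inner normal. It contains every point of `ΓD` in the open element `K j`;
on a part of `ΓD` that lies on the mesh skeleton, or on the boundary of the patch, it selects the
element on the side of `Ω`. These sets are disjoint and cover `ΓD` up to a null set. -/
def Γ (D : Trimmed P) (j : D.mesh.Cell) : Set (E d) :=
  {x | x ∈ D.ΓD ∧ ∀ᶠ t : ℝ in 𝓝[>] 0, x - t • outerNormal D.Ω x ∈ D.K j}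

/-- The boundary value, from inside `K j ∩ Ω`, of `v`. -/
def bval (D : Trimmed P) (j : D.mesh.Cell) (v : E d → E d) (x : E d) : E d :=
  trace (D.K j ∩ D.Ω) v x

/-- The boundary value, from inside `K j ∩ Ω`, of the normal derivative `D R(v) n`. -/
def stabNormalDeriv (D : Trimmed P) (el : StokesElement) (k : ℕ) (θ : ℝ) (j : D.mesh.Cell)
    (v : E d → E d) (x : E d) : E d :=
  (trace (D.K j ∩ D.Ω) (fderiv ℝ (D.stab el k θ j v)) x) (outerNormal D.Ω x)

/-- The integral over `ΓD`, for the surface measure, of a function that is given element by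
element. -/
def bdryIntegral (D : Trimmed P) (f : D.mesh.Cell → E d → ℝ) : ℝ :=
  ∑ j, ∫ x in D.Γ j, f j x ∂μHE[d - 1]

/-- The mesh-dependent norm `‖v‖_{1,h}`. The matrix `D v` is the classical derivative in the open
elements, hence almost everywhere in `Ω`; it is the weak derivative whenever `v` is in `H¹(Ω)`. -/
def norm1h (D : Trimmed P) (μ : ℝ) (v : E d → E d) : ℝ :=
  √((∫ x in D.Ω, μ * frob (fderiv ℝ v x) (fderiv ℝ v x))
    + D.bdryIntegral fun j x => (D.h j)⁻¹ * (μ * ‖D.bval j v x‖ ^ 2))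

/-- The stabilized Nitsche bilinear form `ā_h(w, v)` with penalty parameter `γ`. -/
def stabForm (D : Trimmed P) (el : StokesElement) (k : ℕ) (μ θ γ : ℝ) (w v : E d → E d) : ℝ :=
  (∫ x in D.Ω, μ * frob (fderiv ℝ w x) (fderiv ℝ v x))
    - (D.bdryIntegral fun j x =>
        μ * inner ℝ (D.stabNormalDeriv el k θ j w x) (D.bval j v x))
    - (D.bdryIntegral fun j x =>
        μ * inner ℝ (D.bval j w x) (D.stabNormalDeriv el k θ j v x))
    + γ * D.bdryIntegral fun j x => (D.h j)⁻¹ * inner ℝ (D.bval j w x) (D.bval j v x)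

end Trimmed

end TrimmedStokes

end

namespace TrimmedStokes

/-! ### Polynomial functions -/

/-! Coercivity and continuity both reduce to one estimate, the second bound of `exists_form_bounds`:
the integral of D R(w) n · v over Γ_D is at most B times ‖Dw‖ times the h⁻¹-weighted norm of v on
Γ_D, with B independent of the mesh and of the cut. Young's inequality then absorbs the two
consistency terms into half of the gradient term and into the penalty, once γ is large; continuity
is Cauchy-Schwarz.

The estimate is proved element by element. The piece of Γ_D assigned to K has area at most a
constant times h_K^(d-1), because the boundary is covered by N Lipschitz graphs
(`exists_surface_bound`). It therefore suffices to bound D R(w) pointwise on K ∩ Ω by the energy of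
w on a source element, divided by the volume of that element (`exists_stab_bound`). The source is K
itself unless K is bad, and the good neighbor K' otherwise. Only supremum bounds are used, so no
trace inequality on cut elements is needed.

The supremum bounds rest on a Remez-type property, obtained by compactness: off a subset of small
relative measure, a polynomial of bounded degree on a ball is at least a fixed fraction of any of
its values there (`exists_sublevel`). On one element a velocity, pulled back to the parametric
domain, is a quotient of polynomials whose denominator is bounded above and below
(`exists_quotient`). Its gradient is thus comparable to a polynomial, and the supremum is controlled
by the mean square over any subset that fills a fixed fraction of the element (`exists_cellField`).
This settles the good elements. On a bad element (`exists_projection_bound`), the projection on K'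
is as close to a constant in L² as w is, that is, up to h times the supremum of |Dw| on K'. The
sublevel property carries this bound to a ball of radius comparable to h containing both K and K';
Markov's inequality gives the gradient, and the powers of h cancel.

For the summation, a shape-regular tensor-product mesh in at least two dimensions is quasi-uniform
(`diam_le_diam`), so a volume count shows that each source serves boundedly many elements
(`exists_card_source_le`). -/

/-- `f` is a polynomial function of total degree at most `m`. -/
def IsPoly {d : ℕ} (m : ℕ) (f : E d → ℝ) : Prop :=
  ∃ p : MvPolynomial (Fin d) ℝ, p.totalDegree ≤ m ∧ ∀ x : E d, f x = MvPolynomial.eval x p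

namespace IsPoly

variable {d m n : ℕ} {f g : E d → ℝ}

theorem mono (hf : IsPoly m f) (h : m ≤ n) : IsPoly n f := by
  obtain ⟨p, hp, hfp⟩ := hf
  exact ⟨p, hp.trans h, hfp⟩

theorem const (m : ℕ) (a : ℝ) : IsPoly m (fun _ : E d => a) :=
  ⟨MvPolynomial.C a, by simp, by simp⟩

theorem coord (l : Fin d) : IsPoly 1 (fun x : E d => x l) :=
  ⟨MvPolynomial.X l, by simp, by simp⟩

theorem add (hf : IsPoly m f) (hg : IsPoly m g) : IsPoly m (fun x => f x + g x) := by
  obtain ⟨p, hp, hfp⟩ := hf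
  obtain ⟨q, hq, hgq⟩ := hg
  exact ⟨p + q, (MvPolynomial.totalDegree_add _ _).trans (max_le hp hq), by simp [hfp, hgq]⟩

theorem mul (hf : IsPoly m f) (hg : IsPoly n g) : IsPoly (m + n) (fun x => f x * g x) := by
  obtain ⟨p, hp, hfp⟩ := hf
  obtain ⟨q, hq, hgq⟩ := hg
  exact ⟨p * q, (MvPolynomial.totalDegree_mul _ _).trans (add_le_add hp hq), by simp [hfp, hgq]⟩

theorem const_mul (a : ℝ) (hf : IsPoly m f) : IsPoly m (fun x => a * f x) := by
  simpa using (const 0 a).mul hf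

theorem sub (hf : IsPoly m f) (hg : IsPoly m g) : IsPoly m (fun x => f x - g x) := by
  simpa [sub_eq_add_neg] using hf.add (hg.const_mul (-1))

theorem sum {ι : Type*} (s : Finset ι) {f : ι → E d → ℝ} (hf : ∀ i ∈ s, IsPoly m (f i)) :
    IsPoly m (fun x => ∑ i ∈ s, f i x) := by
  classical
  induction s using Finset.induction_on with
  | empty => simpa using const m 0
  | insert a s ha ih =>
    simp only [Finset.sum_insert ha]
    exact (hf a (by simp)).add (ih fun i hi => hf i (by simp [hi]))

theorem prod {ι : Type*} (s : Finset ι) {k : ι → ℕ} {f : ι → E d → ℝ}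
    (hf : ∀ i ∈ s, IsPoly (k i) (f i)) :
    IsPoly (∑ i ∈ s, k i) (fun x => ∏ i ∈ s, f i x) := by
  classical
  induction s using Finset.induction_on with
  | empty => simpa using const 0 1
  | insert a s ha ih =>
    simp only [Finset.sum_insert ha, Finset.prod_insert ha]
    exact (hf a (by simp)).mul (ih fun i hi => hf i (by simp [hi]))

theorem pow (hf : IsPoly m f) (n : ℕ) : IsPoly (n * m) (fun x => f x ^ n) := by
  simpa using prod (Finset.range n) (k := fun _ => m) (f := fun _ => f) (fun _ _ => hf)

theorem comp_affine (hf : IsPoly m f) (x₀ : E d) (ρ : ℝ) :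
    IsPoly m (fun x => f (x₀ + ρ • x)) := by
  obtain ⟨p, hp, hfp⟩ := hf
  have : (fun x => f (x₀ + ρ • x)) = fun x : E d =>
      ∑ s ∈ p.support, p.coeff s * ∏ l : Fin d, (x₀ l + ρ * x l) ^ s l := by
    ext x
    rw [hfp, MvPolynomial.eval_eq']
    simp
  rw [this]
  refine sum _ fun s hs => const_mul _ ?_
  have h1 : ∀ l : Fin d, IsPoly 1 (fun x : E d => x₀ l + ρ * x l) := fun l =>
    (const 1 (x₀ l)).add ((coord l).const_mul ρ)
  refine (prod Finset.univ fun l _ => (h1 l).pow (s l)).mono ?_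
  have := MvPolynomial.le_totalDegree hs
  rw [Finsupp.sum_fintype _ _ (by simp)] at this
  simpa using this.trans hp

theorem of_polynomial (p : Polynomial ℝ) (l : Fin d) (hp : p.natDegree ≤ m) :
    IsPoly m (fun x : E d => p.eval (x l)) := by
  simp only [Polynomial.eval_eq_sum_range]
  refine sum _ fun i hi => const_mul _ (((coord l).pow i).mono ?_)
  rw [Finset.mem_range] at hi
  omega

theorem of_degreeOf {p : MvPolynomial (Fin d) ℝ} (hp : ∀ l, p.degreeOf l ≤ m) :
    IsPoly (d * m) (fun x : E d => MvPolynomial.eval (fun l => x l) p) := by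
  refine ⟨p, ?_, fun x => rfl⟩
  rw [MvPolynomial.totalDegree]
  refine Finset.sup_le fun s hs => ?_
  rw [Finsupp.sum_fintype _ _ (by simp)]
  calc ∑ i, s i ≤ ∑ _i : Fin d, m :=
        Finset.sum_le_sum fun i _ => (MvPolynomial.degreeOf_le_iff.1 (hp i)) s hs
    _ = d * m := by simp

theorem hasFDerivAt_eval (p : MvPolynomial (Fin d) ℝ) (x : E d) :
    HasFDerivAt (fun x : E d => MvPolynomial.eval x p)
      (∑ l, MvPolynomial.eval x (MvPolynomial.pderiv l p) •
        (EuclideanSpace.proj l : E d →L[ℝ] ℝ)) x := by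
  induction p using MvPolynomial.induction_on with
  | C a => simpa using hasFDerivAt_const a x
  | add p q hp hq =>
    simp only [map_add, add_smul, Finset.sum_add_distrib]
    exact hp.fun_add hq
  | mul_X p i hp =>
    have h := hp.fun_mul (EuclideanSpace.proj i : E d →L[ℝ] ℝ).hasFDerivAt
    have e : (fun x : E d => MvPolynomial.eval x (p * MvPolynomial.X i)) =
        fun x : E d => MvPolynomial.eval x p * (EuclideanSpace.proj i : E d →L[ℝ] ℝ) x := by
      ext; simp
    rw [e]
    refine h.congr_fderiv ?_
    simp only [MvPolynomial.pderiv_mul, MvPolynomial.pderiv_X, map_add, map_mul, add_smul,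
      Finset.sum_add_distrib, MvPolynomial.eval_X, Finset.smul_sum]
    rw [add_comm (_ • EuclideanSpace.proj i)]
    congr 1
    · refine Finset.sum_congr rfl fun l _ => ?_
      simp [smul_smul, mul_comm]
    · rw [Finset.sum_eq_single i]
      · simp
      · intro b _ hb
        simp [hb.symm]
      · simp

theorem contDiff (hf : IsPoly m f) {n : WithTop ℕ∞} : ContDiff ℝ n f := by
  obtain ⟨p, -, hfp⟩ := hf
  rw [show f = fun x : E d => MvPolynomial.eval x p from funext hfp]
  induction p using MvPolynomial.induction_on generalizing f with
  | C a => simpa using contDiff_const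
  | add p q hp hq => simpa using (hp (fun _ => rfl)).add (hq fun _ => rfl)
  | mul_X p i hp =>
    have h := (hp (fun _ => rfl)).mul (EuclideanSpace.proj i : E d →L[ℝ] ℝ).contDiff (n := n)
    simpa using h

theorem differentiable (hf : IsPoly m f) : Differentiable ℝ f :=
  (hf.contDiff (n := 1)).differentiable (by simp)

theorem continuous (hf : IsPoly m f) : Continuous f := hf.differentiable.continuous

theorem totalDegree_pderiv_le (p : MvPolynomial (Fin d) ℝ) (l : Fin d) :
    (MvPolynomial.pderiv l p).totalDegree ≤ p.totalDegree := by
  conv_lhs => rw [p.as_sum, map_sum]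
  refine MvPolynomial.totalDegree_finsetSum_le fun s hs => ?_
  rw [MvPolynomial.pderiv_monomial]
  refine (MvPolynomial.totalDegree_monomial_le _ _).trans ?_
  refine le_trans ?_ (MvPolynomial.le_totalDegree hs)
  rw [Finsupp.sum_fintype _ _ (by simp), Finsupp.sum_fintype _ _ (by simp)]
  exact Finset.sum_le_sum fun i _ => by simp

theorem deriv (hf : IsPoly m f) (v : E d) : IsPoly m (fun x => fderiv ℝ f x v) := by
  obtain ⟨p, hp, hfp⟩ := hf
  have : (fun x => fderiv ℝ f x v) = fun x : E d =>
      ∑ l, v l * MvPolynomial.eval x (MvPolynomial.pderiv l p) := by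
    ext x
    rw [show f = fun x : E d => MvPolynomial.eval x p from funext hfp,
      (hasFDerivAt_eval p x).fderiv]
    simp [mul_comm]
  rw [this]
  exact sum _ fun l _ => const_mul _
    ⟨_, (totalDegree_pderiv_le p l).trans hp, fun x => rfl⟩

end IsPoly

/-! ### The zero set of a polynomial is a null set -/

/-- Fubini and induction on the number of variables: read p as a polynomial in one variable with
coefficients in the others. Off the zero set of the leading coefficient, null by induction, each
one-variable slice has finitely many roots. -/
theorem volume_zeros_mvPolynomial (n : ℕ) (p : MvPolynomial (Fin n) ℝ) (hp : p ≠ 0) :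
    volume {x : Fin n → ℝ | MvPolynomial.eval x p = 0} = 0 := by
  induction n with
  | zero =>
    have : {x : Fin 0 → ℝ | MvPolynomial.eval x p = 0} = ∅ := by
      ext x
      simp only [Set.mem_ofPred_eq, Set.mem_empty_iff_false, iff_false]
      intro h
      refine hp (MvPolynomial.funext fun y => ?_)
      rw [Subsingleton.elim y x, h, map_zero]
    simp [this]
  | succ n ih =>
    have hm : MeasurableSet {x : Fin (n + 1) → ℝ | MvPolynomial.eval x p = 0} :=
      (isClosed_eq (MvPolynomial.continuous_eval p) continuous_const).measurableSet
    have hpres := (volume_preserving_piFinSuccAbove (fun _ : Fin (n + 1) => ℝ) 0).symm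
    have hswap := hpres.comp (Measure.measurePreserving_swap (μ := (volume : Measure (Fin n → ℝ)))
      (ν := (volume : Measure ℝ)))
    rw [← hswap.measure_preimage hm.nullMeasurableSet]
    refine Measure.measure_prod_null_of_ae_null (hswap.measurable hm) ?_
    have hq : MvPolynomial.finSuccEquiv ℝ n p ≠ 0 := by simpa using hp
    have hlead := ih _ (Polynomial.leadingCoeff_ne_zero.2 hq)
    filter_upwards [measure_eq_zero_iff_ae_notMem.1 hlead] with s hs
    have hs' : Polynomial.map (MvPolynomial.eval s) (MvPolynomial.finSuccEquiv ℝ n p) ≠ 0 := by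
      intro h0
      apply hs
      have := congrArg (fun q => q.coeff (MvPolynomial.finSuccEquiv ℝ n p).natDegree) h0
      simpa using this
    refine Set.Finite.measure_zero (Set.Finite.subset (Polynomial.map (MvPolynomial.eval s)
      (MvPolynomial.finSuccEquiv ℝ n p)).roots.toFinset.finite_toSet fun y hy => ?_) _
    have hy' : MvPolynomial.eval (Fin.cons y s : Fin (n + 1) → ℝ) p = 0 := by
      simpa [MeasurableEquiv.piFinSuccAbove, Fin.insertNthEquiv] using hy
    rw [MvPolynomial.eval_eq_eval_mv_eval'] at hy'
    simpa [hs'] using hy'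

theorem IsPoly.volume_zeros {d m : ℕ} {f : E d → ℝ} (hf : IsPoly m f) {x : E d} (hx : f x ≠ 0) :
    volume {x : E d | f x = 0} = 0 := by
  have hm : MeasurableSet {x : E d | f x = 0} :=
    (isClosed_eq hf.continuous continuous_const).measurableSet
  obtain ⟨p, -, hfp⟩ := hf
  have hp : p ≠ 0 := by
    rintro rfl
    exact hx (by simp [hfp])
  rw [← (PiLp.volume_preserving_toLp (Fin d)).measure_preimage hm.nullMeasurableSet]
  simpa [hfp] using volume_zeros_mvPolynomial d p hp

/-! ### Norm equivalences for polynomials on a ball -/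

/-- `T` composed with the inverse of `S` is linear on the finite-dimensional range of `S`, hence
bounded. This is equivalence of norms in a form that puts no norm on `V`. -/
theorem exists_norm_le_of_injective {V X Y : Type*} [AddCommGroup V] [Module ℝ V]
    [FiniteDimensional ℝ V] [NormedAddCommGroup X] [NormedSpace ℝ X] [NormedAddCommGroup Y]
    [NormedSpace ℝ Y] (S : V →ₗ[ℝ] X) (T : V →ₗ[ℝ] Y) (hS : Function.Injective S) :
    ∃ C > 0, ∀ v, ‖T v‖ ≤ C * ‖S v‖ := by
  let e := LinearEquiv.ofInjective S hS
  have : FiniteDimensional ℝ (LinearMap.range S) := inferInstance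
  let A : LinearMap.range S →L[ℝ] Y := LinearMap.toContinuousLinearMap (T ∘ₗ e.symm.toLinearMap)
  refine ⟨‖A‖ + 1, by positivity, fun v => ?_⟩
  have h := A.le_opNorm (e v)
  have hA : A (e v) = T v := by simp [A]
  rw [hA] at h
  refine h.trans ?_
  have : ‖e v‖ = ‖S v‖ := rfl
  rw [this]
  gcongr
  linarith

/-- The restrictions to the closed unit ball of the polynomials of degree at most `m`. -/
noncomputable def evalBall (d m : ℕ) :
    MvPolynomial.restrictTotalDegree (Fin d) ℝ m →ₗ[ℝ] C(Metric.closedBall (0 : E d) 1, ℝ) where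
  toFun p := ⟨fun x => MvPolynomial.eval x.1 p.1, (MvPolynomial.continuous_eval p.1).comp
    ((PiLp.continuous_ofLp 2 _).comp continuous_subtype_val)⟩
  map_add' p q := by ext; simp
  map_smul' c p := by ext; simp

/-- A nonzero polynomial cannot vanish on a set of positive measure such as a ball. -/
theorem evalBall_injective (d m : ℕ) : Function.Injective (evalBall d m) := by
  rw [← LinearMap.ker_eq_bot, LinearMap.ker_eq_bot']
  intro p hp
  by_contra h
  have h' : p.1 ≠ 0 := fun h0 => h (Subtype.ext h0)
  have h1 : ∃ x : E d, MvPolynomial.eval x p.1 ≠ 0 := by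
    by_contra! hx
    exact h' (MvPolynomial.funext fun x => by simpa using hx (WithLp.toLp 2 x))
  obtain ⟨x, hx⟩ := h1
  have hz := IsPoly.volume_zeros (m := p.1.totalDegree) ⟨p.1, le_rfl, fun _ => rfl⟩ hx
  have hb : volume (Metric.ball (0 : E d) 1) = 0 := by
    refine measure_mono_null (fun y hy => ?_) hz
    exact DFunLike.congr_fun hp ⟨y, Metric.ball_subset_closedBall hy⟩
  exact (Metric.measure_ball_pos volume (0 : E d) one_pos).ne' hb

/-- The sublevel sets of polynomials on the unit ball are uniformly small. -/
theorem exists_sublevel_unit (d m : ℕ) {ε : ℝ} (hε : 0 < ε) :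
    ∃ δ > 0, ∀ f : E d → ℝ, IsPoly m f → ∀ y ∈ Metric.closedBall (0 : E d) 1,
      volume {x ∈ Metric.closedBall (0 : E d) 1 | |f x| < δ * |f y|} ≤ ENNReal.ofReal ε := by
  let W := LinearMap.range (evalBall d m)
  have : FiniteDimensional ℝ W := inferInstanceAs (FiniteDimensional ℝ (LinearMap.range _))
  have : ProperSpace W := FiniteDimensional.proper_real W
  let sub : W → ℝ → Set (E d) := fun w δ =>
    Subtype.val '' {x : Metric.closedBall (0 : E d) 1 | |w.1 x| < δ}
  have hmono : ∀ w a b, a ≤ b → sub w a ⊆ sub w b := fun w a b hab =>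
    Set.image_mono fun x (hx : |w.1 x| < a) => show |w.1 x| < b from hx.trans_le hab
  -- Compactness of the unit sphere for the supremum norm. Locally near a polynomial g: the sets
  -- where |g| ≤ η shrink to the null zero set of g, so one of them has measure below ε. If w' is
  -- within η/2 of g, the set where |w'| < η/2 lies inside it.
  have key : ∃ δ > 0, ∀ w ∈ Metric.sphere (0 : W) 1, volume (sub w δ) ≤ ENNReal.ofReal ε := by
    refine (isCompact_sphere (0 : W) 1).induction_on
      (p := fun s => ∃ δ > 0, ∀ w ∈ s, volume (sub w δ) ≤ ENNReal.ofReal ε) ?_ ?_ ?_ ?_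
    · exact ⟨1, one_pos, by simp⟩
    · rintro s t hst ⟨δ, hδ, h⟩
      exact ⟨δ, hδ, fun w hw => h w (hst hw)⟩
    · rintro s t ⟨δ, hδ, h⟩ ⟨δ', hδ', h'⟩
      refine ⟨min δ δ', lt_min hδ hδ', ?_⟩
      rintro w (hw | hw)
      · exact (measure_mono (hmono w _ _ (min_le_left _ _))).trans (h w hw)
      · exact (measure_mono (hmono w _ _ (min_le_right _ _))).trans (h' w hw)
    · rintro ⟨w, hw⟩ hw1
      obtain ⟨p, rfl⟩ := hw
      set g : E d → ℝ := fun x => MvPolynomial.eval x p.1 with hg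
      have hgp : IsPoly p.1.totalDegree g := ⟨p.1, le_rfl, fun _ => rfl⟩
      have hz : volume {x : E d | g x = 0} = 0 := by
        have hne : evalBall d m p ≠ 0 := by
          intro h0
          rw [mem_sphere_zero_iff_norm] at hw1
          simp [h0] at hw1
        obtain ⟨x, hx⟩ := DFunLike.ne_iff.1 hne
        exact hgp.volume_zeros (x := x.1) hx
      have hlim : Tendsto (fun n : ℕ => volume
          (Metric.closedBall (0 : E d) 1 ∩ {x : E d | |g x| ≤ 1 / ((n : ℝ) + 1)})) atTop (𝓝 0) := by
        have hmeas : ∀ n : ℕ, MeasurableSet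
            (Metric.closedBall (0 : E d) 1 ∩ {x : E d | |g x| ≤ 1 / ((n : ℝ) + 1)}) := fun n =>
          Metric.isClosed_closedBall.measurableSet.inter
            (isClosed_le hgp.continuous.abs continuous_const).measurableSet
        have h := tendsto_measure_iInter_atTop (μ := (volume : Measure (E d)))
          (s := fun n : ℕ => Metric.closedBall (0 : E d) 1 ∩ {x : E d | |g x| ≤ 1 / ((n : ℝ) + 1)})
          (fun n => (hmeas n).nullMeasurableSet) ?_ ⟨0, ?_⟩
        · rwa [measure_mono_null _ hz] at h
          intro x hx
          rw [Set.mem_iInter] at hx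
          have hx' : |g x| ≤ 0 := ge_of_tendsto' tendsto_one_div_add_atTop_nhds_zero_nat
            fun n => (hx n).2
          exact abs_nonpos_iff.1 hx'
        · intro a b hab x hx
          have hx2 : |g x| ≤ 1 / ((b : ℝ) + 1) := hx.2
          refine ⟨hx.1, hx2.trans ?_⟩
          have : (a : ℝ) ≤ b := by exact_mod_cast hab
          gcongr
        · exact ((measure_mono Set.inter_subset_left).trans_lt
            (isCompact_closedBall (0 : E d) 1).measure_lt_top).ne
      obtain ⟨n, hn⟩ := (hlim.eventually (gt_mem_nhds (ENNReal.ofReal_pos.2 hε))).exists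
      have hη : (0 : ℝ) < 1 / ((n : ℝ) + 1) / 2 := by positivity
      refine ⟨Metric.ball ⟨evalBall d m p, p, rfl⟩ (1 / ((n : ℝ) + 1) / 2),
        mem_nhdsWithin_of_mem_nhds (Metric.ball_mem_nhds _ hη), 1 / ((n : ℝ) + 1) / 2, hη, ?_⟩
      intro w' hw'
      refine le_trans (measure_mono ?_) hn.le
      rintro _ ⟨x, hx, rfl⟩
      refine ⟨x.2, ?_⟩
      have h1 : |w'.1 x - g x| ≤ dist w' ⟨evalBall d m p, p, rfl⟩ := by
        rw [Subtype.dist_eq, dist_eq_norm]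
        exact (w'.1 - evalBall d m p).norm_coe_le_norm x
      rw [Metric.mem_ball] at hw'
      have hx' : |w'.1 x| < 1 / ((n : ℝ) + 1) / 2 := hx
      change |g x| ≤ _
      have h2 : |g x| ≤ |w'.1 x| + |w'.1 x - g x| := by
        have := abs_sub_abs_le_abs_sub (g x) (w'.1 x)
        rw [abs_sub_comm] at this
        linarith
      linarith
  obtain ⟨δ, hδ, h⟩ := key
  refine ⟨δ, hδ, fun f hf y hy => ?_⟩
  obtain ⟨p, hp, hfp⟩ := hf
  let q : MvPolynomial.restrictTotalDegree (Fin d) ℝ m :=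
    ⟨p, (MvPolynomial.mem_restrictTotalDegree _ _ _).2 hp⟩
  -- The claim is homogeneous in f, so f is normalized to the unit sphere. If f vanishes on the
  -- ball, the strict inequality leaves the sublevel set empty.
  by_cases h0 : evalBall d m q = 0
  · have : f y = 0 := by
      rw [hfp]
      exact DFunLike.congr_fun h0 ⟨y, hy⟩
    refine (measure_mono (t := ∅) fun x hx => ?_).trans (by simp)
    have hx2 : |f x| < δ * |f y| := hx.2
    rw [this, abs_zero, mul_zero] at hx2
    exact absurd hx2 (abs_nonneg _).not_gt
  have hn : 0 < ‖evalBall d m q‖ := norm_pos_iff.2 h0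
  let w : W := ‖evalBall d m q‖⁻¹ • ⟨evalBall d m q, q, rfl⟩
  have hw : w ∈ Metric.sphere (0 : W) 1 := by
    rw [mem_sphere_zero_iff_norm]
    change ‖‖evalBall d m q‖⁻¹ • evalBall d m q‖ = 1
    rw [norm_smul, norm_inv, norm_norm]
    exact inv_mul_cancel₀ hn.ne'
  refine (measure_mono ?_).trans (h w hw)
  rintro x ⟨hx, hfx⟩
  refine ⟨⟨x, hx⟩, ?_, rfl⟩
  have hfy : |f y| ≤ ‖evalBall d m q‖ := by
    rw [hfp]
    exact (evalBall d m q).norm_coe_le_norm ⟨y, hy⟩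
  change |‖evalBall d m q‖⁻¹ * MvPolynomial.eval x p| < δ
  rw [← hfp, abs_mul, abs_inv, abs_norm, inv_mul_lt_iff₀ hn]
  calc |f x| < δ * |f y| := hfx
    _ ≤ ‖evalBall d m q‖ * δ := by rw [mul_comm]; gcongr

-- Affine scaling from the unit ball to any ball. This is the source of the inverse inequalities on
-- cut sets: a lower bound for |f| fails only on a set of small relative measure, so the shape of
-- the remaining set never matters.
open scoped Pointwise in
theorem exists_sublevel (d m : ℕ) {ε : ℝ} (hε : 0 < ε) :
    ∃ δ > 0, ∀ f : E d → ℝ, IsPoly m f → ∀ (x₀ : E d) (ρ : ℝ), 0 < ρ →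
      ∀ y ∈ Metric.closedBall x₀ ρ,
      volume.real {x ∈ Metric.closedBall x₀ ρ | |f x| < δ * |f y|} ≤ ε * ρ ^ d := by
  obtain ⟨δ, hδ, h⟩ := exists_sublevel_unit d m hε
  refine ⟨δ, hδ, fun f hf x₀ ρ hρ y hy => ?_⟩
  have hmem : ∀ x ∈ Metric.closedBall x₀ ρ, ρ⁻¹ • (x - x₀) ∈ Metric.closedBall (0 : E d) 1 := by
    intro x hx
    rw [mem_closedBall_zero_iff, norm_smul, norm_inv, Real.norm_of_nonneg hρ.le,
      inv_mul_le_iff₀ hρ, mul_one]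
    simpa [dist_eq_norm] using hx
  have hinv : ∀ x, x₀ + ρ • (ρ⁻¹ • (x - x₀)) = x := fun x => by
    rw [smul_inv_smul₀ hρ.ne']; abel
  have h1 := h _ (hf.comp_affine x₀ ρ) _ (hmem y hy)
  simp only [hinv] at h1
  have hsub : {x ∈ Metric.closedBall x₀ ρ | |f x| < δ * |f y|} ⊆
      (fun x => x₀ + x) '' (ρ • {x ∈ Metric.closedBall (0 : E d) 1 |
        |f (x₀ + ρ • x)| < δ * |f y|}) := by
    rintro x ⟨hx, hfx⟩
    exact ⟨_, Set.smul_mem_smul_set ⟨hmem x hx, by simpa only [hinv] using hfx⟩, hinv x⟩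
  have h2 : volume {x ∈ Metric.closedBall x₀ ρ | |f x| < δ * |f y|} ≤
      ENNReal.ofReal (ε * ρ ^ d) := by
    refine (measure_mono hsub).trans ?_
    rw [Set.image_add_left, measure_preimage_add, Measure.addHaar_smul, finrank_euclideanSpace,
      Fintype.card_fin, abs_of_pos (by positivity), mul_comm ε, ENNReal.ofReal_mul (by positivity)]
    gcongr
  exact ENNReal.toReal_le_of_le_ofReal (by positivity) h2

theorem norm_le_sum_abs_apply {d : ℕ} (A : E d →L[ℝ] ℝ) :
    ‖A‖ ≤ ∑ l, |A (EuclideanSpace.single l 1)| := by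
  refine A.opNorm_le_bound (Finset.sum_nonneg fun _ _ => abs_nonneg _) fun x => ?_
  have hx : x = ∑ l, x l • EuclideanSpace.single l (1 : ℝ) := by
    ext i
    simp [Finset.sum_apply, Pi.single_apply]
  conv_lhs => rw [hx, map_sum]
  refine (norm_sum_le _ _).trans ?_
  rw [Finset.sum_mul]
  refine Finset.sum_le_sum fun l _ => ?_
  rw [map_smul, norm_smul, Real.norm_eq_abs (A _), mul_comm]
  gcongr
  exact PiLp.norm_apply_le x l

/-- Markov's inequality on balls. -/
theorem exists_norm_fderiv_le (d m : ℕ) :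
    ∃ C > 0, ∀ f : E d → ℝ, IsPoly m f → ∀ (x₀ : E d) (ρ M : ℝ), 0 < ρ →
      (∀ x ∈ Metric.closedBall x₀ ρ, |f x| ≤ M) →
      ∀ y ∈ Metric.closedBall x₀ ρ, ‖fderiv ℝ f y‖ ≤ C * M / ρ := by
  let dl : Fin d → MvPolynomial.restrictTotalDegree (Fin d) ℝ m →ₗ[ℝ]
      C(Metric.closedBall (0 : E d) 1, ℝ) := fun l =>
    evalBall d m ∘ₗ ((MvPolynomial.pderiv l).toLinearMap.restrict fun p hp => by
      rw [MvPolynomial.mem_restrictTotalDegree] at hp ⊢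
      exact (IsPoly.totalDegree_pderiv_le p l).trans hp)
  -- On the finite-dimensional polynomial space, evaluation on the ball is injective, so it
  -- dominates evaluation of each partial derivative. The scaling by ρ comes afterwards.
  have hC := fun l => exists_norm_le_of_injective (evalBall d m) (dl l) (evalBall_injective d m)
  choose C hC0 hC using hC
  refine ⟨∑ l, C l + 1, ?_, ?_⟩
  · have := Finset.sum_nonneg fun l (_ : l ∈ Finset.univ) => (hC0 l).le
    positivity
  intro f hf x₀ ρ M hρ hM y hy
  have hM0 : 0 ≤ M := (abs_nonneg _).trans (hM y hy)
  obtain ⟨p, hp, hfp⟩ := hf.comp_affine x₀ ρ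
  let q : MvPolynomial.restrictTotalDegree (Fin d) ℝ m :=
    ⟨p, (MvPolynomial.mem_restrictTotalDegree _ _ _).2 hp⟩
  have hq : ‖evalBall d m q‖ ≤ M := by
    rw [ContinuousMap.norm_le _ hM0]
    rintro ⟨x, hx⟩
    change |MvPolynomial.eval x p| ≤ M
    rw [← hfp]
    refine hM _ ?_
    rw [mem_closedBall_zero_iff] at hx
    simp only [Metric.mem_closedBall, dist_self_add_left, norm_smul, Real.norm_of_nonneg hρ.le]
    nlinarith
  have hmem : ρ⁻¹ • (y - x₀) ∈ Metric.closedBall (0 : E d) 1 := by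
    rw [mem_closedBall_zero_iff, norm_smul, norm_inv, Real.norm_of_nonneg hρ.le,
      inv_mul_le_iff₀ hρ, mul_one]
    simpa [dist_eq_norm] using hy
  set z := ρ⁻¹ • (y - x₀) with hz
  have hinv : x₀ + ρ • z = y := by
    rw [hz, smul_inv_smul₀ hρ.ne']; abel
  have hder : ∀ l, fderiv ℝ f y (EuclideanSpace.single l 1) =
      ρ⁻¹ * MvPolynomial.eval z (MvPolynomial.pderiv l p) := by
    intro l
    have h1 := IsPoly.hasFDerivAt_eval p z
    have h2 : HasFDerivAt (fun x => f (x₀ + ρ • x))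
        ((fderiv ℝ f y).comp (ρ • ContinuousLinearMap.id ℝ (E d))) z := by
      have h3 : HasFDerivAt (fun x : E d => x₀ + ρ • x) (ρ • ContinuousLinearMap.id ℝ (E d)) z :=
        ((hasFDerivAt_id z).const_smul ρ).const_add x₀
      refine HasFDerivAt.comp z (g := f) ?_ h3
      rw [hinv]
      exact (hf.differentiable y).hasFDerivAt
    rw [funext hfp] at h2
    have h4 := DFunLike.congr_fun (h1.unique h2) (EuclideanSpace.single l (1 : ℝ))
    have h5 : MvPolynomial.eval z (MvPolynomial.pderiv l p) =
        ρ * fderiv ℝ f y (EuclideanSpace.single l 1) := by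
      simpa [Pi.single_apply] using h4
    rw [h5, inv_mul_cancel_left₀ hρ.ne']
  have hb : ∀ l, |fderiv ℝ f y (EuclideanSpace.single l 1)| ≤ C l * M / ρ := by
    intro l
    rw [hder, abs_mul, abs_inv, abs_of_pos hρ, div_eq_inv_mul]
    gcongr
    calc |MvPolynomial.eval z (MvPolynomial.pderiv l p)| ≤ ‖dl l q‖ :=
          (dl l q).norm_coe_le_norm ⟨z, hmem⟩
      _ ≤ C l * ‖evalBall d m q‖ := hC l q
      _ ≤ C l * M := by have := (hC0 l).le; gcongr
  calc ‖fderiv ℝ f y‖ ≤ ∑ l, C l * M / ρ :=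
        (norm_le_sum_abs_apply _).trans (Finset.sum_le_sum fun l _ => hb l)
    _ = (∑ l, C l) * M / ρ := by rw [← Finset.sum_div, Finset.sum_mul]
    _ ≤ (∑ l, C l + 1) * M / ρ := by gcongr; linarith

/-! ### Determinants, Lipschitz images -/

theorem euclideanHausdorffMeasure_image_le {X Y : Type*} [EMetricSpace X] [EMetricSpace Y]
    [MeasurableSpace X] [BorelSpace X] [MeasurableSpace Y] [BorelSpace Y] {K : ℝ≥0} {f : X → Y}
    {s : Set X} (h : LipschitzOnWith K f s) (d : ℕ) :
    (μHE[d] : Measure Y) (f '' s) ≤ (K : ℝ≥0∞) ^ d * (μHE[d] : Measure X) s := by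
  simp only [Measure.euclideanHausdorffMeasure_def, Measure.smul_apply, ENNReal.smul_def,
    smul_eq_mul]
  rw [mul_left_comm]
  gcongr
  simpa using h.hausdorffMeasure_image_le (d := d) (by positivity)

/-- Lebesgue measure is the d-dimensional Hausdorff measure, so the bound needs neither injectivity
nor differentiability. -/
theorem volume_image_le {d : ℕ} {K : ℝ} (hK : 0 ≤ K) {f : E d → E d} {s : Set (E d)}
    (h : ∀ x ∈ s, ∀ y ∈ s, dist (f x) (f y) ≤ K * dist x y) :
    volume (f '' s) ≤ ENNReal.ofReal (K ^ d) * volume s := by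
  have h' : LipschitzOnWith ⟨K, hK⟩ f s := LipschitzOnWith.of_dist_le_mul h
  have := euclideanHausdorffMeasure_image_le h' d
  rw [EuclideanSpace.euclideanHausdorffMeasure_eq_volume] at this
  rwa [ENNReal.ofReal_pow hK, ENNReal.ofReal, Real.toNNReal_of_nonneg hK]

/-- The determinant is the factor by which `A` scales the volume of the unit ball. -/
theorem abs_det_le {d : ℕ} {A : E d →L[ℝ] E d} {C : ℝ} (hC : 0 ≤ C)
    (hA : ∀ ξ, ‖A ξ‖ ≤ C * ‖ξ‖) : |A.det| ≤ C ^ d := by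
  have h := volume_image_le (f := A) (s := Metric.ball 0 1) hC fun x _ y _ => by
    rw [dist_eq_norm, dist_eq_norm, ← map_sub]
    exact hA _
  rw [Measure.addHaar_image_continuousLinearMap] at h
  rw [ENNReal.mul_le_mul_iff_left (Metric.measure_ball_pos volume _ one_pos).ne'
    measure_ball_lt_top.ne] at h
  exact (ENNReal.ofReal_le_ofReal_iff (by positivity)).1 h

/-- The lower bound makes `A` invertible, and `abs_det_le` applies to its inverse. -/
theorem le_abs_det {d : ℕ} {A : E d →L[ℝ] E d} {c : ℝ} (hc : 0 < c)
    (hA : ∀ ξ, c * ‖ξ‖ ≤ ‖A ξ‖) : c ^ d ≤ |A.det| := by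
  have hinj : Function.Injective A.toLinearMap := by
    rw [← LinearMap.ker_eq_bot, LinearMap.ker_eq_bot']
    intro ξ hξ
    have h := hA ξ
    rw [show A ξ = 0 from hξ, norm_zero] at h
    exact norm_eq_zero.1 (le_antisymm (by nlinarith [norm_nonneg ξ]) (norm_nonneg ξ))
  let e := LinearEquiv.ofInjectiveEndo A.toLinearMap hinj
  let B : E d →L[ℝ] E d := LinearMap.toContinuousLinearMap e.symm.toLinearMap
  have hAB : ∀ ξ, A (B ξ) = ξ := fun ξ => e.apply_symm_apply ξ
  have hB : |B.det| ≤ c⁻¹ ^ d := abs_det_le (by positivity) fun ξ => by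
    have := hA (B ξ)
    rw [hAB] at this
    rwa [le_inv_mul_iff₀ hc]
  have hmul : A.det * B.det = 1 := by
    have : A.toLinearMap ∘ₗ B.toLinearMap = LinearMap.id := LinearMap.ext hAB
    simp only [ContinuousLinearMap.det]
    rw [← LinearMap.det_comp, this, LinearMap.det_id]
  have h1 : |A.det| * |B.det| = 1 := by rw [← abs_mul, hmul, abs_one]
  rw [inv_pow] at hB
  have h2 : 1 ≤ |A.det| * (c ^ d)⁻¹ := by
    rw [← h1]
    gcongr
  rwa [← div_eq_mul_inv, one_le_div (by positivity)] at h2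

/-! ### Smooth bi-Lipschitz maps -/

/-- `Φ` is continuously differentiable, and bi-Lipschitz on the open set `Q`. -/
structure BiLip {d : ℕ} (c C : ℝ) (Φ : E d → E d) (Q : Set (E d)) : Prop where
  c_pos : 0 < c
  C_pos : 0 < C
  isOpen : IsOpen Q
  contDiff : ContDiff ℝ 1 Φ
  lower : ∀ x ∈ Q, ∀ y ∈ Q, c * dist x y ≤ dist (Φ x) (Φ y)
  upper : ∀ x ∈ Q, ∀ y ∈ Q, dist (Φ x) (Φ y) ≤ C * dist x y

namespace BiLip

variable {d : ℕ} {c C : ℝ} {Φ : E d → E d} {Q : Set (E d)}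

theorem hasFDerivAt (h : BiLip c C Φ Q) (x : E d) : HasFDerivAt Φ (fderiv ℝ Φ x) x :=
  (h.contDiff.differentiable (by simp) x).hasFDerivAt

/-- Difference quotients at points of the open set `Q` obey both bounds. The bounds are closed
conditions and the derivative is continuous everywhere, so they persist on the closure, where
boundary values are taken. -/
theorem norm_fderiv_mem (h : BiLip c C Φ Q) {x : E d} (hx : x ∈ closure Q) (ξ : E d) :
    c * ‖ξ‖ ≤ ‖fderiv ℝ Φ x ξ‖ ∧ ‖fderiv ℝ Φ x ξ‖ ≤ C * ‖ξ‖ := by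
  have hcont : Continuous fun x => ‖fderiv ℝ Φ x ξ‖ :=
    ((h.contDiff.continuous_fderiv (by simp)).clm_apply continuous_const).norm
  have hclosed : IsClosed {x | c * ‖ξ‖ ≤ ‖fderiv ℝ Φ x ξ‖ ∧ ‖fderiv ℝ Φ x ξ‖ ≤ C * ‖ξ‖} :=
    (isClosed_le continuous_const hcont).inter (isClosed_le hcont continuous_const)
  refine closure_minimal (fun x hx => ?_) hclosed hx
  have hlim := ((h.hasFDerivAt x).hasLineDerivAt ξ).tendsto_slope_zero.norm
  have hev : ∀ᶠ t : ℝ in 𝓝[≠] 0, x + t • ξ ∈ Q := by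
    have : Tendsto (fun t : ℝ => x + t • ξ) (𝓝 0) (𝓝 x) := by
      have hc : Continuous fun t : ℝ => x + t • ξ := by fun_prop
      simpa using hc.tendsto 0
    exact (this.eventually (h.isOpen.mem_nhds hx)).filter_mono nhdsWithin_le_nhds
  have hd : ∀ t : ℝ, dist (x + t • ξ) x = |t| * ‖ξ‖ := fun t => by
    rw [dist_eq_norm, add_sub_cancel_left, norm_smul, Real.norm_eq_abs]
  constructor
  · refine ge_of_tendsto hlim ?_
    filter_upwards [hev, self_mem_nhdsWithin] with t ht ht0
    have ht0' : 0 < |t| := abs_pos.2 ht0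
    have := h.lower _ ht _ hx
    rw [hd, dist_eq_norm] at this
    rw [norm_smul, norm_inv, Real.norm_eq_abs, le_inv_mul_iff₀ ht0']
    linarith
  · refine le_of_tendsto hlim ?_
    filter_upwards [hev, self_mem_nhdsWithin] with t ht ht0
    have ht0' : 0 < |t| := abs_pos.2 ht0
    have := h.upper _ ht _ hx
    rw [hd, dist_eq_norm] at this
    rw [norm_smul, norm_inv, Real.norm_eq_abs, inv_mul_le_iff₀ ht0']
    linarith

theorem abs_det_mem (h : BiLip c C Φ Q) {x : E d} (hx : x ∈ closure Q) :
    c ^ d ≤ |(fderiv ℝ Φ x).det| ∧ |(fderiv ℝ Φ x).det| ≤ C ^ d :=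
  ⟨le_abs_det h.c_pos fun ξ => (h.norm_fderiv_mem hx ξ).1,
    abs_det_le h.C_pos.le fun ξ => (h.norm_fderiv_mem hx ξ).2⟩

theorem det_ne_zero (h : BiLip c C Φ Q) {x : E d} (hx : x ∈ closure Q) :
    (fderiv ℝ Φ x).det ≠ 0 :=
  abs_pos.1 ((pow_pos h.c_pos d).trans_le (h.abs_det_mem hx).1)

theorem isOpen_image (h : BiLip c C Φ Q) : IsOpen (Φ '' Q) := by
  rw [isOpen_iff_mem_nhds]
  rintro _ ⟨x, hx, rfl⟩
  have hstrict : HasStrictFDerivAt Φ (((fderiv ℝ Φ x).toContinuousLinearEquivOfDetNeZero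
      (h.det_ne_zero (subset_closure hx)) : E d ≃L[ℝ] E d) : E d →L[ℝ] E d) x := by
    rw [ContinuousLinearMap.coe_toContinuousLinearEquivOfDetNeZero]
    exact h.contDiff.contDiffAt.hasStrictFDerivAt (by simp)
  rw [← hstrict.map_nhds_eq_of_equiv]
  exact image_mem_map (h.isOpen.mem_nhds hx)

theorem injOn (h : BiLip c C Φ Q) : Set.InjOn Φ Q := by
  intro x hx y hy hxy
  have := h.lower x hx y hy
  rw [hxy, dist_self] at this
  exact dist_le_zero.1 (nonpos_of_mul_nonpos_right this h.c_pos)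

/-- The inverse on the image is Lipschitz with constant c⁻¹ and is extended to a Lipschitz map of
the whole space. The extension makes pulled-back functions meaningful and continuous up to the
boundary of the physical element. -/
theorem exists_inverse (h : BiLip c C Φ Q) : ∃ Ψ : E d → E d, Continuous Ψ ∧
    (∀ x ∈ Q, Ψ (Φ x) = x) ∧ ∀ y ∈ closure (Φ '' Q), Ψ y ∈ closure Q := by
  have hl : LipschitzOnWith (Real.toNNReal c⁻¹) (Function.invFunOn Φ Q) (Φ '' Q) := by
    refine LipschitzOnWith.of_dist_le_mul ?_
    rintro _ ⟨x, hx, rfl⟩ _ ⟨y, hy, rfl⟩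
    rw [h.injOn.leftInvOn_invFunOn hx, h.injOn.leftInvOn_invFunOn hy,
      Real.coe_toNNReal _ (inv_nonneg.2 h.c_pos.le), le_inv_mul_iff₀ h.c_pos]
    exact h.lower x hx y hy
  obtain ⟨Ψ, hΨ, heq⟩ := hl.extend_finite_dimension
  have hinv : ∀ x ∈ Q, Ψ (Φ x) = x := fun x hx => by
    rw [← heq ⟨x, hx, rfl⟩, h.injOn.leftInvOn_invFunOn hx]
  refine ⟨Ψ, hΨ.continuous, hinv, fun y hy => ?_⟩
  have : Set.MapsTo Ψ (Φ '' Q) Q := by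
    rintro _ ⟨x, hx, rfl⟩
    rwa [hinv x hx]
  exact this.closure hΨ.continuous hy

theorem volume_image_le (h : BiLip c C Φ Q) {A : Set (E d)} (hA : A ⊆ Q) :
    volume (Φ '' A) ≤ ENNReal.ofReal (C ^ d) * volume A :=
  TrimmedStokes.volume_image_le h.C_pos.le fun x hx y hy => h.upper x (hA hx) y (hA hy)

theorem le_volume_image (h : BiLip c C Φ Q) {A : Set (E d)} (hA : A ⊆ Q) :
    ENNReal.ofReal (c ^ d) * volume A ≤ volume (Φ '' A) := by
  have hinv : Function.invFunOn Φ Q '' (Φ '' A) = A := by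
    rw [Set.image_image]
    exact (Set.image_congr fun x hx => h.injOn.leftInvOn_invFunOn (hA hx)).trans (Set.image_id' A)
  have := TrimmedStokes.volume_image_le (f := Function.invFunOn Φ Q) (s := Φ '' A)
    (K := c⁻¹) (inv_nonneg.2 h.c_pos.le) (by
      rintro _ ⟨x, hx, rfl⟩ _ ⟨y, hy, rfl⟩
      rw [h.injOn.leftInvOn_invFunOn (hA hx), h.injOn.leftInvOn_invFunOn (hA hy),
        le_inv_mul_iff₀ h.c_pos]
      exact h.lower x (hA hx) y (hA hy))
  rw [hinv] at this
  calc ENNReal.ofReal (c ^ d) * volume A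
      ≤ ENNReal.ofReal (c ^ d) * (ENNReal.ofReal (c⁻¹ ^ d) * volume (Φ '' A)) := by gcongr
    _ = volume (Φ '' A) := by
      have hc := h.c_pos
      rw [← mul_assoc, ← ENNReal.ofReal_mul (by positivity), ← mul_pow, mul_inv_cancel₀ hc.ne',
        one_pow, ENNReal.ofReal_one, one_mul]

end BiLip

/-! ### Splines are polynomials on each element -/

/-- The hypothesis on `ξ` says that no knot lies in the open interval, so the indicator functions at
the bottom of the recursion are constant on it. -/
theorem exists_polynomial_bspline {a b : ℝ} {ξ : ℕ → ℝ} (hξ : ∀ n, ξ n ≤ a ∨ b ≤ ξ n) (p i : ℕ) :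
    ∃ P : Polynomial ℝ, P.natDegree ≤ p ∧ ∀ x ∈ Set.Ioo a b, bspline ξ p i x = P.eval x := by
  induction p generalizing i with
  | zero =>
    by_cases h : ξ i ≤ a ∧ b ≤ ξ (i + 1)
    · refine ⟨1, by simp, fun x hx => ?_⟩
      simp [bspline, h.1.trans hx.1.le, hx.2.trans_le h.2]
    · refine ⟨0, by simp, fun x hx => ?_⟩
      rw [bspline, if_neg, Polynomial.eval_zero]
      rintro ⟨h1, h2⟩
      refine h ⟨(hξ i).resolve_right fun h3 => ?_, (hξ (i + 1)).resolve_left fun h3 => ?_⟩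
      · exact (hx.2.trans_le h3).not_ge h1
      · exact (h3.trans_lt hx.1).not_gt h2
  | succ p ih =>
    obtain ⟨P, hP, hPx⟩ := ih i
    obtain ⟨R, hR, hRx⟩ := ih (i + 1)
    refine ⟨Polynomial.C (ξ (i + p + 1) - ξ i)⁻¹ * (Polynomial.X - Polynomial.C (ξ i)) * P +
      Polynomial.C (ξ (i + p + 2) - ξ (i + 1))⁻¹ *
        (Polynomial.C (ξ (i + p + 2)) - Polynomial.X) * R, ?_, fun x hx => ?_⟩
    · have h1 : ∀ a b : ℝ, (Polynomial.C a * (Polynomial.X - Polynomial.C b)).natDegree ≤ 1 :=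
        fun a b => (Polynomial.natDegree_C_mul_le _ _).trans (Polynomial.natDegree_X_sub_C_le _)
      have h2 : ∀ a b : ℝ, (Polynomial.C a * (Polynomial.C b - Polynomial.X)).natDegree ≤ 1 :=
        fun a b => (Polynomial.natDegree_C_mul_le _ _).trans
          (by rw [← neg_sub, Polynomial.natDegree_neg]; exact Polynomial.natDegree_X_sub_C_le _)
      refine (Polynomial.natDegree_add_le _ _).trans (max_le ?_ ?_)
      · refine Polynomial.natDegree_mul_le.trans ?_
        have := h1 (ξ (i + p + 1) - ξ i)⁻¹ (ξ i)
        omega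
      · refine Polynomial.natDegree_mul_le.trans ?_
        have := h2 (ξ (i + p + 2) - ξ (i + 1))⁻¹ (ξ (i + p + 2))
        omega
    · rw [bspline, hPx x hx, hRx x hx]
      simp [div_eq_inv_mul]

/-- Every knot of the coarse mesh is a breakpoint of the refinement, hence outside each open fine
element. It is applied to the patch map with `T₀` the coarse mesh, and to velocities with `T₀ = T`.
-/
theorem CartesianMesh.exists_isPoly {d : ℕ} {T T₀ : CartesianMesh d} (hT : T.Refines T₀)
    {p r : Fin d → ℕ} {s : E d → ℝ} (hs : s ∈ T₀.splineSpace p r) (j : T.Cell) :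
    ∃ f : E d → ℝ, IsPoly (∑ i, p i) f ∧ ∀ x ∈ T.Q j, s x = f x := by
  induction hs using Submodule.span_induction with
  | mem s hs =>
    obtain ⟨a, rfl⟩ := hs
    have hknot : ∀ i n, T₀.knot i (p i) (r i) n ≤ T.ζ i (j i).castSucc ∨
        T.ζ i (j i).succ ≤ T₀.knot i (p i) (r i) n := by
      intro i n
      obtain ⟨l, hl⟩ := hT i ⟨_, rfl⟩
      rw [CartesianMesh.knot, ← hl]
      rcases le_or_gt l (j i).castSucc with h | h
      · exact Or.inl ((T.strictMono i).monotone h)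
      · exact Or.inr ((T.strictMono i).monotone (Fin.castSucc_lt_iff_succ_le.1 h))
    choose P hP hPx using fun i => exists_polynomial_bspline (hknot i) (p i) (a i)
    refine ⟨fun x => ∏ i, (P i).eval (x i),
      IsPoly.prod _ fun i _ => IsPoly.of_polynomial _ _ (hP i), fun x hx => ?_⟩
    exact Finset.prod_congr rfl fun i _ => hPx i _ (hx i)
  | zero => exact ⟨fun _ => 0, IsPoly.const _ _, fun x _ => rfl⟩
  | add s t _ _ hs ht =>
    obtain ⟨f, hf, hfx⟩ := hs
    obtain ⟨g, hg, hgx⟩ := ht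
    exact ⟨_, hf.add hg, fun x hx => by simp [hfx x hx, hgx x hx]⟩
  | smul a s _ hs =>
    obtain ⟨f, hf, hfx⟩ := hs
    exact ⟨_, hf.const_mul a, fun x hx => by simp [hfx x hx]⟩

namespace CartesianMesh

variable {d : ℕ} (T : CartesianMesh d)

/-! ### Parametric elements -/

/-- The edge length in direction `i` of the parametric element `j`. -/
def edge (j : T.Cell) (i : Fin d) : ℝ := T.ζ i (j i).succ - T.ζ i (j i).castSucc

variable {T}

theorem edge_pos (j : T.Cell) (i : Fin d) : 0 < T.edge j i :=
  sub_pos.2 (T.strictMono i (Fin.castSucc_lt_succ))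

theorem Q_eq_preimage (j : T.Cell) :
    T.Q j = (fun x : E d => x.ofLp) ⁻¹'
      Set.univ.pi fun i => Set.Ioo (T.ζ i (j i).castSucc) (T.ζ i (j i).succ) := by
  ext x
  simp [Q]

theorem isOpen_Q (j : T.Cell) : IsOpen (T.Q j) := by
  rw [Q_eq_preimage]
  exact (isOpen_set_pi Set.finite_univ fun _ _ => isOpen_Ioo).preimage (PiLp.continuous_ofLp 2 _)

theorem convex_Q (j : T.Cell) : Convex ℝ (T.Q j) := by
  intro x hx y hy a b ha hb hab i
  exact convex_Ioo _ _ (hx i) (hy i) ha hb hab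

theorem volume_Q (j : T.Cell) : volume (T.Q j) = ENNReal.ofReal (∏ i, T.edge j i) := by
  have hm : MeasurableSet
      (Set.univ.pi fun i => Set.Ioo (T.ζ i (j i).castSucc) (T.ζ i (j i).succ)) :=
    MeasurableSet.univ_pi fun _ => measurableSet_Ioo
  rw [Q_eq_preimage, (PiLp.volume_preserving_ofLp (Fin d)).measure_preimage hm.nullMeasurableSet,
    Real.volume_pi_Ioo, ENNReal.ofReal_prod_of_nonneg fun i _ => (edge_pos j i).le]
  rfl

/-- The center of a parametric element. -/
noncomputable def center (j : T.Cell) : E d :=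
  WithLp.toLp 2 fun i => (T.ζ i (j i).castSucc + T.ζ i (j i).succ) / 2

theorem center_add_mem (j : T.Cell) (i : Fin d) {t : ℝ} (ht : |t| < T.edge j i / 2) :
    center j + EuclideanSpace.single i t ∈ T.Q j := by
  intro l
  have hl := edge_pos j l
  rw [abs_lt] at ht
  unfold edge at *
  by_cases h : l = i
  · subst h
    simp only [center, PiLp.add_apply, PiLp.single_apply, if_true, Set.mem_Ioo]
    constructor <;> linarith [ht.1, ht.2]
  · simp only [center, PiLp.add_apply, PiLp.single_apply, if_neg h, Set.mem_Ioo]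
    constructor <;> linarith

theorem center_mem (j : T.Cell) : center j ∈ T.Q j := by
  intro l
  have hl := edge_pos j l
  unfold edge at hl
  simp only [center, Set.mem_Ioo]
  constructor <;> linarith

theorem Q_subset_unitCube (j : T.Cell) : T.Q j ⊆ unitCube d := by
  intro x hx i
  refine ⟨?_, ?_⟩
  · refine lt_of_le_of_lt ?_ (hx i).1
    rw [← T.first i]
    exact (T.strictMono i).monotone (Fin.zero_le _)
  · refine lt_of_lt_of_le (hx i).2 ?_
    rw [← T.last i]
    exact (T.strictMono i).monotone (Fin.le_last _)

theorem isBounded_unitCube : Bornology.IsBounded (unitCube d) := by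
  rw [Metric.isBounded_iff_subset_closedBall 0]
  refine ⟨∑ _i : Fin d, 1, fun x hx => ?_⟩
  rw [mem_closedBall_zero_iff, EuclideanSpace.norm_eq]
  refine (Real.sqrt_le_sqrt (Finset.sum_le_sum (g := fun _ => (1 : ℝ)) fun i _ => ?_)).trans ?_
  · rw [Real.norm_eq_abs, sq_abs]
    nlinarith [(hx i).1, (hx i).2]
  · have hn : (0 : ℝ) ≤ ∑ _i : Fin d, 1 := by simp
    rcases Nat.eq_zero_or_pos d with h | h
    · subst h; simp
    · rw [Real.sqrt_le_left hn]
      have : (1 : ℝ) ≤ ∑ _i : Fin d, 1 := by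
        have : (1 : ℝ) ≤ d := by exact_mod_cast h
        simpa using this
      nlinarith

theorem isBounded_Q (j : T.Cell) : Bornology.IsBounded (T.Q j) :=
  isBounded_unitCube.subset (Q_subset_unitCube j)

theorem edge_le_diam (j : T.Cell) (i : Fin d) : T.edge j i ≤ Metric.diam (T.Q j) := by
  refine le_of_forall_lt fun t ht => ?_
  rcases lt_or_ge t 0 with h | h
  · exact h.trans_le Metric.diam_nonneg
  obtain ⟨s, hs, hs'⟩ := exists_between ht
  have hs0 : 0 < s := h.trans_lt hs
  have h1 := Metric.dist_le_diam_of_mem (isBounded_Q j)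
    (center_add_mem j i (t := s / 2) (by rw [abs_of_pos (by positivity)]; linarith))
    (center_add_mem j i (t := -(s / 2)) (by rw [abs_neg, abs_of_pos (by positivity)]; linarith))
  rw [dist_add_left, PiLp.dist_single_same, Real.dist_eq, sub_neg_eq_add, add_halves,
    abs_of_pos hs0] at h1
  exact hs.trans_le h1

theorem eq_of_mem_Q {j j' : T.Cell} {x : E d} (hx : x ∈ T.Q j) (hx' : x ∈ T.Q j') : j = j' := by
  have key : ∀ (a b : T.Cell) (i : Fin d), x ∈ T.Q a → x ∈ T.Q b → ¬ a i < b i := by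
    intro a b i ha hb hlt
    have h1 : T.ζ i (a i).succ ≤ T.ζ i (b i).castSucc :=
      (T.strictMono i).monotone (Fin.le_def.2 (by simpa using hlt))
    exact lt_irrefl _ (((ha i).2.trans_le h1).trans (hb i).1)
  funext i
  exact le_antisymm (not_lt.1 (key j' j i hx' hx)) (not_lt.1 (key j j' i hx hx'))

theorem volume_coord_eq (i : Fin d) (a : ℝ) : volume {x : E d | x i = a} = 0 := by
  have h : IsPoly 1 (fun x : E d => x i - a) := (IsPoly.coord i).sub (IsPoly.const 1 a)
  have := h.volume_zeros (x := EuclideanSpace.single i (a + 1)) (by simp)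
  simpa [sub_eq_zero] using this

theorem volume_unitCube_diff : volume (unitCube d \ ⋃ j, T.Q j) = 0 := by
  refine measure_mono_null (t := ⋃ i, ⋃ m, {x : E d | x i = T.ζ i m}) (fun x hx => ?_)
    (measure_iUnion_null fun i => measure_iUnion_null fun m => volume_coord_eq i _)
  by_contra hne
  simp only [Set.mem_iUnion, not_exists] at hne
  have key : ∀ i, ∃ m : Fin (T.n i), x i ∈ Set.Ioo (T.ζ i m.castSucc) (T.ζ i m.succ) := by
    intro i
    by_contra! hno
    -- A coordinate that avoids every breakpoint and every open interval would climb past all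
    -- breakpoints in turn, including the last one, which is 1.
    have hall : ∀ m : Fin (T.n i + 1), T.ζ i m < x i := by
      intro m
      induction m using Fin.induction with
      | zero => rw [T.first]; exact (hx.1 i).1
      | succ m ih =>
        have h1 : ¬ x i < T.ζ i m.succ := fun h => hno m ⟨ih, h⟩
        exact lt_of_le_of_ne (not_lt.1 h1) fun h => hne i _ h.symm
    have := hall (Fin.last _)
    rw [T.last] at this
    exact lt_irrefl _ (this.trans (hx.1 i).2)
  choose m hm using key
  exact hx.2 (Set.mem_iUnion.2 ⟨m, hm⟩)

theorem diam_Q_pos (hd : 0 < d) (j : T.Cell) : 0 < Metric.diam (T.Q j) :=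
  (edge_pos j ⟨0, hd⟩).trans_le (edge_le_diam j _)

namespace ShapeRegular

variable {σ : ℝ}

theorem pos (h : T.ShapeRegular σ) (hd : 0 < d) (j : T.Cell) : 0 < σ :=
  pos_of_mul_pos_left ((diam_Q_pos hd j).trans_le (h j ⟨0, hd⟩)) (edge_pos j ⟨0, hd⟩).le

/-- The element `j''` takes its position in direction 0 from `j` and in the other directions from
`j'`, so it shares one edge length with each. Comparing its edges with its diameter links two
arbitrary elements: shape regularity of a tensor-product mesh forces quasi-uniformity as soon as
there are two directions. -/
theorem diam_le_diam (h : T.ShapeRegular σ) (hd : 2 ≤ d) (j j' : T.Cell) :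
    Metric.diam (T.Q j) ≤ σ ^ 2 * Metric.diam (T.Q j') := by
  have hσ := h.pos (by omega) j
  let i0 : Fin d := ⟨0, by omega⟩
  let i1 : Fin d := ⟨1, by omega⟩
  have hne : i1 ≠ i0 := by simp [i0, i1]
  let j'' : T.Cell := Function.update j' i0 (j i0)
  have h0 : T.edge j'' i0 = T.edge j i0 := by simp [edge, j'']
  have h1 : T.edge j'' i1 = T.edge j' i1 := by simp [edge, j'', hne]
  calc Metric.diam (T.Q j) ≤ σ * T.edge j'' i0 := h0 ▸ h j i0
    _ ≤ σ * (σ * T.edge j' i1) := by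
        gcongr
        exact (edge_le_diam j'' i0).trans (h1 ▸ h j'' i1)
    _ ≤ σ * (σ * Metric.diam (T.Q j')) := by
        gcongr
        exact edge_le_diam j' i1
    _ = _ := by ring

theorem le_volume (h : T.ShapeRegular σ) (hd : 0 < d) (j : T.Cell) :
    ENNReal.ofReal ((Metric.diam (T.Q j) / σ) ^ d) ≤ volume (T.Q j) := by
  have hσ := h.pos hd j
  rw [volume_Q]
  refine ENNReal.ofReal_le_ofReal ?_
  calc (Metric.diam (T.Q j) / σ) ^ d = ∏ _i : Fin d, Metric.diam (T.Q j) / σ := by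
        rw [Finset.prod_const, Finset.card_univ, Fintype.card_fin]
    _ ≤ ∏ i, T.edge j i := by
      refine Finset.prod_le_prod (fun _ _ => by have := Metric.diam_nonneg (s := T.Q j); positivity)
        fun i _ => ?_
      rw [div_le_iff₀' hσ]
      exact h j i

end ShapeRegular

end CartesianMesh

variable {d : ℕ}

/-! ### The patch -/

/-- The vector field with components `φ i`. -/
def ofComponents (φ : Fin d → E d → ℝ) (x : E d) : E d := WithLp.toLp 2 fun i => φ i x

theorem contDiff_ofComponents {φ : Fin d → E d → ℝ} {n : WithTop ℕ∞}
    (hφ : ∀ i, ContDiff ℝ n (φ i)) : ContDiff ℝ n (ofComponents φ) :=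
  contDiff_euclidean.2 hφ

namespace Patch

variable {P : Patch d} {c C : ℝ}

/-- The map of the patch is bi-Lipschitz with constants `c` and `C`. -/
structure BiLipWith (P : Patch d) (c C : ℝ) : Prop where
  c_pos : 0 < c
  C_pos : 0 < C
  lower : ∀ x ∈ unitCube d, ∀ y ∈ unitCube d, c * dist x y ≤ dist (P.map x) (P.map y)
  upper : ∀ x ∈ unitCube d, ∀ y ∈ unitCube d, dist (P.map x) (P.map y) ≤ C * dist x y

theorem exists_biLipWith (P : Patch d) : ∃ c C, P.BiLipWith c C := by
  obtain ⟨c, C, hc, h⟩ := P.biLipschitz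
  refine ⟨c, max C 1, hc, by positivity, fun x hx y hy => (h x hx y hy).1, fun x hx y hy => ?_⟩
  exact (h x hx y hy).2.trans (by gcongr; exact le_max_left _ _)

theorem BiLipWith.injOn (h : P.BiLipWith c C) : Set.InjOn P.map (unitCube d) := by
  intro x hx y hy hxy
  have := h.lower x hx y hy
  rw [hxy, dist_self] at this
  exact dist_le_zero.1 (nonpos_of_mul_nonpos_right this h.c_pos)

theorem BiLipWith.continuousOn (h : P.BiLipWith c C) : ContinuousOn P.map (unitCube d) :=
  (LipschitzOnWith.of_dist_le_mul (K := ⟨C, h.C_pos.le⟩) h.upper).continuousOn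

/-- The patch map is known only on the cube and is smooth only inside the elements. The polynomial
map that represents it on one element is smooth on the whole space, in particular up to the closure
of that element. -/
theorem BiLipWith.exists_cellMap (h : P.BiLipWith c C) {T : CartesianMesh d}
    (hT : T.Refines P.mesh) (j : T.Cell) :
    ∃ φ : Fin d → E d → ℝ, (∀ i, IsPoly (∑ l, P.deg l) (φ i)) ∧
      Set.EqOn P.map (ofComponents φ) (T.Q j) ∧ BiLip c C (ofComponents φ) (T.Q j) := by
  have key : ∀ i, ∃ f : E d → ℝ, IsPoly (∑ l, P.deg l) f ∧ ∀ x ∈ T.Q j, P.map x i = f x := by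
    intro i
    obtain ⟨s, hs, hsx⟩ := P.isSpline i
    obtain ⟨f, hf, hfx⟩ := CartesianMesh.exists_isPoly hT hs j
    exact ⟨f, hf, fun x hx => (hsx x (CartesianMesh.Q_subset_unitCube j hx)).trans (hfx x hx)⟩
  choose φ hφ hφx using key
  have heq : Set.EqOn P.map (ofComponents φ) (T.Q j) := fun x hx => by
    ext i
    exact hφx i x hx
  refine ⟨φ, hφ, heq, h.c_pos, h.C_pos, CartesianMesh.isOpen_Q j,
    contDiff_ofComponents fun i => (hφ i).contDiff, fun x hx y hy => ?_, fun x hx y hy => ?_⟩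
  · rw [← heq hx, ← heq hy]
    exact h.lower x (CartesianMesh.Q_subset_unitCube j hx) y (CartesianMesh.Q_subset_unitCube j hy)
  · rw [← heq hx, ← heq hy]
    exact h.upper x (CartesianMesh.Q_subset_unitCube j hx) y (CartesianMesh.Q_subset_unitCube j hy)

theorem BiLipWith.isBounded_image (h : P.BiLipWith c C) :
    Bornology.IsBounded (P.map '' unitCube d) := by
  obtain ⟨R, hR⟩ := Metric.isBounded_iff.1 (CartesianMesh.isBounded_unitCube (d := d))
  refine Metric.isBounded_iff.2 ⟨C * R, ?_⟩
  rintro _ ⟨x, hx, rfl⟩ _ ⟨y, hy, rfl⟩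
  have := h.C_pos
  exact (h.upper x hx y hy).trans (by gcongr; exact hR hx hy)

end Patch

/-! ### Physical elements -/

namespace Trimmed

variable {P : Patch d} {D : Trimmed P} {c C : ℝ}

theorem K_subset (j : D.mesh.Cell) : D.K j ⊆ P.map '' unitCube d :=
  Set.image_mono (CartesianMesh.Q_subset_unitCube j)

theorem nonempty_K (j : D.mesh.Cell) : (D.K j).Nonempty :=
  ⟨_, CartesianMesh.center j, CartesianMesh.center_mem j, rfl⟩

theorem isBounded_K (hP : P.BiLipWith c C) (j : D.mesh.Cell) : Bornology.IsBounded (D.K j) :=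
  hP.isBounded_image.subset (K_subset j)

theorem isOpen_K (hP : P.BiLipWith c C) (hT : D.mesh.Refines P.mesh) (j : D.mesh.Cell) :
    IsOpen (D.K j) := by
  obtain ⟨φ, -, heq, hb⟩ := hP.exists_cellMap hT j
  rw [K, heq.image_eq]
  exact hb.isOpen_image

theorem isPreconnected_K (hP : P.BiLipWith c C) (j : D.mesh.Cell) : IsPreconnected (D.K j) :=
  (CartesianMesh.convex_Q j).isPreconnected.image _
    (hP.continuousOn.mono (CartesianMesh.Q_subset_unitCube j))

theorem eq_of_mem_K (hP : P.BiLipWith c C) {j j' : D.mesh.Cell} {y : E d} (hy : y ∈ D.K j)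
    (hy' : y ∈ D.K j') : j = j' := by
  obtain ⟨x, hx, rfl⟩ := hy
  obtain ⟨x', hx', hxx'⟩ := hy'
  have := hP.injOn (CartesianMesh.Q_subset_unitCube j' hx') (CartesianMesh.Q_subset_unitCube j hx)
    hxx'
  exact CartesianMesh.eq_of_mem_Q hx (this ▸ hx')

theorem isOpen_K_inter_Ω (hP : P.BiLipWith c C) (hT : D.mesh.Refines P.mesh) (j : D.mesh.Cell) :
    IsOpen (D.K j ∩ D.Ω) := by
  have : D.K j ∩ D.Ω = D.K j \ closure D.cutOut := by
    ext x
    simp only [Ω, Set.mem_inter_iff, Set.mem_sdiff]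
    exact ⟨fun h => ⟨h.1, h.2.2⟩, fun h => ⟨h.1, K_subset j h.1, h.2⟩⟩
  rw [this]
  exact (isOpen_K hP hT j).sdiff isClosed_closure

theorem volume_Ω_diff (hP : P.BiLipWith c C) : volume (D.Ω \ ⋃ j, D.K j) = 0 := by
  have hsub : D.Ω \ ⋃ j, D.K j ⊆ P.map '' (unitCube d \ ⋃ j, D.mesh.Q j) := by
    rintro _ ⟨⟨⟨x, hx, rfl⟩, -⟩, hx2⟩
    refine ⟨x, ⟨hx, fun h => hx2 ?_⟩, rfl⟩
    obtain ⟨j, hj⟩ := Set.mem_iUnion.1 h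
    exact Set.mem_iUnion.2 ⟨j, x, hj, rfl⟩
  refine measure_mono_null hsub (le_antisymm ?_ bot_le)
  refine (volume_image_le hP.C_pos.le fun x hx y hy => hP.upper x hx.1 y hy.1).trans ?_
  rw [CartesianMesh.volume_unitCube_diff, mul_zero]

theorem h_le (hP : P.BiLipWith c C) (j : D.mesh.Cell) :
    D.h j ≤ C * Metric.diam (D.mesh.Q j) := by
  have hC := hP.C_pos
  refine Metric.diam_le_of_forall_dist_le
    (mul_nonneg hC.le Metric.diam_nonneg) ?_
  rintro _ ⟨x, hx, rfl⟩ _ ⟨y, hy, rfl⟩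
  refine (hP.upper x (CartesianMesh.Q_subset_unitCube j hx) y
    (CartesianMesh.Q_subset_unitCube j hy)).trans ?_
  gcongr
  exact Metric.dist_le_diam_of_mem (CartesianMesh.isBounded_Q j) hx hy

theorem le_h (hP : P.BiLipWith c C) (j : D.mesh.Cell) :
    c * Metric.diam (D.mesh.Q j) ≤ D.h j := by
  have hc := hP.c_pos
  rw [← le_div_iff₀' hc]
  refine Metric.diam_le_of_forall_dist_le (div_nonneg Metric.diam_nonneg hc.le) fun x hx y hy => ?_
  rw [le_div_iff₀' hc]
  refine (hP.lower x (CartesianMesh.Q_subset_unitCube j hx) y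
    (CartesianMesh.Q_subset_unitCube j hy)).trans ?_
  exact Metric.dist_le_diam_of_mem (isBounded_K hP j) ⟨x, hx, rfl⟩ ⟨y, hy, rfl⟩

theorem h_pos (hP : P.BiLipWith c C) (hd : 0 < d) (j : D.mesh.Cell) : 0 < D.h j :=
  (mul_pos hP.c_pos (CartesianMesh.diam_Q_pos hd j)).trans_le (le_h hP j)

theorem h_le_h (hP : P.BiLipWith c C) (hd : 2 ≤ d) {σ : ℝ} (hσ : D.mesh.ShapeRegular σ)
    (j j' : D.mesh.Cell) : D.h j ≤ C * σ ^ 2 / c * D.h j' := by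
  have hC := hP.C_pos
  have hc := hP.c_pos
  calc D.h j ≤ C * Metric.diam (D.mesh.Q j) := h_le hP j
    _ ≤ C * (σ ^ 2 * Metric.diam (D.mesh.Q j')) := by
        gcongr
        exact CartesianMesh.ShapeRegular.diam_le_diam hσ hd j j'
    _ = C * σ ^ 2 / c * (c * Metric.diam (D.mesh.Q j')) := by field_simp
    _ ≤ C * σ ^ 2 / c * D.h j' := by
        gcongr
        exact le_h hP j'

theorem volume_K_lt_top (hP : P.BiLipWith c C) (j : D.mesh.Cell) : volume (D.K j) < ∞ :=
  (isBounded_K hP j).measure_lt_top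

theorem le_volume_K (hP : P.BiLipWith c C) (hT : D.mesh.Refines P.mesh) (hd : 0 < d) {σ : ℝ}
    (hσ : D.mesh.ShapeRegular σ) (j : D.mesh.Cell) :
    (c / σ) ^ d * Metric.diam (D.mesh.Q j) ^ d ≤ volume.real (D.K j) := by
  obtain ⟨φ, -, heq, hb⟩ := hP.exists_cellMap hT j
  have hc := hP.c_pos
  have hσ0 := hσ.pos hd j
  have h1 := hb.le_volume_image subset_rfl
  rw [← heq.image_eq] at h1
  have h2 : ENNReal.ofReal (c ^ d * (Metric.diam (D.mesh.Q j) / σ) ^ d) ≤ volume (D.K j) := by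
    rw [ENNReal.ofReal_mul (by positivity)]
    exact le_trans (by gcongr; exact hσ.le_volume hd j) h1
  have h3 := (ENNReal.ofReal_le_iff_le_toReal (volume_K_lt_top hP j).ne).1 h2
  refine le_trans (le_of_eq ?_) h3
  rw [← mul_pow, ← mul_pow]
  congr 1
  ring

theorem le_volume_K' (hP : P.BiLipWith c C) (hT : D.mesh.Refines P.mesh) (hd : 0 < d) {σ : ℝ}
    (hσ : D.mesh.ShapeRegular σ) (j : D.mesh.Cell) :
    (c / (σ * C)) ^ d * D.h j ^ d ≤ volume.real (D.K j) := by
  refine le_trans ?_ (le_volume_K hP hT hd hσ j)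
  have hc := hP.c_pos
  have hC := hP.C_pos
  have hσ0 := hσ.pos hd j
  have hh := h_pos hP hd j
  rw [← mul_pow, ← mul_pow]
  refine pow_le_pow_left₀ (by positivity) ?_ _
  calc c / (σ * C) * D.h j ≤ c / (σ * C) * (C * Metric.diam (D.mesh.Q j)) := by
        gcongr
        exact h_le hP j
    _ = c / σ * Metric.diam (D.mesh.Q j) := by field_simp

/-- The element is open, so it meets one of the active non-cut elements whose closures cover it;
distinct elements are disjoint, so it is that element. Being connected, meeting Ω and missing the
boundary of Ω, it lies in Ω. -/
theorem neighbor_subset_Ω (hP : P.BiLipWith c C) (hT : D.mesh.Refines P.mesh)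
    {j' : D.mesh.Cell} (hj : D.K j' ⊆ D.closedInterior) : D.K j' ⊆ D.Ω := by
  obtain ⟨x, hx⟩ := nonempty_K j'
  have hx' := hj hx
  simp only [closedInterior, Set.mem_iUnion] at hx'
  obtain ⟨i, ⟨hact, hcut⟩, hxi⟩ := hx'
  obtain ⟨y, hy, hyi⟩ := mem_closure_iff.1 hxi _ (isOpen_K hP hT j') hx
  obtain rfl := eq_of_mem_K hP hy hyi
  by_contra hnot
  rw [Set.not_subset] at hnot
  obtain ⟨z, hz, hzΩ⟩ := hnot
  have hcov : D.K j' ⊆ interior D.Ω ∪ (closure D.Ω)ᶜ := fun w hw => by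
    by_contra h
    rw [Set.mem_union, not_or, Set.mem_compl_iff, not_not] at h
    exact hcut ⟨hact, w, ⟨h.2, h.1⟩, hw⟩
  obtain ⟨u, hu, huΩ⟩ := hact
  obtain ⟨w, -, hw1, hw2⟩ := isPreconnected_K hP j' _ _ isOpen_interior
    isClosed_closure.isOpen_compl hcov
    ⟨u, hu, (hcov hu).resolve_right fun h => h (subset_closure huΩ)⟩
    ⟨z, hz, (hcov hz).resolve_left fun h => hzΩ (interior_subset h)⟩
  exact hw2 (interior_subset_closure hw1)

end Trimmed

variable {d : ℕ}

/-! ### Velocities as quotients of polynomials -/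

theorem fderiv_ofComponents_apply {φ : Fin d → E d → ℝ} {x : E d}
    (hφ : ∀ i, DifferentiableAt ℝ (φ i) x) (ξ : E d) (i : Fin d) :
    fderiv ℝ (ofComponents φ) x ξ i = fderiv ℝ (φ i) x ξ := by
  have h1 : DifferentiableAt ℝ (ofComponents φ) x := differentiableAt_euclidean.2 hφ
  have h2 := (EuclideanSpace.proj i : E d →L[ℝ] ℝ).hasFDerivAt.comp x h1.hasFDerivAt
  have h3 : (EuclideanSpace.proj i : E d →L[ℝ] ℝ) ∘ ofComponents φ = φ i := by
    ext y
    simp [ofComponents]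
  rw [h3] at h2
  rw [h2.fderiv]
  simp

theorem sum_smul_single (ξ : E d) : ∑ l, ξ l • EuclideanSpace.single l (1 : ℝ) = ξ := by
  ext i
  simp [Pi.single_apply]

theorem IsPoly.det_fderiv {m : ℕ} {φ : Fin d → E d → ℝ} (hφ : ∀ i, IsPoly m (φ i)) :
    IsPoly (d * m) (fun x => (fderiv ℝ (ofComponents φ) x).det) := by
  have hdet : (fun x => (fderiv ℝ (ofComponents φ) x).det) = fun x =>
      ∑ s : Equiv.Perm (Fin d), (Equiv.Perm.sign s : ℝ) *
        ∏ i, fderiv ℝ (φ (s i)) x (EuclideanSpace.single i 1) := by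
    ext x
    rw [ContinuousLinearMap.det,
      ← LinearMap.det_toMatrix (EuclideanSpace.basisFun (Fin d) ℝ).toBasis,
      Matrix.det_apply]
    refine Finset.sum_congr rfl fun s _ => ?_
    rw [Units.smul_def, zsmul_eq_mul]
    congr 1
    refine Finset.prod_congr rfl fun i _ => ?_
    rw [LinearMap.toMatrix_apply]
    simp only [OrthonormalBasis.coe_toBasis, EuclideanSpace.basisFun_apply,
      OrthonormalBasis.coe_toBasis_repr_apply, EuclideanSpace.basisFun_repr]
    exact fderiv_ofComponents_apply (fun i => (hφ i).differentiable x) _ _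
  rw [hdet]
  refine IsPoly.sum _ fun s _ => IsPoly.const_mul _ ?_
  refine (IsPoly.prod Finset.univ (k := fun _ => m) fun i _ => (hφ (s i)).deriv _).mono ?_
  simp

theorem StokesElement.deg_le (el : StokesElement) (k : ℕ) (i l : Fin d) : el.deg k i l ≤ k + 1 := by
  cases el
  · simp only [StokesElement.deg]
    split_ifs <;> omega
  · exact le_rfl
  · exact le_rfl

variable {P : Patch d} {c C : ℝ}

/-- On each element the push-forward of a spline velocity is the quotient of a polynomial vector
field by a polynomial that is bounded above and below. -/
theorem exists_quotient (hd : 0 < d) {T : CartesianMesh d} {j : T.Cell}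
    {φ : Fin d → E d → ℝ} {m : ℕ} (hφ : ∀ i, IsPoly m (φ i))
    (heq : Set.EqOn P.map (ofComponents φ) (T.Q j)) (hb : BiLip c C (ofComponents φ) (T.Q j))
    (el : StokesElement) (k r : ℕ) {v w : E d → E d} (hw : w ∈ el.paramVelocity k r T)
    (hv : ∀ x ∈ T.Q j, el.pullback P.map v x = w x) :
    ∃ (q : Fin d → E d → ℝ) (δ : E d → ℝ), (∀ i, IsPoly (d * m + d * (k + 1)) (q i)) ∧
      IsPoly (d * m + d * (k + 1)) δ ∧
      (∀ x ∈ closure (T.Q j), min 1 (c ^ d) ≤ |δ x| ∧ |δ x| ≤ max 1 (C ^ d)) ∧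
      ∀ x ∈ T.Q j, v (P.map x) = (δ x)⁻¹ • ofComponents q x := by
  have hpoly : ∀ i, ∃ f : E d → ℝ, IsPoly (d * (k + 1)) f ∧ ∀ x ∈ T.Q j, w x i = f x := by
    intro i
    obtain ⟨f, hf, hfx⟩ := CartesianMesh.exists_isPoly (T := T) (fun _ => subset_rfl) (hw i) j
    refine ⟨f, hf.mono ?_, hfx⟩
    refine (Finset.sum_le_sum fun l _ => el.deg_le k i l).trans ?_
    simp
  choose f hf hfx using hpoly
  have hwf : ∀ x ∈ T.Q j, w x = ofComponents f x := fun x hx => by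
    ext i
    exact hfx i x hx
  -- Inverting the Piola transformation gives v ∘ F = det(DF)⁻¹ DF w, with polynomial numerator DF w
  -- and denominator det DF. The minimum and maximum with 1 in the bounds also cover Taylor-Hood,
  -- where the denominator is 1.
  have hpiola : (∀ x ∈ T.Q j, (fderiv ℝ P.map x).det • (fderiv ℝ P.map x).inverse (v (P.map x)) =
      w x) → ∃ (q : Fin d → E d → ℝ) (δ : E d → ℝ), (∀ i, IsPoly (d * m + d * (k + 1)) (q i)) ∧
      IsPoly (d * m + d * (k + 1)) δ ∧
      (∀ x ∈ closure (T.Q j), min 1 (c ^ d) ≤ |δ x| ∧ |δ x| ≤ max 1 (C ^ d)) ∧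
      ∀ x ∈ T.Q j, v (P.map x) = (δ x)⁻¹ • ofComponents q x := by
    intro hv
    refine ⟨fun i x => ∑ l, fderiv ℝ (φ i) x (EuclideanSpace.single l 1) * f l x,
      fun x => (fderiv ℝ (ofComponents φ) x).det, fun i => IsPoly.sum _ fun l _ =>
        (((hφ i).deriv _).mul (hf l)).mono ?_, (IsPoly.det_fderiv hφ).mono (by omega), fun x hx =>
        ⟨(min_le_right _ _).trans (hb.abs_det_mem hx).1,
          (hb.abs_det_mem hx).2.trans (le_max_right _ _)⟩, fun x hx => ?_⟩
    · have := Nat.le_mul_of_pos_left m hd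
      omega
    have hA : fderiv ℝ P.map x = fderiv ℝ (ofComponents φ) x :=
      (heq.eventuallyEq_of_mem ((CartesianMesh.isOpen_Q j).mem_nhds hx)).fderiv_eq
    have h1 := hv x hx
    rw [hA] at h1
    set A := fderiv ℝ (ofComponents φ) x with hAdef
    have hdet := hb.det_ne_zero (subset_closure hx)
    rw [← hAdef] at hdet
    have hinv : A (A.inverse (v (P.map x))) = v (P.map x) := by
      have : A = (A.toContinuousLinearEquivOfDetNeZero hdet : E d →L[ℝ] E d) := by simp
      rw [this, ContinuousLinearMap.inverse_equiv]
      simp only [ContinuousLinearEquiv.coe_coe, ContinuousLinearEquiv.apply_symm_apply]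
    have h2 : v (P.map x) = A.det⁻¹ • A (w x) := by
      rw [← h1, map_smul, inv_smul_smul₀ hdet, hinv]
    rw [h2, hwf x hx]
    congr 1
    ext i
    conv_lhs => rw [← sum_smul_single (ofComponents f x), map_sum]
    simp only [map_smul, WithLp.ofLp_sum, Finset.sum_apply, PiLp.smul_apply, smul_eq_mul]
    refine Finset.sum_congr rfl fun l _ => ?_
    rw [hAdef, fderiv_ofComponents_apply fun i => (hφ i).differentiable x, mul_comm]
    rfl
  cases el
  · exact hpiola hv
  · exact hpiola hv
  · refine ⟨f, fun _ => 1, fun i => (hf i).mono (by omega), IsPoly.const _ _, fun x _ => ?_,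
      fun x hx => ?_⟩
    · simp
    · rw [inv_one, one_smul, ← hwf x hx, ← hv x hx]
      rfl

/-! ### Norms of matrices -/

theorem norm_apply_single_le (A : E d →L[ℝ] E d) (l : Fin d) :
    ‖A (EuclideanSpace.single l 1)‖ ≤ ‖A‖ := by
  simpa using A.le_opNorm (EuclideanSpace.single l (1 : ℝ))

theorem abs_entry_le_norm (A : E d →L[ℝ] E d) (i l : Fin d) :
    |A (EuclideanSpace.single l 1) i| ≤ ‖A‖ :=
  (PiLp.norm_apply_le _ i).trans (norm_apply_single_le A l)

theorem norm_le_of_entries {A : E d →L[ℝ] E d} {M : ℝ}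
    (h : ∀ i l, |A (EuclideanSpace.single l 1) i| ≤ M) (hM : 0 ≤ M) : ‖A‖ ≤ d ^ 2 * M := by
  refine A.opNorm_le_bound (by positivity) fun ξ => ?_
  have hcol : ∀ l, ‖A (EuclideanSpace.single l 1)‖ ≤ d * M := by
    intro l
    rw [← sum_smul_single (A (EuclideanSpace.single l 1))]
    refine (norm_sum_le _ _).trans ?_
    refine (Finset.sum_le_sum (g := fun _ => M) fun i _ => ?_).trans (by simp)
    rw [norm_smul]
    simpa using h i l
  conv_lhs => rw [← sum_smul_single ξ, map_sum]
  refine (norm_sum_le _ _).trans ?_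
  refine (Finset.sum_le_sum (g := fun _ => ‖ξ‖ * (d * M)) fun l _ => ?_).trans (le_of_eq ?_)
  · rw [map_smul, norm_smul]
    gcongr
    · exact PiLp.norm_apply_le ξ l
    · exact hcol l
  · rw [Finset.sum_const, Finset.card_univ, Fintype.card_fin, nsmul_eq_mul]
    ring

variable {d : ℕ}

/-! ### Quotients of polynomials -/

section Quotient

variable {M : ℕ} {q : Fin d → E d → ℝ} {δ : E d → ℝ}

theorem contDiffAt_quotient (hq : ∀ i, IsPoly M (q i)) (hδ : IsPoly M δ) {x : E d}
    (hx : δ x ≠ 0) {n : WithTop ℕ∞} :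
    ContDiffAt ℝ n (fun x => (δ x)⁻¹ • ofComponents q x) x :=
  (hδ.contDiff.contDiffAt.inv hx).smul
    (contDiff_ofComponents fun i => (hq i).contDiff).contDiffAt

/-- Quotient rule. After multiplication by δ² the derivative has polynomial entries, to which the
sublevel estimate applies. -/
theorem exists_numerator (hq : ∀ i, IsPoly M (q i)) (hδ : IsPoly M δ) :
    ∃ g : Fin d → Fin d → E d → ℝ, (∀ i l, IsPoly (M + M) (g i l)) ∧ ∀ x, δ x ≠ 0 → ∀ i l,
      fderiv ℝ (fun x => (δ x)⁻¹ • ofComponents q x) x (EuclideanSpace.single l 1) i =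
        g i l x / δ x ^ 2 := by
  refine ⟨fun i l x => δ x * fderiv ℝ (q i) x (EuclideanSpace.single l 1) -
    q i x * fderiv ℝ δ x (EuclideanSpace.single l 1), fun i l =>
      (hδ.mul ((hq i).deriv _)).sub ((hq i).mul (hδ.deriv _)), fun x hx i l => ?_⟩
  have hder : ∀ i, HasFDerivAt (fun x => (δ x)⁻¹ * q i x)
      ((δ x)⁻¹ • fderiv ℝ (q i) x + q i x • (-(δ x ^ 2)⁻¹ • fderiv ℝ δ x)) x := fun i =>
    HasFDerivAt.fun_mul
      ((hasDerivAt_inv hx).comp_hasFDerivAt x (hδ.differentiable x).hasFDerivAt)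
      ((hq i).differentiable x).hasFDerivAt
  have : (fun x => (δ x)⁻¹ • ofComponents q x) = ofComponents fun i x => (δ x)⁻¹ * q i x := by
    ext x i
    simp [ofComponents]
  rw [this, fderiv_ofComponents_apply fun i => (hder i).differentiableAt, (hder i).fderiv]
  simp only [add_apply, smul_apply, smul_eq_mul]
  field_simp
  ring

end Quotient

/-! ### Velocities on an element -/

/-- On the element `K j` the velocity `v` and its derivative are given by functions `u` and `H` that
extend continuously to the closure of the element and satisfy inverse inequalities. -/
structure IsCellField {P : Patch d} (D : Trimmed P) (C₀ θ : ℝ) (v : E d → E d) (j : D.mesh.Cell)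
    (u : E d → E d) (H : E d → E d →L[ℝ] E d) : Prop where
  continuousOn_u : ContinuousOn u (closure (D.K j))
  continuousOn_H : ContinuousOn H (closure (D.K j))
  eqOn : Set.EqOn v u (D.K j ∩ D.Ω)
  hasFDerivAt : ∀ y ∈ D.K j ∩ D.Ω, HasFDerivAt v (H y) y
  osc : ∀ M, (∀ y ∈ D.K j, ‖H y‖ ≤ M) → ∀ y ∈ D.K j, ∀ y' ∈ D.K j,
    ‖u y - u y'‖ ≤ C₀ * M * D.h j
  level : ∀ A ⊆ D.K j, MeasurableSet A → θ * volume.real (D.K j) ≤ volume.real A →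
    ∀ y ∈ D.K j, ‖H y‖ ^ 2 * volume.real (D.K j) ≤ C₀ * ∫ y in A, ‖H y‖ ^ 2

variable {P : Patch d} {c C : ℝ}

theorem BiLip.inverse_fderiv {Φ : E d → E d} {Q : Set (E d)} (h : BiLip c C Φ Q) {x : E d}
    (hx : x ∈ closure Q) :
    ∃ e : E d ≃L[ℝ] E d, (e : E d →L[ℝ] E d) = fderiv ℝ Φ x ∧
      (fderiv ℝ Φ x).inverse = e.symm ∧ ‖fderiv ℝ Φ x‖ ≤ C ∧ ‖(e.symm : E d →L[ℝ] E d)‖ ≤ c⁻¹ := by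
  refine ⟨(fderiv ℝ Φ x).toContinuousLinearEquivOfDetNeZero (h.det_ne_zero hx), by simp, ?_, ?_, ?_⟩
  · rw [← ContinuousLinearMap.inverse_equiv]
    simp
  · exact ContinuousLinearMap.opNorm_le_bound _ h.C_pos.le fun ξ => (h.norm_fderiv_mem hx ξ).2
  · refine ContinuousLinearMap.opNorm_le_bound _ (inv_nonneg.2 h.c_pos.le) fun ξ => ?_
    rw [le_inv_mul_iff₀ h.c_pos]
    refine (h.norm_fderiv_mem hx _).1.trans (le_of_eq ?_)
    congr 1
    exact ((fderiv ℝ Φ x).toContinuousLinearEquivOfDetNeZero (h.det_ne_zero hx)).apply_symm_apply ξ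

theorem setIntegral_norm_sq_ge {A : Set (E d)} {H : E d → E d →L[ℝ] E d}
    (hint : IntegrableOn (fun y => ‖H y‖ ^ 2) A) {a V : ℝ} (ha : 0 ≤ a)
    (hV : V ≤ (volume.restrict A).real {y | a ≤ ‖H y‖}) :
    a ^ 2 * V ≤ ∫ y in A, ‖H y‖ ^ 2 := by
  have h := mul_meas_ge_le_integral_of_nonneg (Eventually.of_forall fun y => by positivity) hint
    (a ^ 2)
  have hset : {y | a ^ 2 ≤ ‖H y‖ ^ 2} = {y | a ≤ ‖H y‖} := by
    ext y
    exact pow_le_pow_iff_left₀ ha (norm_nonneg _) (by norm_num)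
  rw [hset] at h
  exact le_trans (by gcongr) h

/-- In parametric coordinates the norm of the gradient is comparable to the largest of the
polynomial numerators. The sublevel estimate for that numerator shows that the gradient is nowhere
much larger than on most of the element, and hence than on most of any subset filling a fraction θ
of it. -/
theorem exists_cellField (hd : 0 < d) (hP : P.BiLipWith c C) (el : StokesElement) (k r : ℕ)
    {σ θ : ℝ} (hθ : 0 < θ) (hσ0 : 0 < σ) :
    ∃ C₀ > 0, ∀ D : Trimmed P, D.mesh.Refines P.mesh → D.mesh.ShapeRegular σ →
      ∀ v ∈ D.velocity el k r, ∀ j, ∃ u H, IsCellField D C₀ θ v j u H := by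
  have hc := hP.c_pos
  have hC := hP.C_pos
  set m := ∑ l, P.deg l with hm
  set M := d * m + d * (k + 1) with hM
  set a := min 1 (c ^ d) with ha
  set b := max 1 (C ^ d) with hb
  have ha0 : 0 < a := by positivity
  have hb0 : 0 < b := by positivity
  -- Chosen so that the exceptional parametric set, of volume at most ε diam(Q)^d, has an image of
  -- volume at most θ/2 times that of K.
  set ε := θ / 2 * (c / σ) ^ d / C ^ d with hε
  have hε0 : 0 < ε := by positivity
  obtain ⟨δ₀, hδ₀, hlev⟩ := exists_sublevel d (M + M) hε0
  -- The sublevel constant δ₀ divided by the two factors lost in passing from the gradient to its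
  -- numerators (`hent`) and back (`hHle`).
  set κ := δ₀ * (a ^ 2 * c / (d ^ 2 * b ^ 2 * C)) with hκ
  have hd' : (0 : ℝ) < d := by exact_mod_cast hd
  have hκ0 : 0 < κ := by positivity
  refine ⟨max (C / c) (2 / (κ ^ 2 * θ)), by positivity, fun D hT hσ v hv j => ?_⟩
  obtain ⟨v₀, ⟨w, hw, hv₀⟩, hvv₀⟩ := hv
  obtain ⟨φ, hφ, heq, hbl⟩ := hP.exists_cellMap hT j
  obtain ⟨q, δ, hq, hδ, hδb, hquot⟩ := exists_quotient hd hφ heq hbl el k r hw (hv₀ j)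
  obtain ⟨g, hg, hgx⟩ := exists_numerator hq hδ
  obtain ⟨Ψ, hΨ, hΨinv, hΨcl⟩ := hbl.exists_inverse
  have hK : D.K j = ofComponents φ '' D.mesh.Q j := heq.image_eq
  have hKopen := Trimmed.isOpen_K hP hT j
  set Q := D.mesh.Q j with hQ
  set Φ := ofComponents φ with hΦ
  rw [← hK] at hΨcl
  have hΨK : ∀ y ∈ D.K j, Ψ y ∈ Q ∧ Φ (Ψ y) = y := by
    intro y hy
    rw [hK] at hy
    obtain ⟨x, hx, rfl⟩ := hy
    rw [hΨinv x hx]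
    exact ⟨hx, rfl⟩
  have hδ0 : ∀ x ∈ closure Q, δ x ≠ 0 := fun x hx => abs_pos.1 (ha0.trans_le (hδb x hx).1)
  set u₀ : E d → E d := fun x => (δ x)⁻¹ • ofComponents q x with hu₀
  -- Chain rule: the physical gradient, as a function of the parametric point, is the parametric
  -- gradient composed with the inverse of DΦ.
  set H₀ : E d → E d →L[ℝ] E d := fun x => (fderiv ℝ u₀ x).comp (fderiv ℝ Φ x).inverse with hH₀
  have hu₀diff : ∀ x ∈ closure Q, DifferentiableAt ℝ u₀ x := fun x hx =>
    (contDiffAt_quotient hq hδ (hδ0 x hx) (n := 1)).differentiableAt (by simp)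
  have hH₀cont : ∀ x ∈ closure Q, ContinuousAt H₀ x := by
    intro x hx
    have h1 : ContinuousAt (fderiv ℝ u₀) x :=
      ((contDiffAt_quotient hq hδ (hδ0 x hx) (n := 1)).fderiv_right (m := 0) (by simp)).continuousAt
    obtain ⟨e, he, -⟩ := hbl.inverse_fderiv hx
    have h2 : ContinuousAt (fun x => (fderiv ℝ Φ x).inverse) x := by
      refine ContinuousAt.comp (g := ContinuousLinearMap.inverse) ?_
        (hbl.contDiff.continuous_fderiv (by simp)).continuousAt
      rw [← he]
      exact (contDiffAt_map_inverse e (n := 0)).continuousAt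
    exact h1.clm_comp h2
  have hder : ∀ y ∈ D.K j, HasFDerivAt (fun z => u₀ (Ψ z)) (H₀ (Ψ y)) y := by
    intro y hy
    have hx := subset_closure (hΨK y hy).1
    obtain ⟨e, he, hei, -⟩ := hbl.inverse_fderiv hx
    have h1 : HasFDerivAt Ψ (e.symm : E d →L[ℝ] E d) y := by
      refine HasFDerivAt.of_local_left_inverse hΨ.continuousAt (f := Φ) ?_ ?_
      · rw [he]
        exact hbl.hasFDerivAt _
      · filter_upwards [hKopen.mem_nhds hy] with z hz using (hΨK z hz).2
    rw [hH₀]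
    simp only
    rw [hei]
    exact (hu₀diff _ hx).hasFDerivAt.comp y h1
  -- pointwise comparison with the numerator
  have hent : ∀ x ∈ Q, ∀ i l, |g i l x| ≤ b ^ 2 * C * ‖H₀ x‖ := by
    intro x hx i l
    have hx' := subset_closure hx
    obtain ⟨e, he, hei, hnC, -⟩ := hbl.inverse_fderiv hx'
    have h1 : fderiv ℝ u₀ x = (H₀ x).comp (fderiv ℝ Φ x) := by
      rw [hH₀]
      simp only
      rw [hei, ← he]
      ext ξ
      simp
    have h2 : ‖fderiv ℝ u₀ x‖ ≤ ‖H₀ x‖ * C := by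
      rw [h1]
      exact (ContinuousLinearMap.opNorm_comp_le _ _).trans (by gcongr)
    have h3 := (abs_entry_le_norm (fderiv ℝ u₀ x) i l).trans h2
    rw [hgx x (hδ0 x hx'), abs_div, abs_of_nonneg (sq_nonneg (δ x)), div_le_iff₀
      (by have := hδ0 x hx'; positivity)] at h3
    refine h3.trans ?_
    have : δ x ^ 2 ≤ b ^ 2 := by
      rw [← sq_abs]
      gcongr
      exact (hδb x hx').2
    calc ‖H₀ x‖ * C * δ x ^ 2 ≤ ‖H₀ x‖ * C * b ^ 2 := by gcongr
      _ = _ := by ring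
  have hHle : ∀ x ∈ Q, ∀ G, 0 ≤ G → (∀ i l, |g i l x| ≤ G) →
      ‖H₀ x‖ ≤ d ^ 2 / (a ^ 2 * c) * G := by
    intro x hx G hG0 hG
    have hx' := subset_closure hx
    obtain ⟨e, he, hei, -, hnc⟩ := hbl.inverse_fderiv hx'
    have h1 : ‖fderiv ℝ u₀ x‖ ≤ d ^ 2 * (G / a ^ 2) := by
      refine norm_le_of_entries (fun i l => ?_) (by positivity)
      rw [hgx x (hδ0 x hx'), abs_div, abs_of_nonneg (sq_nonneg (δ x))]
      have : a ^ 2 ≤ δ x ^ 2 := by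
        rw [← sq_abs (δ x)]
        gcongr
        exact (hδb x hx').1
      gcongr
      exact hG i l
    calc ‖H₀ x‖ ≤ ‖fderiv ℝ u₀ x‖ * ‖(e.symm : E d →L[ℝ] E d)‖ := by
          rw [hH₀]
          simp only
          rw [hei]
          exact ContinuousLinearMap.opNorm_comp_le _ _
      _ ≤ d ^ 2 * (G / a ^ 2) * c⁻¹ := by gcongr
      _ = _ := by field_simp
  have hρ0 : 0 < Metric.diam Q := CartesianMesh.diam_Q_pos hd j
  have hQball : Q ⊆ Metric.closedBall (CartesianMesh.center j) (Metric.diam Q) := fun x hx =>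
    Metric.dist_le_diam_of_mem (CartesianMesh.isBounded_Q j) hx (CartesianMesh.center_mem j)
  have hcontH : ContinuousOn (fun y => H₀ (Ψ y)) (closure (D.K j)) := fun y hy =>
    (ContinuousAt.comp (hH₀cont _ (hΨcl y hy)) hΨ.continuousAt).continuousWithinAt
  refine ⟨fun y => u₀ (Ψ y), fun y => H₀ (Ψ y), ?_, hcontH, ?_, ?_, ?_, ?_⟩
  · exact fun y hy => (ContinuousAt.comp (hu₀diff _ (hΨcl y hy)).continuousAt
      hΨ.continuousAt).continuousWithinAt
  · rintro y ⟨hy, hyΩ⟩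
    obtain ⟨h1, h2⟩ := hΨK y hy
    rw [hvv₀ hyΩ]
    have h3 := hquot _ h1
    rw [heq h1, h2] at h3
    exact h3
  · rintro y ⟨hy, hyΩ⟩
    refine (hder y hy).congr_of_eventuallyEq ?_
    filter_upwards [(Trimmed.isOpen_K_inter_Ω hP hT j).mem_nhds ⟨hy, hyΩ⟩] with z hz
    obtain ⟨h1, h2⟩ := hΨK z hz.1
    rw [hvv₀ hz.2]
    have h3 := hquot _ h1
    rw [heq h1, h2] at h3
    exact h3
  · intro N hN y hy y' hy'
    have hN0 : 0 ≤ N := (norm_nonneg _).trans (hN y hy)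
    have hbd : ∀ x ∈ Q, ‖fderiv ℝ u₀ x‖ ≤ N * C := by
      intro x hx
      obtain ⟨e, he, hei, hnC, -⟩ := hbl.inverse_fderiv (subset_closure hx)
      have h1 : fderiv ℝ u₀ x = (H₀ x).comp (fderiv ℝ Φ x) := by
        rw [hH₀]
        simp only
        rw [hei, ← he]
        ext ξ
        simp
      have h2 : ‖H₀ x‖ ≤ N := by
        have := hN (Φ x) (hK ▸ ⟨x, hx, rfl⟩)
        rwa [hΨinv x hx] at this
      rw [h1]
      exact (ContinuousLinearMap.opNorm_comp_le _ _).trans (by gcongr)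
    -- The mean value inequality is used in the parametric element, which is convex; the physical
    -- element need not be.
    have h1 := (CartesianMesh.convex_Q j).norm_image_sub_le_of_norm_fderiv_le
      (fun x hx => hu₀diff x (subset_closure hx)) hbd (hΨK y' hy').1 (hΨK y hy).1
    refine h1.trans ?_
    have h2 : c * ‖Ψ y - Ψ y'‖ ≤ D.h j := by
      rw [← dist_eq_norm]
      refine (hbl.lower _ (hΨK y hy).1 _ (hΨK y' hy').1).trans ?_
      rw [(hΨK y hy).2, (hΨK y' hy').2]
      exact Metric.dist_le_diam_of_mem (Trimmed.isBounded_K hP j) hy hy'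
    have hh := (Trimmed.h_pos hP hd j).le
    calc N * C * ‖Ψ y - Ψ y'‖ = C / c * N * (c * ‖Ψ y - Ψ y'‖) := by field_simp
      _ ≤ max (C / c) (2 / (κ ^ 2 * θ)) * N * D.h j := by
        gcongr
        exact le_max_left _ _
  -- The set A will be K ∩ Ω for a good element and all of K for the neighbor of a bad one. The
  -- numerator chosen next is the one that is largest at x, so that it controls the gradient there.
  · intro A hA hAm hAθ y hy
    obtain ⟨hx, hxy⟩ := hΨK y hy
    set x := Ψ y with hxdef
    obtain ⟨⟨i, l⟩, -, hmax⟩ := Finset.exists_max_image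
      (Finset.univ : Finset (Fin d × Fin d)) (fun s => |g s.1 s.2 x|) ⟨(⟨0, hd⟩, ⟨0, hd⟩), by simp⟩
    have hHx : ‖H₀ x‖ ≤ d ^ 2 / (a ^ 2 * c) * |g i l x| :=
      hHle x hx _ (abs_nonneg _) fun i' l' => hmax (i', l') (by simp)
    set S := {z ∈ Metric.closedBall (CartesianMesh.center j) (Metric.diam Q) |
      |g i l z| < δ₀ * |g i l x|} with hS
    have hSvol := hlev (g i l) (hg i l) (CartesianMesh.center j) (Metric.diam Q) hρ0 x (hQball hx)
    have hbad : ∀ z ∈ D.K j, ‖H₀ (Ψ z)‖ < κ * ‖H₀ x‖ → z ∈ Φ '' (S ∩ Q) := by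
      intro z hz hlt
      obtain ⟨h1, h2⟩ := hΨK z hz
      refine ⟨Ψ z, ⟨⟨hQball h1, ?_⟩, h1⟩, h2⟩
      calc |g i l (Ψ z)| ≤ b ^ 2 * C * ‖H₀ (Ψ z)‖ := hent _ h1 i l
        _ < b ^ 2 * C * (κ * ‖H₀ x‖) := by gcongr
        _ ≤ b ^ 2 * C * (κ * (d ^ 2 / (a ^ 2 * c) * |g i l x|)) := by gcongr
        _ = δ₀ * |g i l x| := by
          rw [hκ]
          field_simp
    have hbadvol : volume.real (Φ '' (S ∩ Q)) ≤ θ / 2 * volume.real (D.K j) := by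
      have h1 : volume.real (Φ '' (S ∩ Q)) ≤ C ^ d * volume.real (S ∩ Q) := by
        have h2 := hbl.volume_image_le (A := S ∩ Q) Set.inter_subset_right
        have h3 : volume (S ∩ Q) < ∞ :=
          ((CartesianMesh.isBounded_Q j).subset Set.inter_subset_right).measure_lt_top
        have h4 := ENNReal.toReal_mono (ENNReal.mul_ne_top ENNReal.ofReal_ne_top h3.ne) h2
        rwa [ENNReal.toReal_mul, ENNReal.toReal_ofReal (by positivity)] at h4
      have h2 : volume.real (S ∩ Q) ≤ ε * Metric.diam Q ^ d :=
        (measureReal_mono Set.inter_subset_left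
          ((Metric.isBounded_closedBall.subset fun z hz => hz.1).measure_lt_top.ne)).trans hSvol
      calc volume.real (Φ '' (S ∩ Q)) ≤ C ^ d * (ε * Metric.diam Q ^ d) := by
            refine h1.trans ?_
            gcongr
        _ = θ / 2 * ((c / σ) ^ d * Metric.diam Q ^ d) := by
            rw [hε]
            field_simp
        _ ≤ _ := by
            gcongr
            exact Trimmed.le_volume_K hP hT hd hσ j
    have hcompact : IsCompact (closure (D.K j)) := (Trimmed.isBounded_K hP j).isCompact_closure
    have hint : IntegrableOn (fun y => ‖H₀ (Ψ y)‖ ^ 2) A :=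
      ((hcontH.norm.pow 2).integrableOn_compact hcompact).mono_set (hA.trans subset_closure)
    have hAfin : volume A ≠ ∞ := ((Trimmed.isBounded_K hP j).subset hA).measure_lt_top.ne
    have hV : θ / 2 * volume.real (D.K j) ≤
        (volume.restrict A).real {z | κ * ‖H₀ x‖ ≤ ‖H₀ (Ψ z)‖} := by
      -- The exceptional set takes at most θ/2 of the volume of K, and A has at least θ, so the
      -- gradient is at least κ‖H₀ x‖ on a part of A of relative volume θ/2. Chebyshev's inequality
      -- finishes.
      have hsub : A ⊆ ({z | κ * ‖H₀ x‖ ≤ ‖H₀ (Ψ z)‖} ∩ A) ∪ Φ '' (S ∩ Q) := by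
        intro z hz
        rcases le_or_gt (κ * ‖H₀ x‖) ‖H₀ (Ψ z)‖ with h | h
        · exact Or.inl ⟨h, hz⟩
        · exact Or.inr (hbad z (hA hz) h)
      have hfin2 : volume (Φ '' (S ∩ Q)) ≠ ∞ := by
        refine ((Trimmed.isBounded_K hP j).subset ?_).measure_lt_top.ne
        rw [hK]
        exact Set.image_mono Set.inter_subset_right
      have h1 : volume.real A ≤ volume.real ({z | κ * ‖H₀ x‖ ≤ ‖H₀ (Ψ z)‖} ∩ A) +
          volume.real (Φ '' (S ∩ Q)) :=
        (measureReal_mono hsub (measure_union_ne_top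
          (measure_ne_top_of_subset Set.inter_subset_right hAfin) hfin2)).trans
          (measureReal_union_le _ _)
      have h2 : (volume.restrict A).real {z | κ * ‖H₀ x‖ ≤ ‖H₀ (Ψ z)‖} =
          volume.real ({z | κ * ‖H₀ x‖ ≤ ‖H₀ (Ψ z)‖} ∩ A) := by
        rw [measureReal_def, Measure.restrict_apply' hAm, measureReal_def]
      rw [h2]
      linarith
    have hfinal := setIntegral_norm_sq_ge hint (by positivity) hV
    calc ‖H₀ (Ψ y)‖ ^ 2 * volume.real (D.K j)
        = 2 / (κ ^ 2 * θ) * ((κ * ‖H₀ x‖) ^ 2 * (θ / 2 * volume.real (D.K j))) := by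
          rw [← hxdef]
          field_simp
      _ ≤ _ := by
          gcongr
          exact le_max_right _ _

variable {d : ℕ}

/-! ### The `L²` projection onto polynomial fields -/

namespace StokesElement

variable (el : StokesElement) (k : ℕ)

/-- `polyField` as a linear subspace. -/
def polySubmodule : Submodule ℝ (E d → E d) where
  carrier := el.polyField k
  zero_mem' := fun i => ⟨0, by simp, by simp⟩
  add_mem' := by
    intro q₁ q₂ h₁ h₂ i
    obtain ⟨p₁, hp₁, hq₁⟩ := h₁ i
    obtain ⟨p₂, hp₂, hq₂⟩ := h₂ i
    exact ⟨p₁ + p₂, fun l => (MvPolynomial.degreeOf_add_le _ _ _).trans (max_le (hp₁ l) (hp₂ l)),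
      fun x => by simp [hq₁, hq₂]⟩
  smul_mem' := by
    intro a q h i
    obtain ⟨p, hp, hq⟩ := h i
    exact ⟨MvPolynomial.C a * p, fun l => (MvPolynomial.degreeOf_C_mul_le _ _ _).trans (hp l),
      fun x => by simp [hq]⟩

variable {el k}

theorem isPoly_of_mem {q : E d → E d} (hq : q ∈ el.polySubmodule k) (i : Fin d) :
    IsPoly (d * (k + 1)) fun x => q x i := by
  obtain ⟨p, hp, hpq⟩ := hq i
  simp only [hpq]
  exact IsPoly.of_degreeOf fun l => (hp l).trans (el.deg_le k i l)

theorem contDiff_of_mem {q : E d → E d} (hq : q ∈ el.polySubmodule k) {n : WithTop ℕ∞} :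
    ContDiff ℝ n q :=
  contDiff_euclidean.2 fun i => (isPoly_of_mem hq i).contDiff

theorem const_mem (a : E d) : (fun _ => a) ∈ el.polySubmodule k :=
  fun i => ⟨MvPolynomial.C (a i), by simp, by simp⟩

instance finiteDimensional_polySubmodule :
    FiniteDimensional ℝ (el.polySubmodule k : Submodule ℝ (E d → E d)) := by
  let Λ : (Fin d → MvPolynomial.restrictTotalDegree (Fin d) ℝ (d * (k + 1))) →ₗ[ℝ] (E d → E d) :=
    { toFun := fun p x => WithLp.toLp 2 fun i => MvPolynomial.eval x (p i).1
      map_add' := fun p q => by ext x i; simp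
      map_smul' := fun a p => by ext x i; simp }
  refine Submodule.finiteDimensional_of_le (S₂ := LinearMap.range Λ) fun q hq => ?_
  choose p hp hpq using fun i => isPoly_of_mem hq i
  refine ⟨fun i => ⟨p i, (MvPolynomial.mem_restrictTotalDegree _ _ _).2 (hp i)⟩, ?_⟩
  ext x i
  exact (hpq i x).symm

theorem integrableOn_inner {q : E d → E d} (hq : q ∈ el.polySubmodule k) {K : Set (E d)}
    (hK : Bornology.IsBounded K) {v : E d → E d} (hv : ContinuousOn v (closure K)) :
    IntegrableOn (fun x => inner ℝ (v x) (q x)) K :=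
  ((hv.inner (𝕜 := ℝ) (contDiff_of_mem hq (n := 0)).continuous.continuousOn).integrableOn_compact
    hK.isCompact_closure).mono_set subset_closure

theorem eq_zero_of_integral_eq_zero {q : E d → E d} (hq : q ∈ el.polySubmodule k) {K : Set (E d)}
    (hK : Bornology.IsBounded K) (hKo : IsOpen K) (hKn : K.Nonempty)
    (h : ∫ x in K, inner ℝ (q x) (q x) = 0) : q = 0 := by
  have hcont := (contDiff_of_mem hq (n := 0)).continuous
  rw [integral_eq_zero_iff_of_nonneg (fun x => real_inner_self_nonneg)
    (integrableOn_inner hq hK hcont.continuousOn)] at h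
  ext x i
  by_contra hne
  have hz := (isPoly_of_mem hq i).volume_zeros hne
  have h1 : ∀ᵐ y ∂volume.restrict K, q y i = 0 := by
    filter_upwards [h] with y hy
    have : q y = 0 := inner_self_eq_zero.1 hy
    simp [this]
  rw [ae_restrict_iff' hKo.measurableSet] at h1
  refine (hKo.measure_pos volume hKn).ne' (measure_mono_null_ae ?_ hz)
  filter_upwards [h1] with y hy hyK using hy hyK

/-- The L² pairing on K is nondegenerate on the finite-dimensional polynomial space, so the induced
map to the dual is injective, hence surjective, and represents pairing with u. Without existence the
choice operator in `l2Projection` would carry no information. -/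
theorem exists_l2Projection {K : Set (E d)} (hK : Bornology.IsBounded K) (hKo : IsOpen K)
    (hKn : K.Nonempty) {v u : E d → E d} (hu : ContinuousOn u (closure K)) (hvu : Set.EqOn v u K) :
    ∃ q, q ∈ el.polyField k ∧ ∀ w ∈ el.polyField k, ∫ x in K, inner ℝ (v x - q x) (w x) = 0 := by
  let W : Submodule ℝ (E d → E d) := el.polySubmodule k
  have hint : ∀ w ∈ W, IntegrableOn (fun x => inner ℝ (u x) (w x)) K := fun w hw =>
    integrableOn_inner hw hK hu
  have hint2 : ∀ q ∈ W, ∀ w ∈ W, IntegrableOn (fun x => inner ℝ (q x) (w x)) K := fun q hq w hw =>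
    integrableOn_inner hw hK (contDiff_of_mem hq (n := 0)).continuous.continuousOn
  let B : W →ₗ[ℝ] W →ₗ[ℝ] ℝ := LinearMap.mk₂ ℝ (fun q w => ∫ x in K, inner ℝ (q.1 x) (w.1 x))
    (fun q₁ q₂ w => by
      rw [← integral_add (hint2 _ q₁.2 _ w.2) (hint2 _ q₂.2 _ w.2)]
      simp [inner_add_left])
    (fun a q w => by
      rw [smul_eq_mul, ← integral_const_mul]
      simp [real_inner_smul_left])
    (fun q w₁ w₂ => by
      rw [← integral_add (hint2 _ q.2 _ w₁.2) (hint2 _ q.2 _ w₂.2)]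
      simp [inner_add_right])
    (fun a q w => by
      rw [smul_eq_mul, ← integral_const_mul]
      simp [real_inner_smul_right])
  let ℓ : W →ₗ[ℝ] ℝ :=
    { toFun := fun w => ∫ x in K, inner ℝ (u x) (w.1 x)
      map_add' := fun w₁ w₂ => by
        rw [← integral_add (hint _ w₁.2) (hint _ w₂.2)]
        simp [inner_add_right]
      map_smul' := fun a w => by
        rw [smul_eq_mul, ← integral_const_mul]
        simp [real_inner_smul_right] }
  have hinj : Function.Injective B := by
    rw [← LinearMap.ker_eq_bot, LinearMap.ker_eq_bot']
    intro q hq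
    exact Subtype.ext (eq_zero_of_integral_eq_zero q.2 hK hKo hKn (DFunLike.congr_fun hq q))
  have hsurj : Function.Surjective B :=
    (LinearMap.injective_iff_surjective_of_finrank_eq_finrank
      (Subspace.dual_finrank_eq (K := ℝ) (V := W)).symm).1 hinj
  obtain ⟨q, hq⟩ := hsurj ℓ
  refine ⟨q.1, q.2, fun w hw => ?_⟩
  have h1 := DFunLike.congr_fun hq ⟨w, hw⟩
  have h2 : ∫ x in K, inner ℝ (q.1 x) (w x) = ∫ x in K, inner ℝ (u x) (w x) := h1
  rw [setIntegral_congr_fun (g := fun x => inner ℝ (u x) (w x) - inner ℝ (q.1 x) (w x))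
    hKo.measurableSet fun x hx => by rw [hvu hx, inner_sub_left]]
  rw [integral_sub (hint w hw) (hint2 _ q.2 w hw), h2, sub_self]

theorem l2Projection_spec {K : Set (E d)} (hK : Bornology.IsBounded K) (hKo : IsOpen K)
    (hKn : K.Nonempty) {v u : E d → E d} (hu : ContinuousOn u (closure K)) (hvu : Set.EqOn v u K) :
    l2Projection (el.polyField k) K v ∈ el.polyField k ∧ ∀ w ∈ el.polyField k,
      ∫ x in K, inner ℝ (v x - l2Projection (el.polyField k) K v x) (w x) = 0 :=
  Classical.epsilon_spec (p := fun q => q ∈ el.polyField k ∧ ∀ w ∈ el.polyField k,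
    ∫ x in K, inner ℝ (v x - q x) (w x) = 0) (exists_l2Projection hK hKo hKn hu hvu)

/-- The projection is closest to `v`, hence it is as close to a constant as `v` is. -/
theorem integral_l2Projection_sub_le {K : Set (E d)} (hK : Bornology.IsBounded K) (hKo : IsOpen K)
    (hKn : K.Nonempty) {v u : E d → E d} (hu : ContinuousOn u (closure K)) (hvu : Set.EqOn v u K)
    (a : E d) {Λ : ℝ} (hΛ : ∀ x ∈ K, ‖u x - a‖ ≤ Λ) :
    ∫ x in K, ‖l2Projection (el.polyField k) K v x - a‖ ^ 2 ≤ Λ ^ 2 * volume.real K := by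
  obtain ⟨hq, horth⟩ := l2Projection_spec (el := el) (k := k) hK hKo hKn hu hvu
  set q := l2Projection (el.polyField k) K v
  have hqa : (fun x => q x - a) ∈ el.polySubmodule k :=
    Submodule.sub_mem (el.polySubmodule k) hq (const_mem a)
  have h0 := horth _ hqa
  have hua : ContinuousOn (fun x => u x - a) (closure K) := hu.sub continuousOn_const
  have hqc := (contDiff_of_mem hqa (n := 0)).continuous
  have hi1 := integrableOn_inner hqa hK hua
  have hi2 := integrableOn_inner hqa hK hqc.continuousOn
  -- Constants belong to the polynomial space, so q - a is an admissible test field. Orthogonality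
  -- then turns the pairing of u - a with q - a into the square norm of q - a, and Young's
  -- inequality absorbs half of it.
  have h1 : ∫ x in K, inner ℝ (u x - a) (q x - a) = ∫ x in K, ‖q x - a‖ ^ 2 := by
    simp only [← real_inner_self_eq_norm_sq]
    rw [← sub_eq_zero, ← integral_sub hi1 hi2, ← h0]
    refine setIntegral_congr_fun hKo.measurableSet fun x hx => ?_
    rw [← inner_sub_left, hvu hx]
    congr 1
    abel
  have hfin : volume K ≠ ∞ := hK.measure_lt_top.ne
  have hi3 : IntegrableOn (fun x => ‖q x - a‖ ^ 2) K := by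
    simpa only [← real_inner_self_eq_norm_sq] using hi2
  have hi4 : Integrable (fun _ : E d => Λ ^ 2 / 2) (volume.restrict K) :=
    integrableOn_const hfin
  have h2 : ∫ x in K, inner ℝ (u x - a) (q x - a) ≤
      ∫ x in K, (Λ ^ 2 / 2 + ‖q x - a‖ ^ 2 / 2) := by
    refine setIntegral_mono_on hi1 (hi4.add (hi3.div_const 2))
      hKo.measurableSet fun x hx => ?_
    have h3 := real_inner_le_norm (u x - a) (q x - a)
    have h4 := hΛ x hx
    nlinarith [norm_nonneg (u x - a), norm_nonneg (q x - a), sq_nonneg (‖u x - a‖ - ‖q x - a‖)]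
  rw [h1, integral_add hi4 (hi3.div_const 2), integral_div 2 fun x => ‖q x - a‖ ^ 2,
    setIntegral_const, smul_eq_mul] at h2
  linarith

end StokesElement

variable {d : ℕ}

/-- The given σ is an arbitrary real number; this allows it to be replaced by a positive one. -/
theorem Trimmed.Admissible.mono {P : Patch d} {D : Trimmed P} {σ σ' θ C : ℝ} {N : ℕ} {L : ℝ≥0}
    (h : D.Admissible σ θ C N L) (hσ : σ ≤ σ') : D.Admissible σ' θ C N L where
  lipschitz := h.lipschitz
  dirichlet := h.dirichlet
  refines := h.refines
  shapeRegular j i := (h.shapeRegular j i).trans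
    (mul_le_mul_of_nonneg_right hσ (CartesianMesh.edge_pos j i).le)
  goodNeighbor := h.goodNeighbor

/-! ### The stabilized gradient -/

namespace Trimmed

open Classical in
/-- The element whose values determine the stabilized velocity on the element `j`. -/
noncomputable def source {P : Patch d} (D : Trimmed P) (θ : ℝ) (j : D.mesh.Cell) : D.mesh.Cell :=
  if D.Bad θ j then D.neighbor j else j

/-- The Dirichlet energy of `v` on the active part of the element `j`. -/
noncomputable def energy {P : Patch d} (D : Trimmed P) (v : E d → E d) (j : D.mesh.Cell) : ℝ :=
  ∫ y in D.K j ∩ D.Ω, ‖fderiv ℝ v y‖ ^ 2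

variable {P : Patch d} {D : Trimmed P} {c C : ℝ}

theorem volume_K_pos (hP : P.BiLipWith c C) (hT : D.mesh.Refines P.mesh) (j : D.mesh.Cell) :
    0 < volume.real (D.K j) :=
  ENNReal.toReal_pos ((isOpen_K hP hT j).measure_pos volume (nonempty_K j)).ne'
    (volume_K_lt_top hP j).ne

theorem dist_le_of_isNeighbor (hP : P.BiLipWith c C) (hd : 0 < d) {C' : ℝ} {j j' : D.mesh.Cell}
    (h : D.IsNeighbor C' j j') {y y' : E d} (hy : y ∈ D.K j) (hy' : y' ∈ D.K j') :
    dist y y' ≤ (|C'| + 2) * D.h j + D.h j' := by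
  have hh := h_pos hP hd j
  -- The distance need not be attained, so the factor is enlarged by 1 to make the inequality
  -- strict. The absolute value is there because C' may be negative.
  have h1 : sInf (Set.image2 dist (D.K j) (D.K j')) < (|C'| + 1) * D.h j := by
    refine h.2.2.trans_lt ?_
    have := le_abs_self C'
    nlinarith
  obtain ⟨_, ⟨a, ha, b, hb, rfl⟩, hab⟩ := exists_lt_of_csInf_lt
    (Set.Nonempty.image2 (nonempty_K j) (nonempty_K j')) h1
  have h2 : dist y a ≤ D.h j := Metric.dist_le_diam_of_mem (isBounded_K hP j) hy ha
  have h3 : dist b y' ≤ D.h j' := Metric.dist_le_diam_of_mem (isBounded_K hP j') hb hy'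
  have h4 := dist_triangle4 y a b y'
  linarith

theorem energy_eq {C₀ θ : ℝ} (hP : P.BiLipWith c C) (hT : D.mesh.Refines P.mesh) {v : E d → E d}
    {j : D.mesh.Cell} {u H} (hf : IsCellField D C₀ θ v j u H) :
    D.energy v j = ∫ y in D.K j ∩ D.Ω, ‖H y‖ ^ 2 :=
  setIntegral_congr_fun (isOpen_K_inter_Ω hP hT j).measurableSet fun y hy => by
    simp only [(hf.hasFDerivAt y hy).fderiv]

end Trimmed

variable {P : Patch d} {c C : ℝ}

/-- On a bad element, the gradient of the projected velocity is controlled by the energy on the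
neighbor. -/
theorem exists_projection_bound (hd : 2 ≤ d) (hP : P.BiLipWith c C) (el : StokesElement) (k : ℕ)
    {σ θ : ℝ} (hσ0 : 0 < σ) (hθ : θ ≤ 1) (C' : ℝ) {C₀ : ℝ} (hC₀ : 0 < C₀) :
    ∃ C₁ > 0, ∀ D : Trimmed P, D.mesh.Refines P.mesh → D.mesh.ShapeRegular σ →
      ∀ j j', D.IsNeighbor C' j j' → D.K j' ⊆ D.Ω → ∀ v u H, IsCellField D C₀ θ v j' u H →
      ∀ y ∈ D.K j, ‖fderiv ℝ (l2Projection (el.polyField k) (D.K j') v) y‖ ^ 2 *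
        volume.real (D.K j') ≤ C₁ * D.energy v j' := by
  have hc := hP.c_pos
  have hC := hP.C_pos
  have hd0 : 0 < d := by omega
  have hd' : (0 : ℝ) < d := by exact_mod_cast hd0
  set τ := C * σ ^ 2 / c with hτ
  -- A ball of radius R h_{K'} centered in K' contains both K' and the bad element K; τ bounds the
  -- ratio of two element sizes.
  set R := (|C'| + 2) * τ + 1 with hR
  have hR1 : 1 ≤ R := by
    have : 0 ≤ (|C'| + 2) * τ := by positivity
    linarith
  have hR0 : 0 < R := by linarith
  set κ := (c / (σ * C)) ^ d with hκ
  have hκ0 : 0 < κ := by positivity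
  -- With this ε the exceptional set in that ball has volume at most κ h_{K'}^d / 2, hence at most
  -- half of the volume of K'.
  have hε : 0 < κ / (2 * R ^ d) := by positivity
  set m := d * (k + 1) with hm
  obtain ⟨δ, hδ, hlev⟩ := exists_sublevel d m hε
  obtain ⟨B, hB, hmarkov⟩ := exists_norm_fderiv_le d m
  set Z := (d : ℝ) ^ 2 * (B * (2 / δ * C₀) / R) with hZ
  have hZ0 : 0 < Z := by positivity
  refine ⟨Z ^ 2 * C₀, by positivity, fun D hT hσ j j' hn hΩ v u H hf y hy => ?_⟩
  have hh := Trimmed.h_pos hP hd0 j'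
  have hV := Trimmed.volume_K_pos hP hT j'
  have hKb := Trimmed.isBounded_K hP j'
  have hKo := Trimmed.isOpen_K hP hT j'
  have hKn := Trimmed.nonempty_K j'
  have hKΩ : D.K j' ∩ D.Ω = D.K j' := Set.inter_eq_left.2 hΩ
  have hfin : volume (D.K j') ≠ ∞ := hKb.measure_lt_top.ne
  set V := volume.real (D.K j') with hVdef
  have henergy : D.energy v j' = ∫ y in D.K j', ‖H y‖ ^ 2 := by
    rw [Trimmed.energy_eq hP hT hf, hKΩ]
  have hen0 : 0 ≤ D.energy v j' := by
    rw [henergy]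
    exact integral_nonneg fun y => by positivity
  -- the oscillation of `v` on the neighbor
  set M := √(C₀ * D.energy v j' / V) with hM
  have hM0 : 0 ≤ M := Real.sqrt_nonneg _
  have hM2 : M ^ 2 * V = C₀ * D.energy v j' := by
    rw [hM, Real.sq_sqrt (by positivity), div_mul_cancel₀ _ hV.ne']
  have hHM : ∀ z ∈ D.K j', ‖H z‖ ≤ M := by
    intro z hz
    refine Real.le_sqrt_of_sq_le ?_
    rw [le_div_iff₀ hV, henergy]
    -- Since θ ≤ 1 the whole element K' is admissible as the subset, and it carries the full energy
    -- because it lies in Ω.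
    refine hf.level _ subset_rfl hKo.measurableSet ?_ z hz
    nlinarith
  obtain ⟨y₀, hy₀⟩ := hKn
  set Λ := C₀ * M * D.h j' with hΛ
  have hΛ0 : 0 ≤ Λ := by positivity
  have hosc : ∀ x ∈ D.K j', ‖u x - u y₀‖ ≤ Λ := fun x hx => hf.osc M hHM x hx y₀ hy₀
  have hvu : Set.EqOn v u (D.K j') := by
    have := hf.eqOn
    rwa [hKΩ] at this
  have hqmem := (StokesElement.l2Projection_spec (el := el) (k := k) hKb hKo ⟨y₀, hy₀⟩
    hf.continuousOn_u hvu).1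
  have hqint := StokesElement.integral_l2Projection_sub_le (el := el) (k := k) hKb hKo ⟨y₀, hy₀⟩
    hf.continuousOn_u hvu (u y₀) hosc
  set q := l2Projection (el.polyField k) (D.K j') v with hq
  have hqa : (fun x => q x - u y₀) ∈ el.polySubmodule k :=
    Submodule.sub_mem (el.polySubmodule k) hqmem (StokesElement.const_mem _)
  have hqac := (StokesElement.contDiff_of_mem hqa (n := 0)).continuous
  set ρ := R * D.h j' with hρ
  have hρ0 : 0 < ρ := by positivity
  have hKball : D.K j' ⊆ Metric.closedBall y₀ ρ := fun z hz => by
    rw [Metric.mem_closedBall]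
    refine (Metric.dist_le_diam_of_mem hKb hz hy₀).trans ?_
    change D.h j' ≤ ρ
    nlinarith
  have hyball : y ∈ Metric.closedBall y₀ ρ := by
    rw [Metric.mem_closedBall]
    refine (Trimmed.dist_le_of_isNeighbor hP hd0 hn hy hy₀).trans ?_
    have h1 := Trimmed.h_le_h hP hd hσ j j'
    have h2 : 0 ≤ |C'| + 2 := by positivity
    calc (|C'| + 2) * D.h j + D.h j' ≤ (|C'| + 2) * (τ * D.h j') + D.h j' := by gcongr
      _ = ρ := by
        rw [hρ, hR]
        ring
  have hVh : κ * D.h j' ^ d ≤ V := Trimmed.le_volume_K' hP hT hd0 hσ j'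
  -- bounds for the components of `q - u y₀` on the large ball
  have hcomp : ∀ i, ∀ z ∈ Metric.closedBall y₀ ρ, |q z i - u y₀ i| ≤ 2 / δ * Λ := by
    intro i z hz
    have hpi : IsPoly m fun x => q x i - u y₀ i := StokesElement.isPoly_of_mem hqa i
    set S := {x ∈ Metric.closedBall y₀ ρ | |q x i - u y₀ i| < δ * |q z i - u y₀ i|} with hS
    have hSvol : volume.real S ≤ V / 2 := by
      refine (hlev _ hpi y₀ ρ hρ0 z hz).trans ?_
      calc κ / (2 * R ^ d) * ρ ^ d = κ * D.h j' ^ d / 2 := by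
            rw [hρ, mul_pow]
            field_simp
        _ ≤ V / 2 := by gcongr
    have hSfin : volume S ≠ ∞ :=
      (Metric.isBounded_closedBall.subset fun x hx => hx.1).measure_lt_top.ne
    have hint : IntegrableOn (fun x => ‖q x - u y₀‖ ^ 2) (D.K j') :=
      ((hqac.norm.pow 2).continuousOn.integrableOn_compact hKb.isCompact_closure).mono_set
        subset_closure
    have hcheb := mul_meas_ge_le_integral_of_nonneg
      (Eventually.of_forall fun x => by positivity) hint ((δ * |q z i - u y₀ i|) ^ 2)
    have hlow : V / 2 ≤ (volume.restrict (D.K j')).real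
        {x | (δ * |q z i - u y₀ i|) ^ 2 ≤ ‖q x - u y₀‖ ^ 2} := by
      rw [measureReal_def, Measure.restrict_apply' hKo.measurableSet, ← measureReal_def]
      have hsub : D.K j' ⊆ ({x | (δ * |q z i - u y₀ i|) ^ 2 ≤ ‖q x - u y₀‖ ^ 2} ∩ D.K j') ∪ S := by
        intro x hx
        rcases lt_or_ge |q x i - u y₀ i| (δ * |q z i - u y₀ i|) with h | h
        · exact Or.inr ⟨hKball hx, h⟩
        · refine Or.inl ⟨?_, hx⟩
          have : |q x i - u y₀ i| ≤ ‖q x - u y₀‖ := PiLp.norm_apply_le (q x - u y₀) i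
          exact pow_le_pow_left₀ (by positivity) (h.trans this) 2
      have h1 : V ≤ volume.real ({x | (δ * |q z i - u y₀ i|) ^ 2 ≤ ‖q x - u y₀‖ ^ 2} ∩ D.K j') +
          volume.real S :=
        (measureReal_mono hsub (measure_union_ne_top
          (measure_ne_top_of_subset Set.inter_subset_right hfin) hSfin)).trans
          (measureReal_union_le _ _)
      linarith
    have h1 : (δ * |q z i - u y₀ i|) ^ 2 * (V / 2) ≤ Λ ^ 2 * V :=
      le_trans (by gcongr) (hcheb.trans hqint)
    have h2 : (δ * |q z i - u y₀ i|) ^ 2 ≤ (2 * Λ) ^ 2 := by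
      have h3 : (δ * |q z i - u y₀ i|) ^ 2 ≤ 2 * Λ ^ 2 :=
        le_of_mul_le_mul_right (by linarith) hV
      refine h3.trans ?_
      rw [mul_pow 2 Λ]
      exact mul_le_mul_of_nonneg_right (by norm_num) (sq_nonneg Λ)
    have h3 : δ * |q z i - u y₀ i| ≤ 2 * Λ :=
      (pow_le_pow_iff_left₀ (by positivity) (by positivity) two_ne_zero).1 h2
    rw [div_mul_eq_mul_div, le_div_iff₀ hδ]
    linarith
  have hder : ‖fderiv ℝ q y‖ ≤ Z * M := by
    have hqd : ∀ i, Differentiable ℝ fun x => q x i := fun i =>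
      (StokesElement.isPoly_of_mem hqmem i).differentiable
    have hqof : q = ofComponents fun i x => q x i := rfl
    have hent : ∀ i, ‖fderiv ℝ (fun x => q x i) y‖ ≤ B * (2 / δ * Λ) / ρ := by
      intro i
      have h1 := hmarkov _ (StokesElement.isPoly_of_mem hqa i) y₀ ρ _ hρ0 (hcomp i) y hyball
      have h2 : fderiv ℝ (fun x => (q x - u y₀) i) y = fderiv ℝ (fun x => q x i) y :=
        fderiv_sub_const (f := fun x => q x i) (u y₀ i)
      rwa [h2] at h1
    have h1 : ‖fderiv ℝ q y‖ ≤ d ^ 2 * (B * (2 / δ * Λ) / ρ) := by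
      refine norm_le_of_entries (fun i l => ?_) (by positivity)
      rw [hqof, fderiv_ofComponents_apply fun i => hqd i y]
      have := (fderiv ℝ (fun x => q x i) y).le_opNorm (EuclideanSpace.single l (1 : ℝ))
      simp only [PiLp.norm_single, norm_one, mul_one] at this
      exact this.trans (hent i)
    -- Λ is proportional to h_{K'} M and ρ to h_{K'}, so the mesh size cancels.
    refine h1.trans (le_of_eq ?_)
    rw [hZ, hΛ, hρ]
    field_simp
  calc ‖fderiv ℝ q y‖ ^ 2 * V ≤ (Z * M) ^ 2 * V := by gcongr
    _ = Z ^ 2 * C₀ * D.energy v j' := by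
      rw [mul_pow, mul_assoc, hM2]
      ring

/-- The stabilized gradient on each element extends continuously to the closure, and is controlled
by the energy on the source element. -/
theorem exists_stab_bound (hd : 2 ≤ d) (hP : P.BiLipWith c C) (el : StokesElement) (k r : ℕ)
    {σ θ : ℝ} (hσ0 : 0 < σ) (hθ : θ ∈ Set.Ioc (0 : ℝ) 1) (C' : ℝ) :
    ∃ C₁ > 0, ∀ (D : Trimmed P) (N : ℕ) (L : ℝ≥0), D.Admissible σ θ C' N L →
      ∀ v ∈ D.velocity el k r, ∀ j,
      (∃ u, ContinuousOn u (closure (D.K j)) ∧ Set.EqOn v u (D.K j ∩ D.Ω)) ∧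
      (∃ H, ContinuousOn H (closure (D.K j)) ∧ Set.EqOn (fderiv ℝ v) H (D.K j ∩ D.Ω)) ∧
      ∃ G, ContinuousOn G (closure (D.K j)) ∧
        Set.EqOn (fderiv ℝ (D.stab el k θ j v)) G (D.K j ∩ D.Ω) ∧
        ∀ y ∈ D.K j ∩ D.Ω, ‖G y‖ ^ 2 * volume.real (D.K (D.source θ j)) ≤
          C₁ * D.energy v (D.source θ j) := by
  have hd0 : 0 < d := by omega
  obtain ⟨C₀, hC₀, hfield⟩ := exists_cellField hd0 hP el k r hθ.1 hσ0
  obtain ⟨C₁, hC₁, hproj⟩ := exists_projection_bound hd hP el k hσ0 hθ.2 C' hC₀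
  refine ⟨max C₀ C₁, by positivity, fun D N L hD v hv j => ?_⟩
  have hT := hD.refines
  obtain ⟨u, H, hf⟩ := hfield D hT hD.shapeRegular v hv j
  have hHeq : Set.EqOn (fderiv ℝ v) H (D.K j ∩ D.Ω) := fun y hy => (hf.hasFDerivAt y hy).fderiv
  have henergy0 : ∀ i, 0 ≤ D.energy v i := fun i => integral_nonneg fun y => by positivity
  refine ⟨⟨u, hf.continuousOn_u, hf.eqOn⟩, ⟨H, hf.continuousOn_H, hHeq⟩, ?_⟩
  by_cases hbad : D.Bad θ j
  · have hstab : D.stab el k θ j v = l2Projection (el.polyField k) (D.K (D.neighbor j)) v := by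
      rw [Trimmed.stab, if_pos hbad]
    have hsource : D.source θ j = D.neighbor j := by rw [Trimmed.source, if_pos hbad]
    obtain ⟨hn, -, hsub⟩ := hD.goodNeighbor j hbad
    have hΩ := Trimmed.neighbor_subset_Ω hP hT hsub
    obtain ⟨u', H', hf'⟩ := hfield D hT hD.shapeRegular v hv (D.neighbor j)
    have hvu' : Set.EqOn v u' (D.K (D.neighbor j)) := fun y hy => hf'.eqOn ⟨hy, hΩ hy⟩
    have hqmem := (StokesElement.l2Projection_spec (el := el) (k := k)
      (Trimmed.isBounded_K hP (D.neighbor j)) (Trimmed.isOpen_K hP hT _) (Trimmed.nonempty_K _)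
      hf'.continuousOn_u hvu').1
    rw [hstab, hsource]
    refine ⟨_, ((StokesElement.contDiff_of_mem hqmem (n := 1)).continuous_fderiv
      (by simp)).continuousOn, fun y _ => rfl, fun y hy => ?_⟩
    refine (hproj D hT hD.shapeRegular j _ hn hΩ v u' H' hf' y hy.1).trans ?_
    exact mul_le_mul_of_nonneg_right (le_max_right _ _) (henergy0 _)
  · have hstab : D.stab el k θ j v = v := by rw [Trimmed.stab, if_neg hbad]
    have hsource : D.source θ j = j := by rw [Trimmed.source, if_neg hbad]
    rw [hstab, hsource]
    refine ⟨H, hf.continuousOn_H, hHeq, fun y hy => ?_⟩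
    -- An element that is not bad may be inactive; the point y of K ∩ Ω excludes this, so the
    -- element is good.
    have hact : D.Active j := ⟨y, hy⟩
    have hgood : D.Good θ j := by
      by_contra h
      exact hbad ⟨hact, h⟩
    have hle := hgood.2
    rw [le_div_iff₀ (Trimmed.volume_K_pos hP hT j)] at hle
    refine (hf.level _ Set.inter_subset_left (Trimmed.isOpen_K_inter_Ω hP hT j).measurableSet hle y
      hy.1).trans ?_
    rw [← Trimmed.energy_eq hP hT hf]
    exact mul_le_mul_of_nonneg_right (le_max_left _ _) (henergy0 _)

variable {d : ℕ}

/-! ### The surface measure of a Lipschitz boundary -/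

/-- A strict inequality in either direction persists near y by continuity, so y would be interior to
Ω or to its complement. -/
theorem frontier_inter_subset_graph {Ω U : Set (E d)} (hU : IsOpen U) {e : E d} {g : E d → ℝ}
    {L : ℝ≥0} (hg : LipschitzWith L g)
    (h : ∀ x ∈ U, (x ∈ Ω ↔ g (x - inner ℝ e x • e) < inner ℝ e x)) {y : E d}
    (hy : y ∈ frontier Ω) (hyU : y ∈ U) : g (y - inner ℝ e y • e) = inner ℝ e y := by
  have hc1 : Continuous fun x : E d => g (x - inner ℝ e x • e) :=
    hg.continuous.comp (by fun_prop)
  have hc2 : Continuous fun x : E d => (inner ℝ e x : ℝ) := by fun_prop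
  rcases lt_trichotomy (g (y - inner ℝ e y • e)) (inner ℝ e y) with hlt | heq | hgt
  · exfalso
    refine hy.2 (mem_interior_iff_mem_nhds.2 ?_)
    filter_upwards [hU.mem_nhds hyU, (isOpen_lt hc1 hc2).mem_nhds hlt] with x hx hx'
    exact (h x hx).2 hx'
  · exact heq
  · exfalso
    have : Ωᶜ ∈ 𝓝 y := by
      filter_upwards [hU.mem_nhds hyU, (isOpen_lt hc2 hc1).mem_nhds hgt] with x hx hx' hxΩ
      exact lt_asymm hx' ((h x hx).1 hxΩ)
    obtain ⟨x, hx, hx'⟩ := mem_closure_iff_nhds.1 hy.1 _ this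
    exact hx hx'

/-- The graph is the image of the hyperplane orthogonal to e under z ↦ z + g(z) e, which is (1 +
L)-Lipschitz. Orthogonal projection does not increase distances, so the part in a ball of radius ρ
comes from a ball of the same radius in the hyperplane. -/
theorem measure_graph_le {n : ℕ} {e : E (n + 1)} (he : ‖e‖ = 1) {g : E (n + 1) → ℝ} {L : ℝ≥0}
    (hg : LipschitzWith L g) (x : E (n + 1)) {ρ : ℝ} (hρ : 0 ≤ ρ) :
    μHE[n] ({y | g (y - inner ℝ e y • e) = inner ℝ e y} ∩ Metric.closedBall x ρ) ≤
      ((1 + L : ℝ≥0) : ℝ≥0∞) ^ n * (ENNReal.ofReal (ρ ^ n) *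
        volume (Metric.ball (0 : EuclideanSpace ℝ (Fin n)) 1)) := by
  have : Fact (Module.finrank ℝ (E (n + 1)) = n + 1) := ⟨by simp⟩
  have he0 : e ≠ 0 := fun h => by simp [h] at he
  let b := OrthonormalBasis.fromOrthogonalSpanSingleton (𝕜 := ℝ) n he0
  let ι : EuclideanSpace ℝ (Fin n) → E (n + 1) := fun z => (b.repr.symm z : E (n + 1))
  let ψ : EuclideanSpace ℝ (Fin n) → E (n + 1) := fun z => ι z + g (ι z) • e
  have hι : ∀ z z', dist (ι z) (ι z') = dist z z' := fun z z' => by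
    rw [← b.repr.symm.dist_map z z']
    rfl
  have hψ : LipschitzWith (1 + L) ψ := by
    refine LipschitzWith.of_dist_le_mul fun z z' => ?_
    calc dist (ψ z) (ψ z') ≤ dist (ι z) (ι z') + dist (g (ι z) • e) (g (ι z') • e) :=
          dist_add_add_le _ _ _ _
      _ ≤ dist z z' + L * dist z z' := by
          refine add_le_add (hι z z').le ?_
          rw [dist_eq_norm, ← sub_smul, norm_smul, he, mul_one, ← dist_eq_norm, ← hι z z']
          exact hg.dist_le_mul _ _
      _ = _ := by
          push_cast
          ring
  have hmem : ∀ y : E (n + 1), y - (inner ℝ e y : ℝ) • e ∈ (Submodule.span ℝ {e})ᗮ := by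
    intro y
    rw [Submodule.mem_orthogonal_singleton_iff_inner_right]
    simp [inner_sub_right, real_inner_smul_right, he]
  let π : E (n + 1) → EuclideanSpace ℝ (Fin n) := fun y => b.repr ⟨_, hmem y⟩
  have hιπ : ∀ y, ι (π y) = y - (inner ℝ e y : ℝ) • e := fun y => by simp [ι, π]
  have hπ : ∀ y y', dist (π y) (π y') ≤ dist y y' := by
    intro y y'
    rw [← hι, hιπ, hιπ, dist_eq_norm, dist_eq_norm]
    have h1 : y - (inner ℝ e y : ℝ) • e - (y' - (inner ℝ e y' : ℝ) • e) =
        (y - y') - (inner ℝ e (y - y') : ℝ) • e := by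
      rw [inner_sub_right, sub_smul]
      abel
    rw [h1]
    refine (pow_le_pow_iff_left₀ (norm_nonneg _) (norm_nonneg _) two_ne_zero).1 ?_
    rw [norm_sub_sq_real, real_inner_smul_right, norm_smul, he, mul_one, real_inner_comm,
      Real.norm_eq_abs, sq_abs]
    nlinarith [sq_nonneg (inner ℝ e (y - y') : ℝ)]
  have hsub : {y | g (y - inner ℝ e y • e) = inner ℝ e y} ∩ Metric.closedBall x ρ ⊆
      ψ '' Metric.closedBall (π x) ρ := by
    rintro y ⟨hy, hyx⟩
    refine ⟨π y, ?_, ?_⟩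
    · rw [Metric.mem_closedBall] at hyx ⊢
      exact (hπ y x).trans hyx
    · change ι (π y) + g (ι (π y)) • e = y
      have hy' : g (y - inner ℝ e y • e) = inner ℝ e y := hy
      rw [hιπ, hy']
      abel
  refine (measure_mono hsub).trans ?_
  refine (euclideanHausdorffMeasure_image_le (hψ.lipschitzOnWith) n).trans ?_
  rw [EuclideanSpace.euclideanHausdorffMeasure_eq_volume, Measure.addHaar_closedBall _ _ hρ]
  simp

theorem exists_surface_bound (hd : 0 < d) (N : ℕ) (L : ℝ≥0) :
    ∃ A > 0, ∀ Ω : Set (E d), HasLipschitzBoundary Ω N L → ∀ (x : E d) (ρ : ℝ), 0 ≤ ρ →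
      μHE[d - 1] (frontier Ω ∩ Metric.closedBall x ρ) ≤ ENNReal.ofReal (A * ρ ^ (d - 1)) := by
  obtain ⟨n, rfl⟩ : ∃ n, d = n + 1 := ⟨d - 1, by omega⟩
  set ω := volume.real (Metric.ball (0 : EuclideanSpace ℝ (Fin n)) 1) with hω
  have hω0 : 0 ≤ ω := measureReal_nonneg
  -- The N graphs are summed, whatever the size of the sets U i; the added 1 keeps the constant
  -- positive when N = 0.
  refine ⟨N * ((1 + L) ^ n * ω) + 1, by positivity, fun Ω hΩ x ρ hρ => ?_⟩
  obtain ⟨U, hU, hcov, hgr⟩ := hΩ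
  choose e g he hg h using hgr
  have hsub : frontier Ω ∩ Metric.closedBall x ρ ⊆ ⋃ i ∈ (Finset.univ : Finset (Fin N)),
      ({y | g i (y - inner ℝ (e i) y • e i) = inner ℝ (e i) y} ∩ Metric.closedBall x ρ) := by
    rintro y ⟨hy, hyx⟩
    obtain ⟨i, hi⟩ := Set.mem_iUnion.1 (hcov hy)
    exact Set.mem_biUnion (Finset.mem_coe.2 (Finset.mem_univ i))
      ⟨frontier_inter_subset_graph (hU i) (hg i) (h i) hy hi, hyx⟩
  refine (measure_mono hsub).trans ((measure_biUnion_finset_le _ _).trans ?_)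
  refine (Finset.sum_le_sum fun i _ => measure_graph_le (he i) (hg i) x hρ).trans ?_
  have h1 : ((1 + L : ℝ≥0) : ℝ≥0∞) ^ n * (ENNReal.ofReal (ρ ^ n) *
      volume (Metric.ball (0 : EuclideanSpace ℝ (Fin n)) 1)) =
      ENNReal.ofReal ((1 + L) ^ n * (ρ ^ n * ω)) := by
    rw [ENNReal.ofReal_mul (by positivity), ENNReal.ofReal_mul (by positivity), hω,
      ofReal_measureReal measure_ball_lt_top.ne, ENNReal.ofReal_pow (by positivity)]
    congr 2
    rw [← NNReal.coe_one, ← NNReal.coe_add, ← NNReal.coe_pow,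
      ENNReal.ofReal_coe_nnreal, ENNReal.coe_pow]
  rw [Finset.sum_const, h1, Finset.card_univ, Fintype.card_fin, nsmul_eq_mul,
    ← ENNReal.ofReal_natCast, ← ENNReal.ofReal_mul (by positivity)]
  refine ENNReal.ofReal_le_ofReal ?_
  have : 0 ≤ ρ ^ n := by positivity
  simp only [Nat.add_sub_cancel]
  nlinarith

/-! ### Boundary values -/

theorem trace_eq {V : Type*} [TopologicalSpace V] [T2Space V] [Nonempty V] {S : Set (E d)}
    {f H : E d → V} (hH : ContinuousOn H (closure S)) (heq : Set.EqOn f H S) {x : E d}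
    (hx : x ∈ closure S) : trace S f x = H x := by
  have : (𝓝[S] x).NeBot := mem_closure_iff_nhdsWithin_neBot.1 hx
  refine Tendsto.limUnder_eq ?_
  have h1 : Tendsto H (𝓝[S] x) (𝓝 (H x)) := ((hH x hx).mono subset_closure).tendsto
  exact h1.congr' (eventually_nhdsWithin_of_forall fun y hy => (heq hy).symm)

theorem norm_outerNormal_le (Ω : Set (E d)) (x : E d) : ‖outerNormal Ω x‖ ≤ 1 := by
  rw [outerNormal]
  split_ifs with h
  · exact h.choose_spec.1.le
  · simp

namespace Trimmed

variable {P : Patch d} {D : Trimmed P} {c C : ℝ}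

/-- Where a normal exists, the points x - t n are in K by definition of `Γ` and in Ω by the cone
condition with ε = 1/2. Where none exists, the default value 0 of `outerNormal` turns the condition
into x ∈ K, and K is open. -/
theorem Γ_subset (hP : P.BiLipWith c C) {σ θ C' : ℝ} {N : ℕ} {L : ℝ≥0}
    (hD : D.Admissible σ θ C' N L) (j : D.mesh.Cell) :
    D.Γ j ⊆ closure (D.K j ∩ D.Ω) ∩ frontier D.Ω := by
  rintro x ⟨hxD, hx⟩
  obtain ⟨U, -, hU⟩ := hD.dirichlet
  have hfr : x ∈ frontier D.Ω := by
    rw [hU] at hxD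
    exact hxD.2
  refine ⟨?_, hfr⟩
  by_cases h : ∃ n, IsOuterNormal D.Ω x n
  · have hn : outerNormal D.Ω x = h.choose := by rw [outerNormal, dif_pos h]
    have hspec := h.choose_spec
    rw [← hn] at hspec
    set n := outerNormal D.Ω x with hndef
    have hlim : Tendsto (fun t : ℝ => x - t • n) (𝓝[>] 0) (𝓝 x) := by
      have hc : Continuous fun t : ℝ => x - t • n := by fun_prop
      have := hc.tendsto 0
      simp only [zero_smul, sub_zero] at this
      exact this.mono_left nhdsWithin_le_nhds
    have h1 := hlim.eventually (hspec.2 (1 / 2) (by norm_num))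
    refine mem_closure_of_tendsto hlim ?_
    filter_upwards [hx, h1, self_mem_nhdsWithin] with t ht ht1 ht0
    have ht0' : (0 : ℝ) < t := ht0
    refine ⟨ht, ht1.1 ?_⟩
    rw [sub_sub_cancel_left, inner_neg_right, real_inner_smul_right, real_inner_self_eq_norm_sq,
      norm_neg, norm_smul, hspec.1, Real.norm_of_nonneg ht0'.le]
    linarith
  · have hn : outerNormal D.Ω x = 0 := by rw [outerNormal, dif_neg h]
    rw [hn] at hx
    simp only [smul_zero, sub_zero, eventually_const] at hx
    exact (isOpen_K hP hD.refines j).inter_closure ⟨hx, hfr.1⟩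

end Trimmed

variable {d : ℕ}

/-! ### The Cauchy-Schwarz inequality -/

theorem frob_self (A : E d →L[ℝ] E d) :
    frob A A = ∑ l, ‖A (EuclideanSpace.single l 1)‖ ^ 2 := by
  simp only [frob, real_inner_self_eq_norm_sq]

theorem frob_self_nonneg (A : E d →L[ℝ] E d) : 0 ≤ frob A A := by
  rw [frob_self]
  positivity

theorem sq_norm_le_frob (A : E d →L[ℝ] E d) : ‖A‖ ^ 2 ≤ frob A A := by
  rw [← Real.le_sqrt (norm_nonneg _) (frob_self_nonneg A)]
  refine A.opNorm_le_bound (Real.sqrt_nonneg _) fun ξ => ?_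
  conv_lhs => rw [← sum_smul_single ξ, map_sum]
  refine (norm_sum_le _ _).trans ?_
  rw [frob_self, mul_comm, EuclideanSpace.norm_eq]
  refine le_trans (Finset.sum_le_sum fun l _ => ?_)
    (Real.sum_mul_le_sqrt_mul_sqrt Finset.univ (fun l => ‖ξ l‖)
      fun l => ‖A (EuclideanSpace.single l 1)‖)
  rw [map_smul, norm_smul]

theorem abs_frob_le (A B : E d →L[ℝ] E d) : |frob A B| ≤ √(frob A A) * √(frob B B) := by
  rw [frob_self, frob_self, frob]
  refine (Finset.abs_sum_le_sum_abs _ _).trans ?_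
  refine le_trans (Finset.sum_le_sum fun l _ => abs_real_inner_le_norm _ _)
    (Real.sum_mul_le_sqrt_mul_sqrt Finset.univ _ _)

/-- Cauchy-Schwarz without measurability of f: if f is not integrable, its integral is 0. This
spares a proof that the outer normal is measurable. -/
theorem abs_integral_le_sqrt_mul_sqrt {α : Type*} [MeasurableSpace α] {ν : Measure α}
    {f a b : α → ℝ} (ha : Integrable a ν) (hb : Integrable b ν) (ha0 : ∀ x, 0 ≤ a x)
    (hb0 : ∀ x, 0 ≤ b x) (h : ∀ᵐ x ∂ν, |f x| ≤ √(a x) * √(b x)) :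
    |∫ x, f x ∂ν| ≤ √(∫ x, a x ∂ν) * √(∫ x, b x ∂ν) := by
  have hmem : ∀ g : α → ℝ, Integrable g ν → (∀ x, 0 ≤ g x) →
      MemLp (fun x => √(g x)) (ENNReal.ofReal 2) ν := by
    intro g hg hg0
    have hm : AEStronglyMeasurable (fun x => √(g x)) ν :=
      Real.continuous_sqrt.comp_aestronglyMeasurable hg.aestronglyMeasurable
    rw [ENNReal.ofReal_ofNat, memLp_two_iff_integrable_sq hm]
    simpa only [Real.sq_sqrt (hg0 _)] using hg
  have hA := hmem a ha ha0
  have hB := hmem b hb hb0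
  have hH := integral_mul_le_Lp_mul_Lq_of_nonneg Real.HolderConjugate.two_two
    (Eventually.of_forall fun x => Real.sqrt_nonneg (a x))
    (Eventually.of_forall fun x => Real.sqrt_nonneg (b x)) hA hB
  simp only [Real.rpow_two, Real.sq_sqrt (ha0 _), Real.sq_sqrt (hb0 _), ← Real.sqrt_eq_rpow] at hH
  rw [ENNReal.ofReal_ofNat] at hA hB
  exact (norm_integral_le_of_norm_le (f := f) (hA.integrable_mul hB) h).trans hH

/-! ### Integrals over the domain and over its boundary -/

namespace Trimmed

variable {P : Patch d} {D : Trimmed P} {c C : ℝ}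

theorem Ω_ae_eq (hP : P.BiLipWith c C) : (⋃ j, D.K j ∩ D.Ω : Set (E d)) =ᵐ[volume] D.Ω := by
  refine Filter.EventuallyLE.antisymm
    (Eventually.of_forall (Set.iUnion_subset fun j => Set.inter_subset_right)) ?_
  rw [ae_le_set, ← Set.iUnion_inter]
  refine measure_mono_null ?_ (volume_Ω_diff (D := D) hP)
  rintro x ⟨hx, hx'⟩
  exact ⟨hx, fun h => hx' ⟨h, hx⟩⟩

theorem integrableOn_Ω (hP : P.BiLipWith c C) (hT : D.mesh.Refines P.mesh) {f : E d → ℝ}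
    (hf : ∀ j, ∃ g, ContinuousOn g (closure (D.K j)) ∧ Set.EqOn f g (D.K j ∩ D.Ω)) :
    IntegrableOn f D.Ω := by
  refine IntegrableOn.congr_set_ae ?_ (Ω_ae_eq hP).symm
  rw [integrableOn_finite_iUnion]
  intro j
  obtain ⟨g, hg, hfg⟩ := hf j
  refine IntegrableOn.congr_fun ?_ hfg.symm (isOpen_K_inter_Ω hP hT j).measurableSet
  exact (hg.integrableOn_compact (isBounded_K hP j).isCompact_closure).mono_set
    (Set.inter_subset_left.trans subset_closure)

theorem sum_setIntegral (hP : P.BiLipWith c C) (hT : D.mesh.Refines P.mesh) {f : E d → ℝ}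
    (hf : IntegrableOn f D.Ω) :
    ∑ j, ∫ y in D.K j ∩ D.Ω, f y = ∫ y in D.Ω, f y := by
  rw [← setIntegral_congr_set (Ω_ae_eq hP), integral_iUnion_fintype]
  · exact fun j => (isOpen_K_inter_Ω hP hT j).measurableSet
  · intro j j' hne
    refine Set.disjoint_left.2 fun x hx hx' => hne (eq_of_mem_K hP hx.1 hx'.1)
  · exact fun j => hf.mono_set Set.inter_subset_right

/-- Boundedly many elements share the same source element. -/
theorem exists_card_source_le (hd : 2 ≤ d) (hP : P.BiLipWith c C) {σ : ℝ} (hσ0 : 0 < σ) (C' : ℝ) :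
    ∃ m : ℝ, 0 < m ∧ ∀ (D : Trimmed P) (θ : ℝ) (N : ℕ) (L : ℝ≥0), D.Admissible σ θ C' N L → ∀ j',
      ((Finset.univ.filter fun j => D.source θ j = j').card : ℝ) ≤ m := by
  have hc := hP.c_pos
  have hC := hP.C_pos
  have hd0 : 0 < d := by omega
  set τ := C * σ ^ 2 / c with hτ
  have hτ0 : 0 < τ := by positivity
  set R := (|C'| + 2) * τ + 1 with hR
  have hR0 : 0 < R := by positivity
  set κ := (c / (σ * C)) ^ d with hκ
  have hκ0 : 0 < κ := by positivity
  set ω := volume.real (Metric.ball (0 : E d) 1) with hω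
  have hω0 : 0 < ω := ENNReal.toReal_pos (Metric.measure_ball_pos volume _ one_pos).ne'
    measure_ball_lt_top.ne
  refine ⟨R ^ d * ω * τ ^ d / κ, by positivity, fun D θ N L hD j' => ?_⟩
  have hT := hD.refines
  have hσ := hD.shapeRegular
  set F := Finset.univ.filter fun j => D.source θ j = j' with hF
  obtain ⟨y₀, hy₀⟩ := nonempty_K (D := D) j'
  have hh := h_pos hP hd0 j'
  -- Volume packing: the elements with source `j'` are disjoint, lie in one ball of radius R h_{j'},
  -- and each has volume at least κ (h_{j'}/τ)^d.
  have hsub : (⋃ j ∈ F, D.K j) ⊆ Metric.closedBall y₀ (R * D.h j') := by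
    refine Set.iUnion₂_subset fun j hj y hy => ?_
    have hsrc : D.source θ j = j' := by simpa [hF] using hj
    rw [Metric.mem_closedBall]
    by_cases hbad : D.Bad θ j
    · rw [source, if_pos hbad] at hsrc
      subst hsrc
      refine (dist_le_of_isNeighbor hP hd0 (hD.goodNeighbor j hbad).1 hy hy₀).trans ?_
      have h1 := h_le_h hP hd hσ j (D.neighbor j)
      calc (|C'| + 2) * D.h j + D.h (D.neighbor j)
          ≤ (|C'| + 2) * (τ * D.h (D.neighbor j)) + D.h (D.neighbor j) := by gcongr
        _ = R * D.h (D.neighbor j) := by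
          rw [hR]
          ring
    · rw [source, if_neg hbad] at hsrc
      subst hsrc
      refine (Metric.dist_le_diam_of_mem (isBounded_K hP j) hy hy₀).trans ?_
      change D.h j ≤ R * D.h j
      have : 0 ≤ (|C'| + 2) * τ := by positivity
      nlinarith
  have h1 : ∑ j ∈ F, volume.real (D.K j) ≤ (R * D.h j') ^ d * ω := by
    rw [← measureReal_biUnion_finset ?_ ?_ fun j _ => (volume_K_lt_top hP j).ne]
    · refine (measureReal_mono hsub measure_closedBall_lt_top.ne).trans (le_of_eq ?_)
      rw [measureReal_def, Measure.addHaar_closedBall _ _ (by positivity), ENNReal.toReal_mul,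
        ENNReal.toReal_ofReal (by positivity), finrank_euclideanSpace, Fintype.card_fin]
      rfl
    · intro j _ i _ hne
      exact Set.disjoint_left.2 fun x hx hx' => hne (eq_of_mem_K hP hx hx')
    · exact fun j _ => (isOpen_K hP hT j).measurableSet
  have h2 : ∀ j ∈ F, κ * (D.h j' / τ) ^ d ≤ volume.real (D.K j) := by
    intro j _
    refine le_trans ?_ (le_volume_K' hP hT hd0 hσ j)
    have : D.h j' / τ ≤ D.h j := by
      rw [div_le_iff₀' hτ0]
      exact h_le_h hP hd hσ j' j
    gcongr
  have h3 := (Finset.sum_le_sum h2).trans h1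
  rw [Finset.sum_const, nsmul_eq_mul] at h3
  have h4 : 0 < κ * (D.h j' / τ) ^ d := by positivity
  rw [← le_div_iff₀ h4] at h3
  refine h3.trans (le_of_eq ?_)
  rw [mul_pow, div_pow]
  field_simp

theorem sum_energy_source_le {θ m : ℝ} (v : E d → E d)
    (hm : ∀ j', ((Finset.univ.filter fun j => D.source θ j = j').card : ℝ) ≤ m) :
    ∑ j, D.energy v (D.source θ j) ≤ m * ∑ j, D.energy v j := by
  rw [← Finset.sum_fiberwise Finset.univ (D.source θ), Finset.mul_sum]
  refine Finset.sum_le_sum fun j' _ => ?_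
  have henergy0 : 0 ≤ D.energy v j' := integral_nonneg fun y => by positivity
  rw [Finset.sum_congr rfl (g := fun _ => D.energy v j')
    fun j hj => by rw [(Finset.mem_filter.1 hj).2], Finset.sum_const, nsmul_eq_mul]
  exact mul_le_mul_of_nonneg_right (hm j') henergy0

/-- The squared Dirichlet seminorm of `v`. -/
noncomputable def dirichlet (D : Trimmed P) (v : E d → E d) : ℝ :=
  ∫ y in D.Ω, frob (fderiv ℝ v y) (fderiv ℝ v y)

/-- The squared weighted boundary norm of `v` on the element `j`. -/
noncomputable def penalty (D : Trimmed P) (v : E d → E d) (j : D.mesh.Cell) : ℝ :=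
  ∫ x in D.Γ j, (D.h j)⁻¹ * ‖D.bval j v x‖ ^ 2 ∂μHE[d - 1]

/-- The squared weighted boundary norm of `v`. -/
noncomputable def totalPenalty (D : Trimmed P) (v : E d → E d) : ℝ := ∑ j, D.penalty v j

end Trimmed

variable {d : ℕ}

/-! ### Boundary integrals and the mesh-dependent norm. -/

namespace Trimmed

variable {P : Patch d} {D : Trimmed P} {c C σ θ C' : ℝ} {N : ℕ} {L : ℝ≥0}

/-- Measurability of the pieces of Γ_D is not needed: the restricted measure is dominated by the one
on the closed set containing the piece. -/
theorem ae_restrict_Γ (hP : P.BiLipWith c C) (hD : D.Admissible σ θ C' N L) (j : D.mesh.Cell)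
    {p : E d → Prop} (h : ∀ x ∈ closure (D.K j ∩ D.Ω), p x) :
    ∀ᵐ x ∂(μHE[d - 1] : Measure (E d)).restrict (D.Γ j), p x :=
  ae_mono (Measure.restrict_mono ((Γ_subset hP hD j).trans Set.inter_subset_left) le_rfl)
    (ae_restrict_of_forall_mem isClosed_closure.measurableSet h)

theorem measure_Γ_le (hP : P.BiLipWith c C) (hD : D.Admissible σ θ C' N L) {A : ℝ}
    (hA : ∀ Ω : Set (E d), HasLipschitzBoundary Ω N L → ∀ (x : E d) (ρ : ℝ), 0 ≤ ρ →
      μHE[d - 1] (frontier Ω ∩ Metric.closedBall x ρ) ≤ ENNReal.ofReal (A * ρ ^ (d - 1)))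
    (j : D.mesh.Cell) :
    (μHE[d - 1] : Measure (E d)) (D.Γ j) ≤ ENNReal.ofReal (A * D.h j ^ (d - 1)) := by
  obtain ⟨x₀, hx₀⟩ := nonempty_K (D := D) j
  refine le_trans (measure_mono fun x hx => ?_) (hA D.Ω hD.lipschitz x₀ (D.h j) Metric.diam_nonneg)
  obtain ⟨h1, h2⟩ := Γ_subset hP hD j hx
  refine ⟨h2, ?_⟩
  refine closure_minimal (fun y hy => ?_) Metric.isClosed_closedBall h1
  exact Metric.dist_le_diam_of_mem (isBounded_K hP j) hy.1 hx₀

theorem integrable_bval (hP : P.BiLipWith c C) (hD : D.Admissible σ θ C' N L) (j : D.mesh.Cell)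
    (hfin : (μHE[d - 1] : Measure (E d)) (D.Γ j) < ∞) {v u : E d → E d}
    (hu : ContinuousOn u (closure (D.K j))) (hvu : Set.EqOn v u (D.K j ∩ D.Ω)) (a : ℝ) :
    Integrable (fun x => a * ‖D.bval j v x‖ ^ 2)
      ((μHE[d - 1] : Measure (E d)).restrict (D.Γ j)) := by
  have hsub : closure (D.K j ∩ D.Ω) ⊆ closure (D.K j) := closure_mono Set.inter_subset_left
  have hb : ∀ x ∈ closure (D.K j ∩ D.Ω), D.bval j v x = u x := fun x hx =>
    trace_eq (hu.mono hsub) hvu hx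
  have hcont : ContinuousOn (fun x => a * ‖D.bval j v x‖ ^ 2) (closure (D.K j ∩ D.Ω)) := by
    have h1 : ContinuousOn (fun x => a * ‖u x‖ ^ 2) (closure (D.K j ∩ D.Ω)) :=
      continuousOn_const.mul ((hu.mono hsub).norm.pow 2)
    refine h1.congr fun x hx => ?_
    simp only [hb x hx]
  have hcpt : IsCompact (closure (D.K j ∩ D.Ω)) :=
    ((isBounded_K hP j).subset Set.inter_subset_left).isCompact_closure
  obtain ⟨B, hB⟩ := hcpt.exists_bound_of_continuousOn hcont
  have : IsFiniteMeasure ((μHE[d - 1] : Measure (E d)).restrict (D.Γ j)) := ⟨by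
    rwa [Measure.restrict_apply_univ]⟩
  refine Integrable.of_bound ?_ B (ae_restrict_Γ hP hD j hB)
  exact (hcont.aestronglyMeasurable isClosed_closure.measurableSet).mono_measure
    (Measure.restrict_mono ((Γ_subset hP hD j).trans Set.inter_subset_left) le_rfl)

theorem dirichlet_nonneg (v : E d → E d) : 0 ≤ D.dirichlet v :=
  integral_nonneg fun _ => frob_self_nonneg _

theorem penalty_nonneg (v : E d → E d) (j : D.mesh.Cell) : 0 ≤ D.penalty v j := by
  have : 0 ≤ D.h j := Metric.diam_nonneg
  exact integral_nonneg fun _ => by positivity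

theorem totalPenalty_nonneg (v : E d → E d) : 0 ≤ D.totalPenalty v :=
  Finset.sum_nonneg fun j _ => penalty_nonneg v j

theorem bdryIntegral_const_mul (a : ℝ) (f : D.mesh.Cell → E d → ℝ) :
    (D.bdryIntegral fun j x => a * f j x) = a * D.bdryIntegral f := by
  simp only [bdryIntegral, integral_const_mul, Finset.mul_sum]

theorem norm1h_sq {μ : ℝ} (hμ : 0 < μ) (v : E d → E d) :
    D.norm1h μ v ^ 2 = μ * (D.dirichlet v + D.totalPenalty v) := by
  have h1 : (∫ x in D.Ω, μ * frob (fderiv ℝ v x) (fderiv ℝ v x)) = μ * D.dirichlet v :=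
    integral_const_mul _ _
  have h2 : (D.bdryIntegral fun j x => (D.h j)⁻¹ * (μ * ‖D.bval j v x‖ ^ 2)) =
      μ * D.totalPenalty v := by
    rw [totalPenalty, ← show D.bdryIntegral (fun j x => (D.h j)⁻¹ * ‖D.bval j v x‖ ^ 2) =
      ∑ j, D.penalty v j from rfl, ← bdryIntegral_const_mul]
    simp only [mul_left_comm]
  have h3 := dirichlet_nonneg (D := D) v
  have h4 := totalPenalty_nonneg (D := D) v
  rw [norm1h, h1, h2, Real.sq_sqrt (by positivity), mul_add]

theorem norm1h_nonneg (μ : ℝ) (v : E d → E d) : 0 ≤ D.norm1h μ v := Real.sqrt_nonneg _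

/-- The Cauchy-Schwarz inequality for sums over the elements of the Dirichlet boundary. -/
theorem abs_bdryIntegral_le {f : D.mesh.Cell → E d → ℝ} {X Y : D.mesh.Cell → ℝ}
    (hX : ∀ j, 0 ≤ X j) (hY : ∀ j, 0 ≤ Y j)
    (h : ∀ j, |∫ x in D.Γ j, f j x ∂μHE[d - 1]| ≤ √(X j) * √(Y j)) :
    |D.bdryIntegral f| ≤ √(∑ j, X j) * √(∑ j, Y j) :=
  (Finset.abs_sum_le_sum_abs _ _).trans ((Finset.sum_le_sum fun j _ => h j).trans
    (Real.sum_sqrt_mul_sqrt_le _ hX hY))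

end Trimmed

/-! ### Uniform bounds for the gradient, consistency and penalty forms. -/

variable {P : Patch d} {c C : ℝ}

/-- The bounds for the three bilinear forms from which `stabForm` is composed. -/
theorem exists_form_bounds (hd : 2 ≤ d) (hP : P.BiLipWith c C) (el : StokesElement) (k r : ℕ)
    {σ θ : ℝ} (hσ0 : 0 < σ) (hθ : θ ∈ Set.Ioc (0 : ℝ) 1) (C' : ℝ) (N : ℕ) (L : ℝ≥0) :
    ∃ B > 0, ∀ D : Trimmed P, D.Admissible σ θ C' N L →
      ∀ w ∈ D.velocity el k r, ∀ v ∈ D.velocity el k r,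
      |∫ x in D.Ω, frob (fderiv ℝ w x) (fderiv ℝ v x)| ≤ √(D.dirichlet w) * √(D.dirichlet v) ∧
      |D.bdryIntegral fun j x => inner ℝ (D.stabNormalDeriv el k θ j w x) (D.bval j v x)| ≤
        B * √(D.dirichlet w) * √(D.totalPenalty v) ∧
      |D.bdryIntegral fun j x => (D.h j)⁻¹ * inner ℝ (D.bval j w x) (D.bval j v x)| ≤
        √(D.totalPenalty w) * √(D.totalPenalty v) := by
  have hc := hP.c_pos
  have hC := hP.C_pos
  have hd0 : 0 < d := by omega
  obtain ⟨C₁, hC₁, hstab⟩ := exists_stab_bound hd hP el k r hσ0 hθ C'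
  obtain ⟨A, hA, hsurf⟩ := exists_surface_bound hd0 N L
  obtain ⟨m, hm, hcard⟩ := Trimmed.exists_card_source_le hd hP hσ0 C'
  set τ := C * σ ^ 2 / c with hτ
  have hτ0 : 0 < τ := by positivity
  set κ := (c / (σ * C)) ^ d with hκ
  have hκ0 : 0 < κ := by positivity
  -- A bounds the area of the boundary piece, τ^d/κ compares h_K^d with the volume of the source
  -- element, and C₁ bounds the stabilized gradient. The number m of elements per source enters in
  -- the sum.
  set C₂ := A * τ ^ d / κ * C₁ with hC₂
  have hC₂0 : 0 < C₂ := by positivity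
  refine ⟨√(C₂ * m), by positivity, fun D hD w hw v hv => ?_⟩
  have hT := hD.refines
  have henergy0 : ∀ z i, 0 ≤ D.energy z i := fun z i => integral_nonneg fun y => by positivity
  have hfrobint : ∀ z ∈ D.velocity el k r,
      IntegrableOn (fun x => frob (fderiv ℝ z x) (fderiv ℝ z x)) D.Ω := by
    intro z hz
    refine Trimmed.integrableOn_Ω hP hT fun j => ?_
    obtain ⟨H, hH, hHeq⟩ := (hstab D N L hD z hz j).2.1
    refine ⟨fun x => frob (H x) (H x), ?_, fun x hx => by simp only [hHeq hx]⟩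
    simp only [frob_self]
    exact continuousOn_finsetSum _ fun l _ => (hH.clm_apply continuousOn_const).norm.pow 2
  have hnormint : ∀ z ∈ D.velocity el k r, IntegrableOn (fun x => ‖fderiv ℝ z x‖ ^ 2) D.Ω := by
    intro z hz
    refine Trimmed.integrableOn_Ω hP hT fun j => ?_
    obtain ⟨H, hH, hHeq⟩ := (hstab D N L hD z hz j).2.1
    exact ⟨fun x => ‖H x‖ ^ 2, hH.norm.pow 2, fun x hx => by simp only [hHeq hx]⟩
  have hΓ := Trimmed.measure_Γ_le hP hD hsurf
  have hΓfin : ∀ j, (μHE[d - 1] : Measure (E d)) (D.Γ j) < ∞ := fun j =>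
    (hΓ j).trans_lt ENNReal.ofReal_lt_top
  have hbval : ∀ z ∈ D.velocity el k r, ∀ j, Integrable
      (fun x => (D.h j)⁻¹ * ‖D.bval j z x‖ ^ 2)
      ((μHE[d - 1] : Measure (E d)).restrict (D.Γ j)) := by
    intro z hz j
    obtain ⟨u, hu, hzu⟩ := (hstab D N L hD z hz j).1
    exact Trimmed.integrable_bval hP hD j (hΓfin j) hu hzu _
  have hh : ∀ j, 0 < D.h j := Trimmed.h_pos hP hd0
  refine ⟨?_, ?_, ?_⟩
  · exact abs_integral_le_sqrt_mul_sqrt (hfrobint w hw) (hfrobint v hv)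
      (fun x => frob_self_nonneg _) (fun x => frob_self_nonneg _)
      (Eventually.of_forall fun x => abs_frob_le _ _)
  · have hcell : ∀ j, |∫ x in D.Γ j, inner ℝ (D.stabNormalDeriv el k θ j w x) (D.bval j v x)
        ∂μHE[d - 1]| ≤ √(C₂ * D.energy w (D.source θ j)) * √(D.penalty v j) := by
      intro j
      obtain ⟨G, hG, hGeq, hGle⟩ := (hstab D N L hD w hw j).2.2
      set s := D.source θ j with hs
      have hV := Trimmed.volume_K_pos hP hT s
      set V := volume.real (D.K s) with hVdef
      set M := √(C₁ * D.energy w s / V) with hM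
      have hM0 : 0 ≤ M := Real.sqrt_nonneg _
      have hen := henergy0 w s
      have hM2 : M ^ 2 * V = C₁ * D.energy w s := by
        rw [hM, Real.sq_sqrt (by positivity), div_mul_cancel₀ _ hV.ne']
      have hsub : closure (D.K j ∩ D.Ω) ⊆ closure (D.K j) := closure_mono Set.inter_subset_left
      -- The pointwise bound on K ∩ Ω passes to its closure by continuity, which is where the
      -- boundary integral lives.
      have hGM : ∀ x ∈ closure (D.K j ∩ D.Ω), ‖G x‖ ≤ M := by
        intro x hx
        have hmaps : Set.MapsTo G (D.K j ∩ D.Ω) (Metric.closedBall 0 M) := by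
          intro y hy
          rw [mem_closedBall_zero_iff]
          refine Real.le_sqrt_of_sq_le ?_
          rw [le_div_iff₀ hV]
          exact hGle y hy
        have h1 := hmaps.closure_of_continuousOn (hG.mono hsub) hx
        rwa [Metric.isClosed_closedBall.closure_eq, mem_closedBall_zero_iff] at h1
      -- The weights h and h⁻¹ are inserted so that the second factor becomes the integrand of the
      -- penalty.
      have hpt : ∀ x ∈ closure (D.K j ∩ D.Ω),
          |inner ℝ (D.stabNormalDeriv el k θ j w x) (D.bval j v x)| ≤
            √(D.h j * M ^ 2) * √((D.h j)⁻¹ * ‖D.bval j v x‖ ^ 2) := by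
        intro x hx
        have h1 : D.stabNormalDeriv el k θ j w x = G x (outerNormal D.Ω x) := by
          rw [Trimmed.stabNormalDeriv, trace_eq (hG.mono hsub) hGeq hx]
        have h2 : ‖D.stabNormalDeriv el k θ j w x‖ ≤ M := by
          rw [h1]
          refine ((G x).le_opNorm _).trans ?_
          calc ‖G x‖ * ‖outerNormal D.Ω x‖ ≤ M * 1 :=
                mul_le_mul (hGM x hx) (norm_outerNormal_le _ _) (norm_nonneg _) hM0
            _ = M := mul_one _
        have hhj := hh j
        rw [← Real.sqrt_mul (by positivity)]
        have h3 : D.h j * M ^ 2 * ((D.h j)⁻¹ * ‖D.bval j v x‖ ^ 2) =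
            (M * ‖D.bval j v x‖) ^ 2 := by
          field_simp
        rw [h3, Real.sqrt_sq (by positivity)]
        exact (abs_real_inner_le_norm _ _).trans (by gcongr)
      have hfinm : IsFiniteMeasure ((μHE[d - 1] : Measure (E d)).restrict (D.Γ j)) := ⟨by
        rw [Measure.restrict_apply_univ]
        exact hΓfin j⟩
      have hhj := hh j
      refine (abs_integral_le_sqrt_mul_sqrt (integrable_const (D.h j * M ^ 2)) (hbval v hv j)
        (fun x => by positivity) (fun x => by positivity)
        (Trimmed.ae_restrict_Γ hP hD j hpt)).trans ?_
      refine mul_le_mul_of_nonneg_right (Real.sqrt_le_sqrt ?_) (Real.sqrt_nonneg _)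
      rw [integral_const, smul_eq_mul, measureReal_def, Measure.restrict_apply_univ]
      have h4 : ((μHE[d - 1] : Measure (E d)) (D.Γ j)).toReal ≤ A * D.h j ^ (d - 1) :=
        ENNReal.toReal_le_of_le_ofReal (by positivity) (hΓ j)
      have h5 : D.h j ^ d ≤ τ ^ d / κ * V := by
        have h6 := Trimmed.h_le_h hP hd hD.shapeRegular j s
        have h7 := Trimmed.le_volume_K' hP hT hd0 hD.shapeRegular s
        have hhs := hh s
        calc D.h j ^ d ≤ (τ * D.h s) ^ d := by gcongr
          _ = τ ^ d / κ * (κ * D.h s ^ d) := by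
            rw [mul_pow]
            field_simp
          _ ≤ τ ^ d / κ * V := by gcongr
      -- The area h^(d-1) and the weight h combine to h^d, which is comparable to the volume of the
      -- source element.
      calc ((μHE[d - 1] : Measure (E d)) (D.Γ j)).toReal * (D.h j * M ^ 2)
          ≤ A * D.h j ^ (d - 1) * (D.h j * M ^ 2) := by gcongr
        _ = A * M ^ 2 * D.h j ^ d := by
            rw [← mul_pow_sub_one hd0.ne' (D.h j)]
            ring
        _ ≤ A * M ^ 2 * (τ ^ d / κ * V) := by gcongr
        _ = A * τ ^ d / κ * (M ^ 2 * V) := by ring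
        _ = C₂ * D.energy w s := by
            rw [hM2, hC₂]
            ring
    refine (Trimmed.abs_bdryIntegral_le (fun j => mul_nonneg hC₂0.le (henergy0 w _))
      (fun j => Trimmed.penalty_nonneg v j) hcell).trans ?_
    change _ * √(D.totalPenalty v) ≤ _
    refine mul_le_mul_of_nonneg_right ?_ (Real.sqrt_nonneg _)
    rw [← Real.sqrt_mul (by positivity)]
    refine Real.sqrt_le_sqrt ?_
    rw [← Finset.mul_sum, mul_assoc C₂ m]
    refine mul_le_mul_of_nonneg_left ?_ hC₂0.le
    refine (Trimmed.sum_energy_source_le w (hcard D θ N L hD)).trans ?_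
    refine mul_le_mul_of_nonneg_left ?_ hm.le
    refine (Trimmed.sum_setIntegral hP hT (hnormint w hw)).le.trans ?_
    exact integral_mono (hnormint w hw) (hfrobint w hw) fun x => sq_norm_le_frob _
  · refine Trimmed.abs_bdryIntegral_le (fun j => Trimmed.penalty_nonneg w j)
      (fun j => Trimmed.penalty_nonneg v j) fun j => ?_
    have hhj := hh j
    refine abs_integral_le_sqrt_mul_sqrt (hbval w hw j) (hbval v hv j)
      (fun x => by positivity) (fun x => by positivity) (Eventually.of_forall fun x => ?_)
    rw [← Real.sqrt_mul (by positivity)]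
    have h3 : (D.h j)⁻¹ * ‖D.bval j w x‖ ^ 2 * ((D.h j)⁻¹ * ‖D.bval j v x‖ ^ 2) =
        ((D.h j)⁻¹ * (‖D.bval j w x‖ * ‖D.bval j v x‖)) ^ 2 := by
      ring
    rw [h3, Real.sqrt_sq (by positivity), abs_mul, abs_of_pos (inv_pos.2 hhj)]
    gcongr
    exact abs_real_inner_le_norm _ _

end TrimmedStokes

/-! ### Coercivity and continuity of the stabilized form. -/

theorem mainTheorem10 {d : ℕ} (hd : d = 2 ∨ d = 3) (P : TrimmedStokes.Patch d)
    (el : TrimmedStokes.StokesElement) (k r : ℕ) (hr : r < k)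
    (μ : ℝ) (hμ : 0 < μ) (θ : ℝ) (hθ : θ ∈ Set.Ioc (0 : ℝ) 1)
    (σ C : ℝ) (N : ℕ) (L : ℝ≥0) :
    ∃ γbar > 0, ∃ α > 0,
      (∀ γ ≥ γbar, ∀ D : TrimmedStokes.Trimmed P, D.Admissible σ θ C N L →
        ∀ v ∈ D.velocity el k r,
          α * D.norm1h μ v ^ 2 ≤ D.stabForm el k μ θ γ v v) ∧
      (∀ γ ≥ γbar, ∃ M > 0, ∀ D : TrimmedStokes.Trimmed P, D.Admissible σ θ C N L →
        ∀ w ∈ D.velocity el k r, ∀ v ∈ D.velocity el k r,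
          |D.stabForm el k μ θ γ w v| ≤ M * D.norm1h μ w * D.norm1h μ v) := by
  have hd2 : 2 ≤ d := by omega
  obtain ⟨c₀, C₀, hP⟩ := P.exists_biLipWith
  obtain ⟨B, hB, hform⟩ := TrimmedStokes.exists_form_bounds hd2 hP el k r
    (σ := max σ 1) (by positivity) hθ C N L
  -- By symmetry of the inner product, the second consistency term is the first with w and v
  -- exchanged, so one bound serves both.
  have hsplit : ∀ (γ : ℝ) (D : TrimmedStokes.Trimmed P)
      (w v : TrimmedStokes.E d → TrimmedStokes.E d), D.stabForm el k μ θ γ w v =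
        μ * (∫ x in D.Ω, TrimmedStokes.frob (fderiv ℝ w x) (fderiv ℝ v x))
        - μ * (D.bdryIntegral fun j x =>
            inner ℝ (D.stabNormalDeriv el k θ j w x) (D.bval j v x))
        - μ * (D.bdryIntegral fun j x =>
            inner ℝ (D.stabNormalDeriv el k θ j v x) (D.bval j w x))
        + γ * D.bdryIntegral fun j x => (D.h j)⁻¹ * inner ℝ (D.bval j w x) (D.bval j v x) := by
    intro γ D w v
    simp only [TrimmedStokes.Trimmed.stabForm, TrimmedStokes.Trimmed.bdryIntegral_const_mul μ,
      integral_const_mul, real_inner_comm (D.stabNormalDeriv el k θ _ v _)]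
  -- From 2Bab ≤ a²/2 + 2B²b², the consistency terms cost half of the gradient term and 2μB² of the
  -- penalty. The remaining μ/2 of the penalty matches α = 1/2.
  refine ⟨2 * μ * B ^ 2 + μ / 2, by positivity, 1 / 2, by norm_num, ?_, ?_⟩
  · intro γ hγ D hD v hv
    obtain ⟨-, h2, -⟩ := hform D (hD.mono (le_max_left _ _)) v hv v hv
    have hA0 := TrimmedStokes.Trimmed.dirichlet_nonneg (D := D) v
    have hB0 := TrimmedStokes.Trimmed.totalPenalty_nonneg (D := D) v
    have hA : (∫ x in D.Ω, TrimmedStokes.frob (fderiv ℝ v x) (fderiv ℝ v x)) = D.dirichlet v := rfl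
    have hBv : (D.bdryIntegral fun j x => (D.h j)⁻¹ * inner ℝ (D.bval j v x) (D.bval j v x)) =
        D.totalPenalty v := by
      simp only [real_inner_self_eq_norm_sq]
      rfl
    rw [hsplit, TrimmedStokes.Trimmed.norm1h_sq hμ, hA, hBv]
    set I := D.bdryIntegral fun j x => inner ℝ (D.stabNormalDeriv el k θ j v x) (D.bval j v x)
    set a := √(D.dirichlet v) with ha
    set b := √(D.totalPenalty v) with hb
    have ha2 : D.dirichlet v = a ^ 2 := (Real.sq_sqrt hA0).symm
    have hb2 : D.totalPenalty v = b ^ 2 := (Real.sq_sqrt hB0).symm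
    rw [ha2, hb2]
    have hI : I ≤ B * a * b := (le_abs_self I).trans h2
    have h3 : 2 * (μ * I) ≤ μ * (a ^ 2 / 2 + 2 * B ^ 2 * b ^ 2) := by
      have h4 : 2 * I ≤ a ^ 2 / 2 + 2 * B ^ 2 * b ^ 2 := by
        nlinarith [sq_nonneg (a - 2 * B * b)]
      nlinarith
    have h5 : (2 * μ * B ^ 2 + μ / 2) * b ^ 2 ≤ γ * b ^ 2 :=
      mul_le_mul_of_nonneg_right hγ (sq_nonneg b)
    linarith
  · intro γ hγ
    have hγ0 : 0 < γ := lt_of_lt_of_le (by positivity) hγ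
    -- The gradient term contributes 1, each consistency term B, and the penalty γ/μ, because the
    -- norm weights the boundary term by μ.
    refine ⟨1 + 2 * B + γ / μ, by positivity, fun D hD w hw v hv => ?_⟩
    obtain ⟨h1, h2, h3⟩ := hform D (hD.mono (le_max_left _ _)) w hw v hv
    obtain ⟨-, h2', -⟩ := hform D (hD.mono (le_max_left _ _)) v hv w hw
    have hbd : ∀ z, √μ * √(D.dirichlet z) ≤ D.norm1h μ z ∧
        √μ * √(D.totalPenalty z) ≤ D.norm1h μ z := by
      intro z
      have hA0 := TrimmedStokes.Trimmed.dirichlet_nonneg (D := D) z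
      have hB0 := TrimmedStokes.Trimmed.totalPenalty_nonneg (D := D) z
      have hn := TrimmedStokes.Trimmed.norm1h_sq hμ (D := D) z
      have hn0 := TrimmedStokes.Trimmed.norm1h_nonneg (D := D) μ z
      rw [← Real.sqrt_mul hμ.le, ← Real.sqrt_mul hμ.le]
      constructor
      · refine Real.sqrt_le_iff.2 ⟨hn0, ?_⟩
        rw [hn]
        nlinarith
      · refine Real.sqrt_le_iff.2 ⟨hn0, ?_⟩
        rw [hn]
        nlinarith
    have hprod : ∀ s t X Y : ℝ, 0 ≤ s → 0 ≤ t → √μ * s ≤ X → √μ * t ≤ Y → μ * (s * t) ≤ X * Y := by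
      intro s t X Y hs ht hX hY
      calc μ * (s * t) = (√μ * s) * (√μ * t) := by
            rw [mul_mul_mul_comm, Real.mul_self_sqrt hμ.le]
        _ ≤ X * Y := mul_le_mul hX hY (by positivity) (le_trans (by positivity) hX)
    set X := D.norm1h μ w
    set Y := D.norm1h μ v
    have e1 := hprod _ _ X Y (Real.sqrt_nonneg _) (Real.sqrt_nonneg _) (hbd w).1 (hbd v).1
    have e2 := hprod _ _ X Y (Real.sqrt_nonneg _) (Real.sqrt_nonneg _) (hbd w).1 (hbd v).2
    have e3 := hprod _ _ Y X (Real.sqrt_nonneg _) (Real.sqrt_nonneg _) (hbd v).1 (hbd w).2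
    have e4 := hprod _ _ X Y (Real.sqrt_nonneg _) (Real.sqrt_nonneg _) (hbd w).2 (hbd v).2
    rw [hsplit]
    generalize (∫ x in D.Ω, TrimmedStokes.frob (fderiv ℝ w x) (fderiv ℝ v x)) = I₁ at *
    generalize (D.bdryIntegral fun j x =>
      inner ℝ (D.stabNormalDeriv el k θ j w x) (D.bval j v x)) = I₂ at *
    generalize (D.bdryIntegral fun j x =>
      inner ℝ (D.stabNormalDeriv el k θ j v x) (D.bval j w x)) = I₃ at *
    generalize (D.bdryIntegral fun j x =>
      (D.h j)⁻¹ * inner ℝ (D.bval j w x) (D.bval j v x)) = I₄ at *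
    have f1 : μ * |I₁| ≤ X * Y := (mul_le_mul_of_nonneg_left h1 hμ.le).trans e1
    have f2 : μ * |I₂| ≤ B * (X * Y) := by
      refine (mul_le_mul_of_nonneg_left h2 hμ.le).trans ?_
      calc μ * (B * √(D.dirichlet w) * √(D.totalPenalty v)) =
            B * (μ * (√(D.dirichlet w) * √(D.totalPenalty v))) := by ring
        _ ≤ B * (X * Y) := by gcongr
    have f3 : μ * |I₃| ≤ B * (X * Y) := by
      refine (mul_le_mul_of_nonneg_left h2' hμ.le).trans ?_
      calc μ * (B * √(D.dirichlet v) * √(D.totalPenalty w)) =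
            B * (μ * (√(D.dirichlet v) * √(D.totalPenalty w))) := by ring
        _ ≤ B * (Y * X) := by gcongr
        _ = B * (X * Y) := by ring
    have f4 : γ * |I₄| ≤ γ / μ * (X * Y) := by
      calc γ * |I₄| ≤ γ * (√(D.totalPenalty w) * √(D.totalPenalty v)) := by gcongr
        _ = γ / μ * (μ * (√(D.totalPenalty w) * √(D.totalPenalty v))) := by field_simp
        _ ≤ γ / μ * (X * Y) := by gcongr
    calc |μ * I₁ - μ * I₂ - μ * I₃ + γ * I₄|
        ≤ |μ * I₁| + |μ * I₂| + |μ * I₃| + |γ * I₄| := by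
          refine (abs_add_le _ _).trans (add_le_add_left ?_ _)
          refine (abs_sub _ _).trans (add_le_add_left ?_ _)
          exact abs_sub _ _
      _ = μ * |I₁| + μ * |I₂| + μ * |I₃| + γ * |I₄| := by
          rw [abs_mul, abs_mul, abs_mul, abs_mul, abs_of_pos hμ, abs_of_pos hγ0]
      _ ≤ X * Y + B * (X * Y) + B * (X * Y) + γ / μ * (X * Y) := by gcongr
      _ = (1 + 2 * B + γ / μ) * X * Y := by ring
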